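/- **Setting.** Let $n\ge 2$, $p\ge 2$. Let $X=(X_1,\dots,X_p)$ be a (possibly random) $n\times p$ design matrix with $\|X_j\|^2=n$ for all $j$, and let $Y\,|\,X\sim N(X\gamma,\sigma^2 I_n)$ with $\sigma>0$; that is, the noise $Y-X\gamma$ has the $N(0,\sigma^2I_n)$ distribution and is independent of $X$ (the coefficient vector $\gamma\in\mathbb R^p$ may be random). Let $$(\hat\gamma,\hat\sigma)\in\arg\min_{g\in\mathbb R^p,\;t\ge 0}\Big\{\frac{\|Y-Xg\|^2}{2nt}+\frac t2+\lambda_0\|g\|_1\Big\}$$ be a scaled lasso estimator, where at $t=0$ the first term is $0$ if $Y=Xg$ and $\infty$ otherwise. For a (possibly random) target vector $\gamma^{\rm target}\in\mathbb R^p$ let $\sigma^{\rm ora}=\|Y-X\gamma^{\rm target}\|/\sqrt n$. For $m>0$ let $L_m(t)=m^{-1/2}\Phi^{-1}(1-t)$, $0<t<1$. For $\alpha\ge 0$ and $K\subseteq\{1,\dots,p\}$ let $$\phi_{\rm comp}(\alpha,K,X)=\inf\Big\{\frac{|K|^{1/2}\|Xu\|}{n^{1/2}\|u_K\|_1}: u\ne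 0,\ \|u_{K^c}\|_1\le\alpha\|u_K\|_1\Big\}\in[0,\infty],$$ and for $m\in\mathbb N$ let $\kappa^*(m,X)=\max\{\|Xu\|^2/n:\|u\|=1,\|u\|_0\le m\}$. Let $\delta\ge1$, $\varepsilon>0$, $A\in\mathbb R$, $0<\epsilon_1<1$, and $0<k<p/2$ be real, and let the penalty level satisfy $$(1+\varepsilon)L_{n-3/2}(k/p)\le\lambda_0\le A\sqrt{\delta(\log p)/n}.$$ Suppose $L_{n-3/2}(\epsilon_1/p)\le 1$ and $\delta s(\log p)/n\le c_0$. For a (possibly random) index set $K$, real $s_1$, and integers $s_2,s_3\ge0$, consider the conditions $$\text{(C1)}\ \ \mathbb P\Big\{|K|+\sum_{j\notin K}\frac{|\gamma^{\rm target}_j/\sigma^{\rm ora}|}{\sqrt{(2/n)\log p}}\le s_1\Big\}\ge1-\epsilon_1,\qquad \text{(C2)}\ \ \mathbb P\Big\{\max_{|J\setminus K|\le s_2}\phi_{\rm comp}^{-2}(\alpha,J,X)\le C_2\Big\}\ge1-\epsilon_1,$$ $$\text{(C3)}\ \ \mathbb P\{\kappa^*(s_3,X)\le C_3\}\ge1-\epsilon_1,\qquad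 \text{(C4)}\ \ \mathbb P\Big\{C_4\|X(\gamma^{\rm target}-\gamma)\|\le\sigma^{\rm ora}\sqrt{\log(p/\epsilon_1)}\Big\}\ge1-\epsilon_1,$$ the inequality $$\text{(E)}\quad \varepsilon_1\ge\frac{e^{1/(4n-6)^2}\,4k/s_2}{L_1^4(k/p)+2L_1^2(k/p)}+\Big(\frac{L_1(\epsilon_1/p)}{L_1(k/p)}+\frac{e^{1/(4n-6)^2}/\sqrt{2\pi}}{L_1(k/p)}\Big)\sqrt{\frac{C_3}{s_2}}$$ (where $\varepsilon_1$ is a real number, different from $\epsilon_1$), and the conclusions $$\text{(B1)}\quad \mathbb P\big\{\|X(\hat\gamma-\gamma^{\rm target})\|^2\le C_0 s(\sigma^{\rm ora})^2\delta\log p\big\}\ge1-p^{1-\delta}\epsilon_0,$$ $$\text{(B2)}\quad \mathbb P\big\{\|\hat\gamma-\gamma^{\rm target}\|_1\le C_0 s\,\sigma^{\rm ora}\sqrt{\delta(\log p)/n}\big\}\ge1-p^{1-\delta}\epsilon_0,$$ $$\text{(B3)}\quad \mathbb P\Big\{\Big|\frac{\hat\sigma}{\sigma^{\rm ora}}-1\Big|\le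 C_0 s\delta(\log p)/n\le\tfrac12\Big\}\ge1-p^{1-\delta}\epsilon_0 .$$ **Theorem.** (i) Let $\gamma^{\rm target}=\gamma$, $s\ge s_1$, $s_2=0$, $k\le\epsilon_1$, $\alpha=1+2/\varepsilon$ and $4\epsilon_1\le p^{1-\delta}\epsilon_0$. There is a constant $C_0>0$ depending on $\{\alpha,C_2,A\}$ only such that, when $C_0c_0\le1/2$, (C1) and (C2) imply (B1), (B2) and (B3). (ii) Let $\gamma^{\rm target}=\gamma$, $s\ge s_1+s_2$, $1\le s_2\le s_3$, $k\ge1$, (E) hold with $\varepsilon_1<\varepsilon$, $\alpha\ge\sqrt2(\varepsilon-\varepsilon_1)^{-1}\{1+\varepsilon+L_1(\epsilon_1/p)/L_1(k/p)\}$ and $(5+e^{1/(4n-6)^2})\epsilon_1\le p^{1-\delta}\epsilon_0$. There is a constant $C_0>0$ depending on $\{\alpha,\varepsilon,\varepsilon_1,C_2,A\}$ only such that, when $C_0c_0\le1/2$, (C1), (C2) and (C3) imply (B1), (B2) and (B3). (iii) Let $\gamma^{\rm target}$ be arbitrary, $s\ge s_1+s_2$, $1\le s_2\le s_3$, $k\ge1$,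 (E) hold, $\varepsilon_1<\varepsilon_2<\varepsilon$, $\alpha\ge2(\varepsilon-\varepsilon_2)^{-1}\{1+\varepsilon+L_1(\epsilon_1/p)/L_1(k/p)\}$, $(6+e^{1/(4n-6)^2})\epsilon_1\le p^{1-\delta}\epsilon_0$ and $C_4\ge\sqrt{(4/L_1^2(k/p))\log(p/\epsilon_1)}\,/\min(\sqrt2-1,\varepsilon_2-\varepsilon_1)$. There is a constant $C_0>0$ depending on $\{\alpha,\varepsilon,\varepsilon_2,C_2,A\}$ only such that, when $C_0c_0\le1/2$, (C1), (C2), (C3) and (C4) imply (B1), (B2) and (B3). -/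

import Mathlib

open MeasureTheory ProbabilityTheory
open scoped ENNReal

/-- The Euclidean norm of a coordinate vector. -/
noncomputable def l2norm {m : ℕ} (v : Fin m → ℝ) : ℝ := ‖WithLp.toLp 2 v‖

/-- The `ℓ₁` norm of the restriction `u_K` of a coordinate vector to an index set `K`. -/
def l1normOn {p : ℕ} (K : Finset (Fin p)) (u : Fin p → ℝ) : ℝ := ∑ j ∈ K, |u j|

/-- The `ℓ₁` norm of a coordinate vector. -/
def l1norm {p : ℕ} (u : Fin p → ℝ) : ℝ := ∑ j, |u j|

/-- The quantile function `Φ⁻¹` of the standard normal distribution (meaningful on `(0, 1)`). -/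
noncomputable def stdNormalQuantile (q : ℝ) : ℝ := sInf {x : ℝ | q ≤ cdf (gaussianReal 0 1) x}

/-- `L_m(t) = m^{-1/2} Φ⁻¹(1 - t)`, the negative quantile function of `N(0, 1/m)`, for real
`m > 0` and `0 < t < 1`. -/
noncomputable def negQuantile (m t : ℝ) : ℝ := stdNormalQuantile (1 - t) / √m

/-- Every column of the design has squared Euclidean length `n`. -/
def Standardized {n p : ℕ} (X : Matrix (Fin n) (Fin p) ℝ) : Prop :=
  ∀ j, l2norm (fun i => X i j) ^ 2 = n

/-- The scaled lasso criterion `‖Y - Xg‖² / (2 n t) + t / 2 + lam ‖g‖₁` for a scale `t ≥ 0`.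
Division in `[0, ∞]` gives the lower semicontinuous extension to `t = 0`:
the first term is `0` there if `Y = Xg`, and `∞` otherwise. -/
noncomputable def scaledLassoObjective {n p : ℕ} (X : Matrix (Fin n) (Fin p) ℝ) (Y : Fin n → ℝ)
    (lam : ℝ) (g : Fin p → ℝ) (t : ℝ) : ℝ≥0∞ :=
  ENNReal.ofReal (l2norm (Y - X.mulVec g) ^ 2) / ENNReal.ofReal (2 * n * t)
    + ENNReal.ofReal (t / 2) + ENNReal.ofReal (lam * l1norm g)

/-- `(ghat, that)` is a minimizer of the scaled lasso criterion with penalty level `lam`. -/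
def IsScaledLasso {n p : ℕ} (X : Matrix (Fin n) (Fin p) ℝ) (Y : Fin n → ℝ) (lam : ℝ)
    (ghat : Fin p → ℝ) (that : ℝ) : Prop :=
  0 ≤ that ∧ ∀ (g : Fin p → ℝ) (t : ℝ), 0 ≤ t →
    scaledLassoObjective X Y lam ghat that ≤ scaledLassoObjective X Y lam g t

/-- The oracle noise level `‖Y - X g‖ / √n` of a target coefficient vector `g`. -/
noncomputable def sigmaOra {n p : ℕ} (X : Matrix (Fin n) (Fin p) ℝ) (Y : Fin n → ℝ)
    (g : Fin p → ℝ) : ℝ :=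
  l2norm (Y - X.mulVec g) / √(n : ℝ)

/-- The compatibility constant: the infimum of `|K|^{1/2} ‖Xu‖ / (n^{1/2} ‖u_K‖₁)` over the
nonzero `u` with `‖u_{Kᶜ}‖₁ ≤ α ‖u_K‖₁`, with values in `[0, ∞]` (it is `∞` for empty `K`). -/
noncomputable def phiComp {n p : ℕ} (α : ℝ) (K : Finset (Fin p))
    (X : Matrix (Fin n) (Fin p) ℝ) : ℝ≥0∞ :=
  ⨅ (u : Fin p → ℝ) (_ : l1normOn Kᶜ u ≤ α * l1normOn K u ∧ u ≠ 0),
    ENNReal.ofReal (√(K.card : ℝ) * l2norm (X.mulVec u) / (√(n : ℝ) * l1normOn K u))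

/-- The upper sparse eigenvalue: the maximum of `‖Xu‖² / n` over the unit vectors `u` with at
most `m` nonzero coordinates. -/
noncomputable def kappaUpper {n p : ℕ} (m : ℕ) (X : Matrix (Fin n) (Fin p) ℝ) : ℝ≥0∞ :=
  ⨆ (u : Fin p → ℝ) (_ : l2norm u = 1 ∧ (Finset.univ.filter fun j => u j ≠ 0).card ≤ m),
    ENNReal.ofReal (l2norm (X.mulVec u) ^ 2 / n)

/-- `P(E) ≥ 1 - η`, written as a bound for the (outer) probability of the complement, so that
it has the intended meaning without a measurability assumption on `E`. -/
def ProbAtLeast {Ω : Type*} [MeasurableSpace Ω] (μ : Measure Ω) (E : Ω → Prop) (η : ℝ) : Prop :=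
  μ {ω | ¬ E ω} ≤ ENNReal.ofReal η

/-- The Gaussian linear model `Y | X ∼ N(Xγ, σ² I)` with a standardized, possibly random design
and a possibly random coefficient vector: the noise `Y - Xγ` is independent of `X` and its
coordinates are i.i.d. `N(0, σ²)`. -/
structure GaussianLinearModel {Ω : Type*} [MeasurableSpace Ω] (μ : Measure Ω) {n p : ℕ}
    (X : Ω → Matrix (Fin n) (Fin p) ℝ) (Y : Ω → Fin n → ℝ) (γ : Ω → Fin p → ℝ) (σ : ℝ) :
    Prop where
  sigma_pos : 0 < σ
  measurable_design : ∀ i j, Measurable fun ω => X ω i j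
  measurable_response : Measurable Y
  measurable_coef : Measurable γ
  standardized : ∀ᵐ ω ∂μ, Standardized (X ω)
  noise_indep : IndepFun (fun ω i j => X ω i j) (fun ω => Y ω - (X ω).mulVec (γ ω)) μ
  noise_law : μ.map (fun ω => Y ω - (X ω).mulVec (γ ω))
    = Measure.pi fun _ : Fin n => gaussianReal 0 (σ ^ 2).toNNReal

/-- Capped-`ℓ₁` sparsity of a target vector `g` off the index set `K`. -/
def CondSparse {n p : ℕ} (X : Matrix (Fin n) (Fin p) ℝ) (Y : Fin n → ℝ) (g : Fin p → ℝ)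
    (K : Finset (Fin p)) (s₁ : ℝ) : Prop :=
  (K.card : ℝ) + ∑ j ∈ Kᶜ, |g j / sigmaOra X Y g| / √(2 / (n : ℝ) * Real.log p) ≤ s₁

/-- Bounded compatibility constants for all `J` with `|J \ K| ≤ s₂`. -/
def CondCompat {n p : ℕ} (X : Matrix (Fin n) (Fin p) ℝ) (K : Finset (Fin p)) (α : ℝ) (s₂ : ℕ)
    (C₂ : ℝ) : Prop :=
  (⨆ (J : Finset (Fin p)) (_ : (J \ K).card ≤ s₂), (phiComp α J X ^ 2)⁻¹) ≤ ENNReal.ofReal C₂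

/-- Bounded upper sparse eigenvalue. -/
def CondEigen {n p : ℕ} (X : Matrix (Fin n) (Fin p) ℝ) (s₃ : ℕ) (C₃ : ℝ) : Prop :=
  kappaUpper s₃ X ≤ ENNReal.ofReal C₃

/-- Small bias of the target vector `g` relative to the true coefficient vector `γ`. -/
def CondBias {n p : ℕ} (X : Matrix (Fin n) (Fin p) ℝ) (Y : Fin n → ℝ) (g γ : Fin p → ℝ)
    (C₄ e₁ : ℝ) : Prop :=
  C₄ * l2norm (X.mulVec (g - γ)) ≤ sigmaOra X Y g * √(Real.log (p / e₁))

/-- The prediction, `ℓ₁` and noise level error bounds for the target vector `g`, each with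
probability at least `1 - p^{1-δ} e₀`. -/
def ErrorBounds {Ω : Type*} [MeasurableSpace Ω] (μ : Measure Ω) {n p : ℕ}
    (X : Ω → Matrix (Fin n) (Fin p) ℝ) (Y : Ω → Fin n → ℝ) (g : Ω → Fin p → ℝ)
    (ghat : Ω → Fin p → ℝ) (σhat : Ω → ℝ) (C₀ s δ e₀ : ℝ) : Prop :=
  ProbAtLeast μ (fun ω => l2norm ((X ω).mulVec (ghat ω - g ω)) ^ 2
      ≤ C₀ * s * sigmaOra (X ω) (Y ω) (g ω) ^ 2 * δ * Real.log p) ((p : ℝ) ^ (1 - δ) * e₀) ∧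
  ProbAtLeast μ (fun ω => l1norm (ghat ω - g ω)
      ≤ C₀ * s * sigmaOra (X ω) (Y ω) (g ω) * √(δ * Real.log p / n)) ((p : ℝ) ^ (1 - δ) * e₀) ∧
  ProbAtLeast μ (fun ω => |σhat ω / sigmaOra (X ω) (Y ω) (g ω) - 1|
        ≤ C₀ * s * δ * Real.log p / n ∧
      C₀ * s * δ * Real.log p / n ≤ 1 / 2) ((p : ℝ) ^ (1 - δ) * e₀)

/-- The assumptions common to all versions of the result: the scaled lasso with penalty level
`(1 + ε) L_{n-3/2}(k/p) ≤ lam ≤ A (δ log p / n)^{1/2}` in a Gaussian linear model, and the ranges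
of the parameters. The condition `k < p/2` says that the quantile `L₁(k/p)` is positive. -/
structure LassoSetting {Ω : Type*} [MeasurableSpace Ω] (μ : Measure Ω) {n p : ℕ}
    (X : Ω → Matrix (Fin n) (Fin p) ℝ) (Y : Ω → Fin n → ℝ) (γ : Ω → Fin p → ℝ) (σ : ℝ)
    (ghat : Ω → Fin p → ℝ) (σhat : Ω → ℝ) (lam A ε k δ s c₀ e₁ : ℝ) : Prop where
  two_le_n : 2 ≤ n
  two_le_p : 2 ≤ p
  model : GaussianLinearModel μ X Y γ σ
  estimator : ∀ᵐ ω ∂μ, IsScaledLasso (X ω) (Y ω) lam (ghat ω) (σhat ω)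
  eps_pos : 0 < ε
  k_pos : 0 < k
  k_lt : k < p / 2
  penalty_ge : (1 + ε) * negQuantile (n - 3 / 2) (k / p) ≤ lam
  penalty_le : lam ≤ A * √(δ * Real.log p / n)
  one_le_delta : 1 ≤ δ
  e₁_pos : 0 < e₁
  e₁_lt_one : e₁ < 1
  lamStar_le_one : negQuantile (n - 3 / 2) (e₁ / p) ≤ 1
  sample_size : δ * s * Real.log p / n ≤ c₀

/-- The lower bound required of `ε₁` for the smaller penalty levels. -/
noncomputable def epsOneBound (n p : ℕ) (k e₁ C₃ : ℝ) (s₂ : ℕ) : ℝ :=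
  Real.exp (1 / (4 * (n : ℝ) - 6) ^ 2) * (4 * k / s₂)
      / (negQuantile 1 (k / p) ^ 4 + 2 * negQuantile 1 (k / p) ^ 2)
    + (negQuantile 1 (e₁ / p) / negQuantile 1 (k / p)
        + Real.exp (1 / (4 * (n : ℝ) - 6) ^ 2) / √(2 * Real.pi) / negQuantile 1 (k / p))
      * √(C₃ / s₂)

/-! Write S(g) = ‖Y - Xg‖/√n. For fixed g the best scale is t = S(g), so σ̂ is the residual size and
γ̂ minimises the convex function S(g) + λ₀‖g‖₁ (`IsScaledLasso.sigmaOra_add_le`). From there on the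
argument is deterministic, given bounds on the correlations of the target's residual vector with the
columns, measured in units of n S. By convexity it is enough to treat perturbations w with λ₀‖w‖₁ ≤
S. For these ‖Xw‖² is at most linear in ‖w‖₁, and the compatibility constant turns this into a bound
on ‖w‖₁ of order s λ₀ S (`IsScaledLasso.error_bounds`).

Write ℓ = L_{n-3/2}(k/p). In (i) every correlation is below ℓ, and w lies in the cone of aperture α
up to an additive error due to the coefficients off K. The aperture leaves no slack, so
compatibility has to be extended to a neighbourhood of the cone
(`CondCompat.sqrt_mul_l1normOn_le_of_relaxed`). In (ii) the penalty need not dominate the largest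
correlation. Add to K the s₂ largest coordinates of w off K to form J. If w violates the cone
condition on J, its coordinates off J, divided by their ℓ₁ norm, are weights of size at most 1/(α
s₂). Then only weighted averages of correlations matter, and these stay below the penalty
(`l1norm_le_of_average`). In (iii) the bias moves each of these bounds by a small multiple of ℓ.

For the probabilities, fix X. The events are unchanged when the noise is rescaled, so they concern a
uniform random direction. A single projection has a smaller tail than N(0, 1/(n - 3/2))
(`stdGaussian_direction_inner_tail`); this rests on a comparison of two tails whose difference has a
derivative with only one sign change (`ratioTail_le`). The largest weighted average is a gauge with
Lipschitz constant √(C₃/s₂), by the sparse eigenvalue bound. Its mean is bounded through the excess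
over a threshold (`integral_averageGauge_le`), its fluctuation by concentration on the sphere
(`stdGaussian_direction_tail`).

Concentration on the sphere follows from Gaussian concentration by Jensen's inequality over the
norm, which is independent of the direction and whose squared mean is at least n - 1/2
(`sub_half_le_chiMean_sq`). Gaussian concentration with the sharp constant follows from the
Prékopa–Leindler inequality (`lintegral_exp_le_of_lipschitz`). -/

/-! ### Brunn–Minkowski and Prékopa–Leindler on the line. -/

/-- One-dimensional Brunn–Minkowski inequality, for any set containing the Minkowski sum. -/
theorem volume_add_le_of_forall_add_mem {A B C : Set ℝ} (hA : MeasurableSet A)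
    (hB : MeasurableSet B) (hA' : A.Nonempty) (hB' : B.Nonempty)
    (h : ∀ a ∈ A, ∀ b ∈ B, a + b ∈ C) : volume A + volume B ≤ volume C := by
  rw [hA.measure_eq_iSup_isCompact, hB.measure_eq_iSup_isCompact]
  simp_rw [iSup_and']
  refine ENNReal.biSup_add_biSup_le' ⟨∅, by simp⟩ ⟨∅, by simp⟩ ?_
  rintro K ⟨hKA, hK⟩ K' ⟨hKB, hK'⟩
  rcases K.eq_empty_or_nonempty with rfl | hne
  · obtain ⟨a, ha⟩ := hA'
    rw [measure_empty, zero_add, ← measure_preimage_add volume (-a) K']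
    refine measure_mono fun x hx => ?_
    simpa using h a ha _ (hKB hx)
  rcases K'.eq_empty_or_nonempty with rfl | hne'
  · obtain ⟨b, hb⟩ := hB'
    rw [measure_empty, add_zero, ← measure_preimage_add volume (-b) K]
    refine measure_mono fun x hx => ?_
    simpa using h _ (hKA hx) b hb
  -- Translate `K` by the least point of `K'`, and `K'` by the greatest point of `K`. Both
  -- translates lie in `C`, and they can meet only at `a + b`.
  obtain ⟨a, ha, ha'⟩ := hK.exists_isGreatest hne
  obtain ⟨b, hb, hb'⟩ := hK'.exists_isLeast hne'
  rw [← measure_preimage_add volume (-b) K, ← measure_preimage_add volume (-a) K',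
    ← measure_union₀ ?_ ?_]
  · refine measure_mono ?_
    rintro x (hx | hx)
    · simpa using h _ (hKA hx) b (hKB hb)
    · simpa using h a (hKA ha) _ (hKB hx)
  · exact ((measurable_const_add (-a)) hK'.measurableSet).nullMeasurableSet
  · refine measure_mono_null (t := {a + b}) ?_ (by simp)
    rintro x ⟨hx, hx'⟩
    have h1 := ha' hx
    have h2 := hb' hx'
    simp only [Set.mem_singleton_iff]
    linarith

theorem ENNReal.rpow_mul_rpow_le_weighted_add {t : ℝ} (ht0 : 0 < t) (ht1 : t < 1) (x y : ℝ≥0∞) :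
    x ^ (1 - t) * y ^ t ≤ ENNReal.ofReal (1 - t) * x + ENNReal.ofReal t * y := by
  have h1t : 0 < 1 - t := by linarith
  have hc : (1 / (1 - t)).HolderConjugate (1 / t) :=
    (Real.holderConjugate_iff).2 ⟨by rw [lt_div_iff₀ h1t]; linarith, by simp⟩
  have := ENNReal.young_inequality (x ^ (1 - t)) (y ^ t) hc
  rw [← ENNReal.rpow_mul, ← ENNReal.rpow_mul, mul_one_div_cancel h1t.ne', mul_one_div_cancel ht0.ne',
    ENNReal.rpow_one, ENNReal.rpow_one, ENNReal.div_eq_inv_mul, ENNReal.div_eq_inv_mul,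
    ← ENNReal.ofReal_inv_of_pos (by positivity), ← ENNReal.ofReal_inv_of_pos (by positivity)] at this
  simpa using this

/-- The dilated level sets of `f` and `g` add up inside the level set of `h`, so Brunn–Minkowski
applies. Both level sets must be nonempty, which is why suprema are normalised before this is used.
-/
theorem volume_level_set_concave {t : ℝ} (ht0 : 0 < t) (ht1 : t < 1) {f g h : ℝ → ℝ}
    (hf : Measurable f) (hg : Measurable g) {l : ℝ} (hl : 0 < l)
    (hf' : ∃ x, l < f x) (hg' : ∃ x, l < g x)
    (H : ∀ x y, f x ^ (1 - t) * g y ^ t ≤ h ((1 - t) * x + t * y)) :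
    ENNReal.ofReal (1 - t) * volume {x | l < f x} + ENNReal.ofReal t * volume {x | l < g x}
      ≤ volume {x | l < h x} := by
  have h1t : 0 < 1 - t := by linarith
  have e1 := Real.volume_preimage_mul_left (inv_ne_zero h1t.ne') {x | l < f x}
  have e2 := Real.volume_preimage_mul_left (inv_ne_zero ht0.ne') {x | l < g x}
  rw [inv_inv, abs_of_pos h1t] at e1
  rw [inv_inv, abs_of_pos ht0] at e2
  rw [← e1, ← e2]
  refine volume_add_le_of_forall_add_mem ?_ ?_ ?_ ?_ ?_
  · exact (measurable_const_mul _) (measurableSet_lt measurable_const hf)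
  · exact (measurable_const_mul _) (measurableSet_lt measurable_const hg)
  · obtain ⟨x, hx⟩ := hf'
    exact ⟨(1 - t) * x, by simpa [h1t.ne'] using hx⟩
  · obtain ⟨x, hx⟩ := hg'
    exact ⟨t * x, by simpa [ht0.ne'] using hx⟩
  · intro a ha b hb
    simp only [Set.mem_preimage, Set.mem_ofPred_eq] at ha hb ⊢
    have := H ((1 - t)⁻¹ * a) (t⁻¹ * b)
    rw [mul_inv_cancel_left₀ h1t.ne', mul_inv_cancel_left₀ ht0.ne'] at this
    refine lt_of_lt_of_le ?_ this
    calc l = l ^ (1 - t) * l ^ t := by rw [← Real.rpow_add hl]; simp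
      _ < _ := by
        refine mul_lt_mul'' (Real.rpow_lt_rpow hl.le ha h1t) (Real.rpow_lt_rpow hl.le hb ht0) ?_ ?_
        all_goals positivity

/-- Prékopa–Leindler on the line, for functions with supremum one. -/
theorem weighted_lintegral_le_of_iSup_eq_one {t : ℝ} (ht0 : 0 < t) (ht1 : t < 1)
    {f g h : ℝ → ℝ≥0∞} (hf : Measurable f) (hg : Measurable g) (hh : Measurable h)
    (hf1 : ⨆ x, f x = 1) (hg1 : ⨆ x, g x = 1)
    (H : ∀ x y, f x ^ (1 - t) * g y ^ t ≤ h ((1 - t) * x + t * y)) :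
    ENNReal.ofReal (1 - t) * (∫⁻ x, f x) + ENNReal.ofReal t * (∫⁻ x, g x) ≤ ∫⁻ x, h x := by
  have h1t : 0 < 1 - t := by linarith
  have hfle : ∀ x, f x ≤ 1 := fun x => hf1 ▸ le_iSup f x
  have hgle : ∀ x, g x ≤ 1 := fun x => hg1 ▸ le_iSup g x
  have hft : ∀ x, f x ≠ ⊤ := fun x => ne_top_of_le_ne_top ENNReal.one_ne_top (hfle x)
  have hgt : ∀ x, g x ≠ ⊤ := fun x => ne_top_of_le_ne_top ENNReal.one_ne_top (hgle x)
  -- Truncation at one makes `h` finite for the layer-cake formula. It is harmless because `f` and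
  -- `g`, hence the left side of `H`, are at most one.
  have hm : Measurable fun x => min (h x) 1 := hh.min measurable_const
  have hmt : ∀ x, min (h x) 1 ≠ ⊤ := fun x => ne_top_of_le_ne_top ENNReal.one_ne_top (min_le_right _ _)
  have key : ∀ l : ℝ, 0 < l → ENNReal.ofReal (1 - t) * volume {x | l < (f x).toReal}
      + ENNReal.ofReal t * volume {x | l < (g x).toReal} ≤ volume {x | l < (min (h x) 1).toReal} := by
    intro l hl
    rcases le_or_gt 1 l with h1 | h1
    · have e1 : {x | l < (f x).toReal} = ∅ := by
        ext x
        simpa using (ENNReal.toReal_mono ENNReal.one_ne_top (hfle x)).trans (by simpa using h1)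
      have e2 : {x | l < (g x).toReal} = ∅ := by
        ext x
        simpa using (ENNReal.toReal_mono ENNReal.one_ne_top (hgle x)).trans (by simpa using h1)
      simp [e1, e2]
    · have hl1 : ENNReal.ofReal l < 1 := by simpa using h1
      refine volume_level_set_concave ht0 ht1 hf.ennreal_toReal hg.ennreal_toReal hl ?_ ?_ ?_
      · rw [← hf1] at hl1
        obtain ⟨x, hx⟩ := lt_iSup_iff.1 hl1
        exact ⟨x, (ENNReal.ofReal_lt_iff_lt_toReal hl.le (hft x)).1 hx⟩
      · rw [← hg1] at hl1
        obtain ⟨x, hx⟩ := lt_iSup_iff.1 hl1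
        exact ⟨x, (ENNReal.ofReal_lt_iff_lt_toReal hl.le (hgt x)).1 hx⟩
      · intro x y
        rw [ENNReal.toReal_rpow, ENNReal.toReal_rpow, ← ENNReal.toReal_mul]
        refine ENNReal.toReal_mono (hmt _) (le_min (H x y) ?_)
        calc f x ^ (1 - t) * g y ^ t ≤ 1 ^ (1 - t) * 1 ^ t := by
              gcongr
              · exact hfle x
              · exact hgle y
          _ = 1 := by simp
  have lc : ∀ {u : ℝ → ℝ≥0∞}, Measurable u → (∀ x, u x ≠ ⊤) →
      ∫⁻ x, u x = ∫⁻ l in Set.Ioi (0 : ℝ), volume {x | l < (u x).toReal} := by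
    intro u hu hut
    rw [← lintegral_eq_lintegral_meas_lt volume (Filter.Eventually.of_forall fun x => by simp)
      hu.ennreal_toReal.aemeasurable]
    exact lintegral_congr fun x => (ENNReal.ofReal_toReal (hut x)).symm
  have hle : ∫⁻ x, min (h x) 1 ≤ ∫⁻ x, h x := lintegral_mono fun x => min_le_left _ _
  refine le_trans ?_ hle
  rw [lc hf hft, lc hg hgt, lc hm hmt, ← lintegral_const_mul', ← lintegral_const_mul']
  rotate_left
  · simp
  · simp
  rw [← lintegral_add_left']
  · refine setLIntegral_mono' measurableSet_Ioi fun l hl => key l hl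
  · refine AEMeasurable.const_mul (Antitone.measurable fun a b hab => ?_).aemeasurable _
    exact measure_mono fun x hx => lt_of_le_of_lt hab hx

/-- Prékopa–Leindler on the line, for bounded functions. -/
theorem prekopa_leindler_of_bounded {t : ℝ} (ht0 : 0 < t) (ht1 : t < 1)
    {f g h : ℝ → ℝ≥0∞} (hf : Measurable f) (hg : Measurable g) (hh : Measurable h)
    (hfb : ⨆ x, f x ≠ ⊤) (hgb : ⨆ x, g x ≠ ⊤)
    (H : ∀ x y, f x ^ (1 - t) * g y ^ t ≤ h ((1 - t) * x + t * y)) :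
    (∫⁻ x, f x) ^ (1 - t) * (∫⁻ x, g x) ^ t ≤ ∫⁻ x, h x := by
  have h1t : 0 < 1 - t := by linarith
  set a := ⨆ x, f x with ha
  set b := ⨆ x, g x with hb
  by_cases ha0 : a = 0
  · have : ∀ x, f x = 0 := fun x => le_antisymm (ha0 ▸ le_iSup f x) zero_le
    simp [this, ENNReal.zero_rpow_of_pos h1t]
  by_cases hb0 : b = 0
  · have : ∀ x, g x = 0 := fun x => le_antisymm (hb0 ▸ le_iSup g x) zero_le
    simp [this, ENNReal.zero_rpow_of_pos ht0]
  have hc0 : a ^ (1 - t) * b ^ t ≠ 0 := by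
    simp [ENNReal.rpow_eq_zero_iff, ha0, hb0, hfb, hgb]
  have hct : a ^ (1 - t) * b ^ t ≠ ⊤ :=
    ENNReal.mul_ne_top (ENNReal.rpow_ne_top_of_nonneg h1t.le hfb)
      (ENNReal.rpow_ne_top_of_nonneg ht0.le hgb)
  have key := weighted_lintegral_le_of_iSup_eq_one ht0 ht1 (f := fun x => a⁻¹ * f x)
    (g := fun x => b⁻¹ * g x) (h := fun x => (a ^ (1 - t) * b ^ t)⁻¹ * h x)
    (hf.const_mul _) (hg.const_mul _) (hh.const_mul _)
    (by rw [← ENNReal.mul_iSup, ENNReal.inv_mul_cancel ha0 hfb])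
    (by rw [← ENNReal.mul_iSup, ENNReal.inv_mul_cancel hb0 hgb])
    (fun x y => by
      rw [ENNReal.mul_rpow_of_nonneg _ _ h1t.le, ENNReal.mul_rpow_of_nonneg _ _ ht0.le,
        ENNReal.inv_rpow, ENNReal.inv_rpow, mul_mul_mul_comm,
        ← ENNReal.mul_inv (Or.inr (ENNReal.rpow_ne_top_of_nonneg ht0.le hgb))
          (Or.inl (ENNReal.rpow_ne_top_of_nonneg h1t.le hfb))]
      gcongr
      exact H x y)
  -- The normalised functions satisfy an additive inequality, which is stronger than the
  -- multiplicative one by the weighted arithmetic-geometric mean inequality. The suprema then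
  -- cancel.
  have amgm := (ENNReal.rpow_mul_rpow_le_weighted_add ht0 ht1 _ _).trans key
  rw [lintegral_const_mul _ hf, lintegral_const_mul _ hg, lintegral_const_mul _ hh,
    ENNReal.mul_rpow_of_nonneg _ _ h1t.le, ENNReal.mul_rpow_of_nonneg _ _ ht0.le,
    ENNReal.inv_rpow, ENNReal.inv_rpow, mul_mul_mul_comm,
    ← ENNReal.mul_inv (Or.inr (ENNReal.rpow_ne_top_of_nonneg ht0.le hgb))
      (Or.inl (ENNReal.rpow_ne_top_of_nonneg h1t.le hfb))] at amgm
  exact (ENNReal.mul_le_mul_iff_right (ENNReal.inv_ne_zero.2 hct) (ENNReal.inv_ne_top.2 hc0)).1 amgm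

theorem iSup_min_natCast (x : ℝ≥0∞) : ⨆ N : ℕ, min x N = x := by
  refine le_antisymm (iSup_le fun N => min_le_left _ _) ?_
  rw [show (⨆ N : ℕ, min x N) = min x (⨆ N : ℕ, (N : ℝ≥0∞)) from (inf_iSup_eq _ _).symm,
    ENNReal.iSup_natCast]
  simp

theorem lintegral_rpow_eq_iSup_min {s : ℝ} (hs : 0 < s) {f : ℝ → ℝ≥0∞} (hf : Measurable f) :
    (∫⁻ x, f x) ^ s = ⨆ N : ℕ, (∫⁻ x, min (f x) N) ^ s := by
  have : ∫⁻ x, f x = ⨆ N : ℕ, ∫⁻ x, min (f x) N := by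
    rw [← lintegral_iSup (fun N => hf.min measurable_const)
      (fun N M hNM x => min_le_min le_rfl (by exact_mod_cast hNM))]
    exact lintegral_congr fun x => (iSup_min_natCast _).symm
  rw [this]
  exact (ENNReal.orderIsoRpow s hs).map_iSup _

/-- The Prékopa–Leindler inequality on the line. -/
theorem prekopa_leindler_real {t : ℝ} (ht0 : 0 < t) (ht1 : t < 1)
    {f g h : ℝ → ℝ≥0∞} (hf : Measurable f) (hg : Measurable g) (hh : Measurable h)
    (H : ∀ x y, f x ^ (1 - t) * g y ^ t ≤ h ((1 - t) * x + t * y)) :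
    (∫⁻ x, f x) ^ (1 - t) * (∫⁻ x, g x) ^ t ≤ ∫⁻ x, h x := by
  have h1t : 0 < 1 - t := by linarith
  rw [lintegral_rpow_eq_iSup_min h1t hf, lintegral_rpow_eq_iSup_min ht0 hg, ENNReal.iSup_mul]
  refine iSup_le fun N => ?_
  rw [ENNReal.mul_iSup]
  refine iSup_le fun M => ?_
  have hb : ∀ (u : ℝ → ℝ≥0∞) (N : ℕ), ⨆ x, min (u x) (N : ℝ≥0∞) ≠ ⊤ := fun u N =>
    ne_top_of_le_ne_top (ENNReal.natCast_ne_top N) (iSup_le fun x => min_le_right _ _)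
  refine prekopa_leindler_of_bounded ht0 ht1 (hf.min measurable_const) (hg.min measurable_const) hh
    (hb f N) (hb g M) fun x y => le_trans ?_ (H x y)
  gcongr
  · exact min_le_left _ _
  · exact min_le_left _ _

/-! ### Gaussian Prékopa–Leindler and concentration of Lipschitz functions. -/

/-- The standard Gaussian measure satisfies a curved Prékopa–Leindler inequality. -/
theorem gaussianReal_prekopa_leindler {t : ℝ} (ht0 : 0 < t) (ht1 : t < 1) {u v : ℝ → ℝ≥0∞}
    (hu : Measurable u) (hv : Measurable v) {c : ℝ≥0∞}
    (H : ∀ x y, u x ^ (1 - t) * v y ^ t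
      ≤ c * ENNReal.ofReal (Real.exp (t * (1 - t) / 2 * (x - y) ^ 2))) :
    (∫⁻ x, u x ∂gaussianReal 0 1) ^ (1 - t) * (∫⁻ x, v x ∂gaussianReal 0 1) ^ t ≤ c := by
  have h1t : 0 < 1 - t := by linarith
  have hφ := measurable_gaussianPDF 0 1
  rw [gaussianReal_of_var_ne_zero 0 one_ne_zero, lintegral_withDensity_eq_lintegral_mul _ hφ hu,
    lintegral_withDensity_eq_lintegral_mul _ hφ hv]
  have hc : c = ∫⁻ x, c * gaussianPDF 0 1 x := by
    rw [lintegral_const_mul _ hφ, lintegral_gaussianPDF_eq_one 0 one_ne_zero, mul_one]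
  conv_rhs => rw [hc]
  refine prekopa_leindler_real ht0 ht1 (hφ.mul hu) (hφ.mul hv) (hφ.const_mul c) fun x y => ?_
  simp only [Pi.mul_apply]
  rw [ENNReal.mul_rpow_of_nonneg _ _ h1t.le, ENNReal.mul_rpow_of_nonneg _ _ ht0.le,
    mul_mul_mul_comm]
  -- Since (1-t)x² + ty² - t(1-t)(x-y)² = ((1-t)x + ty)², the curved factor is exactly the surplus
  -- from the strong log-concavity of the density.
  have hpdf : gaussianPDF 0 1 x ^ (1 - t) * gaussianPDF 0 1 y ^ t
      * ENNReal.ofReal (Real.exp (t * (1 - t) / 2 * (x - y) ^ 2))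
      = gaussianPDF 0 1 ((1 - t) * x + t * y) := by
    simp only [gaussianPDF]
    have hp : ∀ z, 0 < gaussianPDFReal 0 1 z := fun z => gaussianPDFReal_pos 0 1 z one_ne_zero
    rw [ENNReal.ofReal_rpow_of_pos (hp x), ENNReal.ofReal_rpow_of_pos (hp y),
      ← ENNReal.ofReal_mul (Real.rpow_nonneg (hp x).le _), ← ENNReal.ofReal_mul
        (mul_nonneg (Real.rpow_nonneg (hp x).le _) (Real.rpow_nonneg (hp y).le _))]
    congr 1
    simp only [gaussianPDFReal, NNReal.coe_one, mul_one, sub_zero]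
    rw [Real.mul_rpow (by positivity) (by positivity), Real.mul_rpow (by positivity) (by positivity),
      mul_mul_mul_comm, ← Real.rpow_add (by positivity), ← Real.exp_mul, ← Real.exp_mul,
      ← Real.exp_add, mul_assoc, ← Real.exp_add]
    rw [show 1 - t + t = 1 by ring, Real.rpow_one]
    congr 2
    ring
  calc gaussianPDF 0 1 x ^ (1 - t) * gaussianPDF 0 1 y ^ t * (u x ^ (1 - t) * v y ^ t)
      ≤ gaussianPDF 0 1 x ^ (1 - t) * gaussianPDF 0 1 y ^ t *
        (c * ENNReal.ofReal (Real.exp (t * (1 - t) / 2 * (x - y) ^ 2))) :=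
        mul_le_mul_right (H x y) _
    _ = c * gaussianPDF 0 1 ((1 - t) * x + t * y) := by rw [← hpdf]; ring

/-- Lebesgue integration against a product of standard Gaussians splits off the first coordinate. -/
theorem lintegral_pi_gaussian_succ {n : ℕ} {f : (Fin (n + 1) → ℝ) → ℝ≥0∞} (hf : Measurable f) :
    ∫⁻ x, f x ∂(Measure.pi fun _ : Fin (n + 1) => gaussianReal 0 1)
      = ∫⁻ a, ∫⁻ y, f (Fin.cons a y) ∂(Measure.pi fun _ : Fin n => gaussianReal 0 1)
          ∂gaussianReal 0 1 := by
  have h := (measurePreserving_piFinSuccAbove (fun _ : Fin (n + 1) => gaussianReal 0 1) 0).symm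
  rw [← h.lintegral_comp hf, lintegral_prod]
  · refine lintegral_congr fun a => lintegral_congr fun y => congrArg f ?_
    simp [MeasurableEquiv.piFinSuccAbove]
    rfl
  · exact (hf.comp (MeasurableEquiv.measurable _)).aemeasurable

/-- The curved Prékopa–Leindler inequality for a product of standard Gaussians. -/
theorem pi_gaussian_prekopa_leindler {t : ℝ} (ht0 : 0 < t) (ht1 : t < 1) {n : ℕ}
    {u v : (Fin n → ℝ) → ℝ≥0∞} (hu : Measurable u) (hv : Measurable v) {c : ℝ≥0∞}
    (H : ∀ x y, u x ^ (1 - t) * v y ^ t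
      ≤ c * ENNReal.ofReal (Real.exp (t * (1 - t) / 2 * ∑ i, (x i - y i) ^ 2))) :
    (∫⁻ x, u x ∂(Measure.pi fun _ : Fin n => gaussianReal 0 1)) ^ (1 - t)
      * (∫⁻ x, v x ∂(Measure.pi fun _ : Fin n => gaussianReal 0 1)) ^ t ≤ c := by
  induction n generalizing c with
  | zero =>
    have := H default default
    simpa [Measure.pi_of_empty (x := (default : Fin 0 → ℝ)), lintegral_dirac' _ hu,
      lintegral_dirac' _ hv] using this
  | succ n ih =>
    rw [lintegral_pi_gaussian_succ hu, lintegral_pi_gaussian_succ hv]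
    have hcons : Measurable fun z : ℝ × (Fin n → ℝ) => (Fin.cons z.1 z.2 : Fin (n + 1) → ℝ) := by
      refine measurable_pi_lambda _ fun i => ?_
      refine Fin.cases ?_ (fun j => ?_) i
      · simpa using measurable_fst
      · simp only [Fin.cons_succ]
        fun_prop
    have hcons' : ∀ a : ℝ, Measurable fun y : Fin n → ℝ => (Fin.cons a y : Fin (n + 1) → ℝ) :=
      fun a => hcons.comp measurable_prodMk_left
    refine gaussianReal_prekopa_leindler ht0 ht1 (hu.comp hcons).lintegral_prod_right'
      (hv.comp hcons).lintegral_prod_right' fun a b => ?_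
    -- With the first coordinates `a` and `b` frozen, their factor exp(t(1-t)(a-b)²/2) joins the
    -- constant; this is why the induction generalises `c`.
    refine ih (hu.comp (hcons' a)) (hv.comp (hcons' b)) fun x y => (H _ _).trans_eq ?_
    rw [Fin.sum_univ_succ]
    simp only [Fin.cons_zero, Fin.cons_succ]
    rw [mul_assoc, ← ENNReal.ofReal_mul (Real.exp_nonneg _), ← Real.exp_add, mul_add]

/-- Jensen's inequality, obtained by integrating the tangent line of the exponential at the mean. -/
theorem integral_exp_neg_ge {Ω : Type*} [MeasurableSpace Ω] {μ : Measure Ω}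
    [IsProbabilityMeasure μ] {F : Ω → ℝ} (hF : Integrable F μ)
    (hE : Integrable (fun x => Real.exp (-F x)) μ) :
    Real.exp (-∫ x, F x ∂μ) ≤ ∫ x, Real.exp (-F x) ∂μ := by
  set m := ∫ x, F x ∂μ
  calc Real.exp (-m) = ∫ x, Real.exp (-m) * (1 - (F x - m)) ∂μ := by
        have hi : Integrable (fun x => F x - m) μ := hF.sub (integrable_const _)
        rw [integral_const_mul, integral_sub (integrable_const _) hi,
          integral_sub hF (integrable_const _)]
        simp [m]
    _ ≤ ∫ x, Real.exp (-F x) ∂μ := by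
        refine integral_mono (((integrable_const _).sub (hF.sub (integrable_const _))).const_mul _)
          hE fun x => ?_
        have := Real.add_one_le_exp (-(F x - m))
        calc Real.exp (-m) * (1 - (F x - m)) ≤ Real.exp (-m) * Real.exp (-(F x - m)) := by
              gcongr; linarith
          _ = Real.exp (-F x) := by rw [← Real.exp_add]; ring_nf

/-- Gaussian concentration: the moment generating function of a Lipschitz function. -/
theorem lintegral_exp_le_of_lipschitz {n : ℕ} {F : (Fin n → ℝ) → ℝ} (hF : Measurable F)
    (hF0 : ∀ x, 0 ≤ F x) (hFi : Integrable F (Measure.pi fun _ : Fin n => gaussianReal 0 1))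
    {l : ℝ} (hlip : ∀ x y, F x - F y ≤ l * √(∑ i, (x i - y i) ^ 2)) :
    ∫⁻ x, ENNReal.ofReal (Real.exp (F x)) ∂(Measure.pi fun _ : Fin n => gaussianReal 0 1)
      ≤ ENNReal.ofReal
          (Real.exp ((∫ x, F x ∂(Measure.pi fun _ : Fin n => gaussianReal 0 1)) + l ^ 2 / 2)) := by
  set μ := Measure.pi fun _ : Fin n => gaussianReal 0 1 with hμ
  set m := ∫ x, F x ∂μ with hm
  have main : ∀ t : ℝ, 0 < t → t < 1 → ∫⁻ x, ENNReal.ofReal (Real.exp (F x)) ∂μ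
      ≤ ENNReal.ofReal (Real.exp (m + l ^ 2 / (2 * t))) := by
    intro t ht0 ht1
    have h1t : 0 < 1 - t := by linarith
    -- With this exponent the powers in Prékopa–Leindler combine to exp((1-t)(F x - F y)), which the
    -- Lipschitz bound controls.
    set r := (1 - t) / t with hr
    have hr0 : 0 < r := by positivity
    have hme : Measurable fun x => Real.exp (-(r * F x)) := (hF.const_mul r).neg.exp
    have hie : Integrable (fun x => Real.exp (-(r * F x))) μ := by
      refine (integrable_const (1 : ℝ)).mono' hme.aestronglyMeasurable
        (Filter.Eventually.of_forall fun x => ?_)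
      rw [Real.norm_eq_abs, Real.abs_exp, Real.exp_le_one_iff]
      have := mul_nonneg hr0.le (hF0 x)
      linarith
    have hpl := pi_gaussian_prekopa_leindler ht0 ht1 (n := n)
      (u := fun x => ENNReal.ofReal (Real.exp (F x)))
      (v := fun x => ENNReal.ofReal (Real.exp (-(r * F x))))
      (c := ENNReal.ofReal (Real.exp ((1 - t) * (l ^ 2 / (2 * t)))))
      hF.exp.ennreal_ofReal hme.ennreal_ofReal (fun x y => by
        rw [ENNReal.ofReal_rpow_of_pos (Real.exp_pos _), ENNReal.ofReal_rpow_of_pos (Real.exp_pos _),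
          ← ENNReal.ofReal_mul (by positivity), ← ENNReal.ofReal_mul (by positivity),
          ← Real.exp_mul, ← Real.exp_mul, ← Real.exp_add, ← Real.exp_add]
        refine ENNReal.ofReal_le_ofReal (Real.exp_le_exp.2 ?_)
        set d := √(∑ i, (x i - y i) ^ 2) with hd
        have hd2 : ∑ i, (x i - y i) ^ 2 = d ^ 2 := by
          rw [hd, Real.sq_sqrt (Finset.sum_nonneg fun i _ => sq_nonneg _)]
        rw [hd2]
        have h1 : F x * (1 - t) + -(r * F y) * t = (1 - t) * (F x - F y) := by
          rw [hr]; field_simp; ring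
        -- Completing the square: the curvature term pays for the part of `l * d` that a constant
        -- cannot cover.
        have h2 : (1 - t) * (l ^ 2 / (2 * t)) + t * (1 - t) / 2 * d ^ 2
            = (1 - t) * (l * d) + (1 - t) * ((l - t * d) ^ 2 / (2 * t)) := by
          field_simp; ring
        rw [h1, h2]
        have h3 : 0 ≤ (1 - t) * ((l - t * d) ^ 2 / (2 * t)) := by positivity
        have h4 := mul_le_mul_of_nonneg_left (hlip x y) h1t.le
        linarith)
    have hjen : ENNReal.ofReal (Real.exp (-(r * m)))
        ≤ ∫⁻ x, ENNReal.ofReal (Real.exp (-(r * F x))) ∂μ := by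
      rw [← ofReal_integral_eq_lintegral_ofReal hie
        (Filter.Eventually.of_forall fun x => (Real.exp_pos _).le)]
      refine ENNReal.ofReal_le_ofReal ?_
      have := integral_exp_neg_ge (μ := μ) (hFi.const_mul r) hie
      rwa [integral_const_mul] at this
    have h5 : (∫⁻ x, ENNReal.ofReal (Real.exp (F x)) ∂μ) ^ (1 - t)
        * ENNReal.ofReal (Real.exp (-((1 - t) * m)))
        ≤ ENNReal.ofReal (Real.exp ((1 - t) * (l ^ 2 / (2 * t)))) := by
      refine le_trans ?_ hpl
      gcongr
      calc ENNReal.ofReal (Real.exp (-((1 - t) * m)))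
          = ENNReal.ofReal (Real.exp (-(r * m))) ^ t := by
            rw [ENNReal.ofReal_rpow_of_pos (Real.exp_pos _), ← Real.exp_mul]
            congr 2
            rw [hr]; field_simp
        _ ≤ _ := by gcongr
    have h6 : (∫⁻ x, ENNReal.ofReal (Real.exp (F x)) ∂μ) ^ (1 - t)
        ≤ ENNReal.ofReal (Real.exp (m + l ^ 2 / (2 * t))) ^ (1 - t) := by
      have h7 := mul_le_mul_left h5 (ENNReal.ofReal (Real.exp ((1 - t) * m)))
      rw [mul_assoc, ← ENNReal.ofReal_mul (Real.exp_nonneg _), ← Real.exp_add,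
        ← ENNReal.ofReal_mul (Real.exp_nonneg _), ← Real.exp_add] at h7
      rw [ENNReal.ofReal_rpow_of_pos (Real.exp_pos _), ← Real.exp_mul]
      convert h7 using 2
      · simp
      · ring_nf
    exact (ENNReal.rpow_le_rpow_iff h1t).1 h6
  -- The bound improves as t increases to 1, and the limit has the sharp variance factor l².
  have hlim : Filter.Tendsto (fun t : ℝ => ENNReal.ofReal (Real.exp (m + l ^ 2 / (2 * t))))
      (nhdsWithin 1 (Set.Iio 1)) (nhds (ENNReal.ofReal (Real.exp (m + l ^ 2 / 2)))) := by
    refine (ENNReal.continuous_ofReal.tendsto _).comp ((Real.continuous_exp.tendsto _).comp ?_)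
    have : ContinuousAt (fun t : ℝ => m + l ^ 2 / (2 * t)) 1 := by
      refine continuousAt_const.add (continuousAt_const.div (by fun_prop) (by norm_num))
    simpa using this.tendsto.mono_left nhdsWithin_le_nhds
  refine ge_of_tendsto hlim ?_
  have : Set.Ioo (0 : ℝ) 1 ∈ nhdsWithin (1 : ℝ) (Set.Iio 1) := Ioo_mem_nhdsLT one_pos
  filter_upwards [this] with t ht using main t ht.1 ht.2

/-! ### Norm and direction of a Gaussian vector, and the mean of its norm. -/

/-- Polar coordinates for a product of a positively homogeneous function of degree zero and a
radial function. -/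
theorem lintegral_mul_fun_norm_addHaar {E : Type*} [NormedAddCommGroup E] [NormedSpace ℝ E]
    [MeasurableSpace E] [BorelSpace E] [FiniteDimensional ℝ E] (μ : Measure E)
    [μ.IsAddHaarMeasure] [Nontrivial E] {ψ : E → ℝ≥0∞} (hψ : Measurable ψ)
    (hψ0 : ∀ (r : ℝ) (x : E), 0 < r → ψ (r • x) = ψ x) {G : ℝ → ℝ≥0∞} (hG : Measurable G) :
    ∫⁻ x, ψ x * G ‖x‖ ∂μ = (∫⁻ θ, ψ θ.1 ∂μ.toSphere)
      * ∫⁻ r in Set.Ioi (0 : ℝ), ENNReal.ofReal (r ^ (Module.finrank ℝ E - 1)) * G r := by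
  calc ∫⁻ x, ψ x * G ‖x‖ ∂μ
      = ∫⁻ x : ({(0)}ᶜ : Set E), ψ x.1 * G ‖x.1‖ ∂(μ.comap (↑)) := by
        rw [lintegral_subtype_comap (measurableSet_singleton _).compl fun x => ψ x * G ‖x‖,
          restrict_compl_singleton]
    _ = ∫⁻ z, ψ z.1.1 * G z.2.1
          ∂μ.toSphere.prod (.volumeIoiPow (Module.finrank ℝ E - 1)) := by
        rw [← μ.measurePreserving_homeomorphUnitSphereProd.lintegral_comp_emb
          (Homeomorph.measurableEmbedding _)]
        refine lintegral_congr fun x => ?_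
        have hx : 0 < ‖x.1‖ := norm_pos_iff.2 x.2
        have h1 := homeomorphUnitSphereProd_apply_fst_coe E x
        have h2 := homeomorphUnitSphereProd_apply_snd_coe E x
        rw [h1, h2, hψ0 _ _ (by positivity)]
    _ = (∫⁻ θ, ψ θ.1 ∂μ.toSphere) * ∫⁻ r, G r.1 ∂.volumeIoiPow (Module.finrank ℝ E - 1) :=
        lintegral_prod_mul (hψ.comp measurable_subtype_coe).aemeasurable
          (hG.comp measurable_subtype_coe).aemeasurable
    _ = _ := by
        congr 1
        rw [Measure.volumeIoiPow, lintegral_withDensity_eq_lintegral_mul _ (by fun_prop)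
          (show Measurable fun r : Set.Ioi (0 : ℝ) => G r.1 from hG.comp measurable_subtype_coe)]
        exact lintegral_subtype_comap measurableSet_Ioi
          fun r => ENNReal.ofReal (r ^ (Module.finrank ℝ E - 1)) * G r

/-- The density of the standard Gaussian measure on a Euclidean space. -/
noncomputable def gaussDensity (n : ℕ) (r : ℝ) : ℝ := (2 * Real.pi) ^ (-(n : ℝ) / 2) * Real.exp (-r ^ 2 / 2)

theorem gaussDensity_pos (n : ℕ) (r : ℝ) : 0 < gaussDensity n r := by
  unfold gaussDensity; positivity

theorem measurable_gaussDensity (n : ℕ) : Measurable (gaussDensity n) := by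
  unfold gaussDensity; fun_prop

theorem measurable_ofReal_gaussDensity_norm (n : ℕ) :
    Measurable fun x : EuclideanSpace ℝ (Fin n) => ENNReal.ofReal (gaussDensity n ‖x‖) :=
  ((measurable_gaussDensity n).comp measurable_norm).ennreal_ofReal

/-- Both are finite measures with characteristic function exp(-‖t‖²/2). -/
theorem stdGaussian_eq_withDensity (n : ℕ) :
    stdGaussian (EuclideanSpace ℝ (Fin n))
      = volume.withDensity fun x => ENNReal.ofReal (gaussDensity n ‖x‖) := by
  have hb : (0 : ℝ) < 1 / 2 := by norm_num
  have hint : Integrable (fun x : EuclideanSpace ℝ (Fin n) => gaussDensity n ‖x‖) := by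
    have h := (GaussianFourier.integrable_cexp_neg_mul_sq_norm_add (b := ((1 / 2 : ℝ) : ℂ))
      (by simp) 0 (0 : EuclideanSpace ℝ (Fin n))).re
    refine (h.const_mul ((2 * Real.pi) ^ (-(n : ℝ) / 2))).congr (Filter.Eventually.of_forall fun x => ?_)
    simp only [gaussDensity]
    congr 1
    simp only [zero_mul, add_zero]
    rw [← Complex.ofReal_pow, ← Complex.ofReal_neg, ← Complex.ofReal_mul, ← Complex.ofReal_exp]
    simp only [RCLike.re_to_complex, Complex.ofReal_re]
    congr 1
    ring
  have : IsFiniteMeasure (volume.withDensity fun x : EuclideanSpace ℝ (Fin n) =>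
      ENNReal.ofReal (gaussDensity n ‖x‖)) := isFiniteMeasure_withDensity_ofReal hint.2
  apply Measure.ext_of_charFun (E := EuclideanSpace ℝ (Fin n))
  ext t
  rw [charFun_stdGaussian, charFun_apply, integral_withDensity_eq_integral_toReal_smul
    (measurable_ofReal_gaussDensity_norm n)
    (Filter.Eventually.of_forall fun x => ENNReal.ofReal_lt_top)]
  have h := GaussianFourier.integral_cexp_neg_mul_sq_norm_add (b := ((1 / 2 : ℝ) : ℂ))
      (by simp) Complex.I t
  have : ∀ x : EuclideanSpace ℝ (Fin n), (ENNReal.ofReal (gaussDensity n ‖x‖)).toReal •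
      Complex.exp ((inner ℝ x t : ℝ) * Complex.I) = ((2 * Real.pi) ^ (-(n : ℝ) / 2) : ℝ) *
        Complex.exp (-((1 / 2 : ℝ) : ℂ) * ‖x‖ ^ 2 + Complex.I * (inner ℝ t x : ℝ)) := by
    intro x
    rw [ENNReal.toReal_ofReal (gaussDensity_pos n _).le, gaussDensity, Complex.exp_add,
      real_inner_comm, Complex.real_smul]
    push_cast
    rw [mul_assoc, mul_comm Complex.I]
    congr 3
    ring
  rw [integral_congr_ae (Filter.Eventually.of_forall this), integral_const_mul, h]
  rw [finrank_euclideanSpace_fin]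
  have h2 : ((Real.pi : ℂ) / ((1 / 2 : ℝ) : ℂ)) ^ ((n : ℂ) / 2) = ((2 * Real.pi) ^ ((n : ℝ) / 2) : ℝ) := by
    rw [Complex.ofReal_cpow (by positivity)]
    push_cast
    congr 1
    ring
  rw [h2, ← mul_assoc, ← Complex.ofReal_mul, ← Real.rpow_add (by positivity)]
  have h3 : -(n : ℝ) / 2 + (n : ℝ) / 2 = 0 := by ring
  rw [h3, Real.rpow_zero, Complex.ofReal_one, one_mul, Complex.I_sq]
  congr 1
  push_cast
  ring

theorem lintegral_stdGaussian {n : ℕ} {f : EuclideanSpace ℝ (Fin n) → ℝ≥0∞} (hf : Measurable f) :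
    ∫⁻ x, f x ∂stdGaussian (EuclideanSpace ℝ (Fin n))
      = ∫⁻ x, f x * ENNReal.ofReal (gaussDensity n ‖x‖) := by
  rw [stdGaussian_eq_withDensity, lintegral_withDensity_eq_lintegral_mul _
    (measurable_ofReal_gaussDensity_norm n) hf]
  exact lintegral_congr fun x => mul_comm _ _

/-- The norm and the direction of a standard Gaussian vector are independent. -/
theorem lintegral_stdGaussian_mul_fun_norm {n : ℕ} [NeZero n]
    {ψ : EuclideanSpace ℝ (Fin n) → ℝ≥0∞} (hψ : Measurable ψ)
    (hψ0 : ∀ (r : ℝ) (x : EuclideanSpace ℝ (Fin n)), 0 < r → ψ (r • x) = ψ x)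
    {G : ℝ → ℝ≥0∞} (hG : Measurable G) :
    ∫⁻ x, ψ x * G ‖x‖ ∂stdGaussian (EuclideanSpace ℝ (Fin n))
      = (∫⁻ x, ψ x ∂stdGaussian (EuclideanSpace ℝ (Fin n)))
        * ∫⁻ x, G ‖x‖ ∂stdGaussian (EuclideanSpace ℝ (Fin n)) := by
  have hd := (measurable_gaussDensity n).ennreal_ofReal
  have key : ∀ {ψ : EuclideanSpace ℝ (Fin n) → ℝ≥0∞}, Measurable ψ →
      (∀ (r : ℝ) (x : EuclideanSpace ℝ (Fin n)), 0 < r → ψ (r • x) = ψ x) →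
      ∀ {G : ℝ → ℝ≥0∞}, Measurable G → _ := fun {ψ} hψ hψ0 {G} hG =>
    (lintegral_stdGaussian (hψ.mul (hG.comp measurable_norm))).trans
      ((lintegral_congr fun x => mul_assoc _ _ _).trans
        (lintegral_mul_fun_norm_addHaar volume hψ hψ0 (hG.mul hd)))
  -- Each integral splits into a spherical and a radial factor. Replacing either function by one
  -- identifies the factors, and the total mass one in `k4` fixes the normalisation.
  have k1 := key hψ hψ0 hG
  have k2 := key hψ hψ0 (G := fun _ => 1) measurable_const
  have k3 := key (ψ := fun _ => 1) measurable_const (fun _ _ _ => rfl) hG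
  have k4 := key (ψ := fun _ => 1) measurable_const (fun _ _ _ => rfl) (G := fun _ => 1) measurable_const
  simp only [Function.comp_def, Pi.mul_apply, mul_one, one_mul, lintegral_one, measure_univ] at k1 k2 k3 k4
  rw [k1, k2, k3]
  set a := ∫⁻ θ : Metric.sphere (0 : EuclideanSpace ℝ (Fin n)) 1, ψ θ.1 ∂volume.toSphere
  rw [← mul_one (a * _), k4]
  ring

/-- The mean `√2 Γ((n+1)/2) / Γ(n/2)` of the chi distribution with `n` degrees of freedom. -/
noncomputable def chiMean (n : ℕ) : ℝ :=
  √2 * Real.Gamma (((n : ℝ) + 1) / 2) / Real.Gamma ((n : ℝ) / 2)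

theorem chiMean_pos {n : ℕ} (hn : 0 < n) : 0 < chiMean n := by
  have h0 : (0 : ℝ) < n := by exact_mod_cast hn
  have h1 := Real.Gamma_pos_of_pos (show 0 < ((n : ℝ) + 1) / 2 by positivity)
  have h2 := Real.Gamma_pos_of_pos (show 0 < (n : ℝ) / 2 by positivity)
  unfold chiMean
  positivity

theorem integral_pow_mul_exp_neg_mul_sq (m : ℕ) {b : ℝ} (hb : 0 < b) :
    ∫ r in Set.Ioi (0 : ℝ), r ^ m * Real.exp (-b * r ^ 2)
      = b ^ (-((m : ℝ) + 1) / 2) * (1 / 2) * Real.Gamma (((m : ℝ) + 1) / 2) := by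
  have h := integral_rpow_mul_exp_neg_mul_rpow (p := 2) (q := m) two_pos
    (by have : (0 : ℝ) ≤ m := Nat.cast_nonneg m
        linarith) hb
  rw [← h]
  refine setIntegral_congr_fun measurableSet_Ioi fun r _ => ?_
  simp only [Real.rpow_natCast, Real.rpow_two]

/-- At s = 0 this is the mean norm; at s = ρ² it is the moment that appears in the derivative of
`ratioTail`. -/
theorem integral_norm_mul_exp_stdGaussian {n : ℕ} [NeZero n] {s : ℝ} (hs : 0 ≤ s) :
    ∫ x, ‖x‖ * Real.exp (-s * ‖x‖ ^ 2 / 2) ∂stdGaussian (EuclideanSpace ℝ (Fin n))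
      = (1 + s) ^ (-((n : ℝ) + 1) / 2) * chiMean n := by
  have hn : 0 < n := Nat.pos_of_ne_zero (NeZero.ne n)
  have h0 : (0 : ℝ) < n := by exact_mod_cast hn
  have hd : ∀ f : EuclideanSpace ℝ (Fin n) → ℝ,
      ∫ x, f x ∂stdGaussian (EuclideanSpace ℝ (Fin n)) = ∫ x, gaussDensity n ‖x‖ * f x := by
    intro f
    rw [stdGaussian_eq_withDensity, integral_withDensity_eq_integral_toReal_smul
      (measurable_ofReal_gaussDensity_norm n)
      (Filter.Eventually.of_forall fun x => ENNReal.ofReal_lt_top)]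
    refine integral_congr_ae (Filter.Eventually.of_forall fun x => ?_)
    simp [ENNReal.toReal_ofReal (gaussDensity_pos n _).le]
  -- The total mass is computed by the same radial formula, so the volume of the ball and the
  -- Gaussian constant cancel without being evaluated.
  have hone : (1 : ℝ) = ∫ x : EuclideanSpace ℝ (Fin n), gaussDensity n ‖x‖ * 1 := by
    rw [← hd]; simp
  rw [hd, integral_fun_norm_addHaar volume (fun r => gaussDensity n r * (r * Real.exp (-s * r ^ 2 / 2)))]
  rw [integral_fun_norm_addHaar volume (fun r => gaussDensity n r * 1)] at hone
  simp only [finrank_euclideanSpace_fin, nsmul_eq_mul, smul_eq_mul, gaussDensity] at hone ⊢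
  set V := (volume : Measure (EuclideanSpace ℝ (Fin n))).real (Metric.ball 0 1)
  set c := (2 * Real.pi) ^ (-(n : ℝ) / 2)
  have e1 : ∫ r in Set.Ioi (0 : ℝ), r ^ (n - 1) * (c * Real.exp (-r ^ 2 / 2) * 1)
      = c * ((1 / 2 : ℝ) ^ (-(n : ℝ) / 2) * (1 / 2) * Real.Gamma ((n : ℝ) / 2)) := by
    have := integral_pow_mul_exp_neg_mul_sq (n - 1) (b := 1 / 2) (by norm_num)
    rw [Nat.cast_sub hn, Nat.cast_one, sub_add_cancel] at this
    rw [← this, ← integral_const_mul]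
    refine integral_congr_ae (Filter.Eventually.of_forall fun r => ?_)
    simp only [mul_one]
    rw [show -(1 / 2 : ℝ) * r ^ 2 = -r ^ 2 / 2 by ring]
    ring
  have e2 : ∫ r in Set.Ioi (0 : ℝ), r ^ (n - 1) *
        (c * Real.exp (-r ^ 2 / 2) * (r * Real.exp (-s * r ^ 2 / 2)))
      = c * (((1 + s) / 2 : ℝ) ^ (-((n : ℝ) + 1) / 2) * (1 / 2) * Real.Gamma (((n : ℝ) + 1) / 2)) := by
    rw [← integral_pow_mul_exp_neg_mul_sq n (by positivity), ← integral_const_mul]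
    refine integral_congr_ae (Filter.Eventually.of_forall fun r => ?_)
    simp only
    rw [show -((1 + s) / 2) * r ^ 2 = -r ^ 2 / 2 + -s * r ^ 2 / 2 by ring, Real.exp_add]
    obtain ⟨k, rfl⟩ : ∃ k, n = k + 1 := ⟨n - 1, by omega⟩
    simp only [Nat.add_sub_cancel, pow_succ]
    ring
  rw [e1] at hone
  rw [e2]
  have hG : Real.Gamma ((n : ℝ) / 2) ≠ 0 := (Real.Gamma_pos_of_pos (by positivity)).ne'
  have e3 : ((1 + s) / 2 : ℝ) ^ (-((n : ℝ) + 1) / 2)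
      = (1 + s) ^ (-((n : ℝ) + 1) / 2) * ((1 / 2 : ℝ) ^ (-(n : ℝ) / 2) * √2) := by
    rw [div_eq_mul_one_div, Real.mul_rpow (by positivity) (by positivity)]
    congr 1
    rw [show -((n : ℝ) + 1) / 2 = -(n : ℝ) / 2 + -(1 / 2) by ring, Real.rpow_add (by positivity)]
    congr 1
    rw [Real.sqrt_eq_rpow, Real.rpow_neg (by norm_num), ← Real.inv_rpow (by norm_num)]
    norm_num
  rw [e3, chiMean]
  have : (n : ℝ) * (V * (c * ((1 + s) ^ (-((n : ℝ) + 1) / 2) * ((1 / 2 : ℝ) ^ (-(n : ℝ) / 2) * √2)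
      * (1 / 2) * Real.Gamma (((n : ℝ) + 1) / 2))))
      = ((n : ℝ) * (V * (c * ((1 / 2 : ℝ) ^ (-(n : ℝ) / 2) * (1 / 2) * Real.Gamma ((n : ℝ) / 2)))))
        * ((1 + s) ^ (-((n : ℝ) + 1) / 2) * (√2 * Real.Gamma (((n : ℝ) + 1) / 2)
          / Real.Gamma ((n : ℝ) / 2))) := by
    field_simp
  rw [this, ← hone, one_mul]

theorem chiMean_mul_succ {n : ℕ} (hn : 0 < n) : chiMean n * chiMean (n + 1) = n := by
  have h0 : (0 : ℝ) < n := by exact_mod_cast hn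
  have h1 := (Real.Gamma_pos_of_pos (show 0 < ((n : ℝ) + 1) / 2 by positivity)).ne'
  have h2 := (Real.Gamma_pos_of_pos (show 0 < (n : ℝ) / 2 by positivity)).ne'
  have h3 := Real.Gamma_add_one (show (n : ℝ) / 2 ≠ 0 by positivity)
  unfold chiMean
  push_cast
  rw [show ((n : ℝ) + 1 + 1) / 2 = (n : ℝ) / 2 + 1 by ring, h3]
  field_simp
  rw [Real.sq_sqrt (by norm_num)]

theorem integrable_norm_stdGaussian (n : ℕ) :
    Integrable (fun x => ‖x‖) (stdGaussian (EuclideanSpace ℝ (Fin n))) :=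
  IsGaussian.integrable_id.norm

theorem integral_norm_stdGaussian {n : ℕ} [NeZero n] :
    ∫ x, ‖x‖ ∂stdGaussian (EuclideanSpace ℝ (Fin n)) = chiMean n := by
  simpa using integral_norm_mul_exp_stdGaussian (n := n) le_rfl

/-- Log-convexity of Γ at the midpoint of n/2 and n/2 + 1. -/
theorem chiMean_sq_le {n : ℕ} (hn : 0 < n) : chiMean n ^ 2 ≤ n := by
  have h0 : (0 : ℝ) < n := by exact_mod_cast hn
  have hG : ∀ {x : ℝ}, 0 < x → 0 < Real.Gamma x := Real.Gamma_pos_of_pos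
  have h1 := Real.Gamma_mul_add_mul_le_rpow_Gamma_mul_rpow_Gamma (s := (n : ℝ) / 2)
    (t := (n : ℝ) / 2 + 1) (a := 1 / 2) (b := 1 / 2) (by positivity) (by positivity) (by norm_num)
    (by norm_num) (by norm_num)
  rw [Real.Gamma_add_one (by positivity), show 1 / 2 * ((n : ℝ) / 2) + 1 / 2 * ((n : ℝ) / 2 + 1)
    = ((n : ℝ) + 1) / 2 by ring, ← Real.sqrt_eq_rpow, ← Real.sqrt_eq_rpow,
    ← Real.sqrt_mul (hG (by positivity)).le] at h1
  have hg := hG (show 0 < (n : ℝ) / 2 by positivity)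
  have h2 := pow_le_pow_left₀ (hG (show 0 < ((n : ℝ) + 1) / 2 by positivity)).le h1 2
  rw [Real.sq_sqrt (by positivity)] at h2
  unfold chiMean
  rw [div_pow, mul_pow, Real.sq_sqrt (by norm_num), div_le_iff₀ (by positivity)]
  nlinarith

/-- The recursion chiMean(m+2) = (m+1)/m · chiMean(m) shows that chiMean(m)²/(m - 1/2) does not
increase from m to m + 2. Its limit along such steps is at least one, so every term is. -/
theorem sub_half_le_chiMean_sq {n : ℕ} (hn : 0 < n) : (n : ℝ) - 1 / 2 ≤ chiMean n ^ 2 := by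
  have hstep : ∀ m : ℕ, 0 < m →
      chiMean (m + 2) ^ 2 / ((m + 2 : ℕ) - 1 / 2) ≤ chiMean m ^ 2 / ((m : ℝ) - 1 / 2) := by
    intro m hm
    have h0 : (1 : ℝ) ≤ m := by exact_mod_cast hm
    have p1 := chiMean_pos hm
    have p2 := chiMean_pos (show 0 < m + 1 by omega)
    have r1 := chiMean_mul_succ hm
    have r2 := chiMean_mul_succ (show 0 < m + 1 by omega)
    have e : chiMean (m + 2) = (m + 1) / m * chiMean m := by
      rw [div_mul_eq_mul_div, eq_div_iff (by positivity)]
      push_cast at r2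
      linear_combination (chiMean m) * r2 - chiMean (m + 2) * r1
    rw [e]
    push_cast
    have : ((m : ℝ) + 1) / m * chiMean m = chiMean m * ((m + 1) / m) := mul_comm _ _
    rw [this, mul_pow, mul_div_assoc, mul_comm (chiMean m ^ 2), div_eq_inv_mul (chiMean m ^ 2)]
    gcongr
    rw [div_pow, div_div, div_le_iff₀ (by nlinarith), inv_mul_eq_div, le_div_iff₀ (by linarith)]
    nlinarith
  have hiter : ∀ k : ℕ, chiMean (n + 2 * k) ^ 2 / ((n + 2 * k : ℕ) - 1 / 2)
      ≤ chiMean n ^ 2 / ((n : ℝ) - 1 / 2) := by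
    intro k
    induction k with
    | zero => simp
    | succ k ih => exact (hstep (n + 2 * k) (by omega)).trans ih
  have hlow : ∀ m : ℕ, 0 < m → 1 - 1 / (m + 1 : ℝ) ≤ chiMean m ^ 2 / ((m : ℝ) - 1 / 2) := by
    intro m hm
    have h0 : (1 : ℝ) ≤ m := by exact_mod_cast hm
    have p1 := chiMean_pos hm
    have r1 := chiMean_mul_succ hm
    have r2 := chiMean_sq_le (show 0 < m + 1 by omega)
    -- The upper bound for the next mean gives a lower bound for this one, because their product is
    -- m.
    have r3 : (m : ℝ) ^ 2 ≤ chiMean m ^ 2 * (m + 1) := by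
      have : (m : ℝ) ^ 2 = chiMean m ^ 2 * chiMean (m + 1) ^ 2 := by rw [← mul_pow, r1]
      push_cast at r2
      rw [this]
      gcongr
    rw [le_div_iff₀ (by linarith), one_sub_div (by positivity), div_mul_eq_mul_div,
      div_le_iff₀ (by positivity)]
    nlinarith
  have h1 : (1 : ℝ) ≤ n := by exact_mod_cast hn
  have hlim : Filter.Tendsto (fun k : ℕ => 1 - 1 / ((n + 2 * k : ℕ) + 1 : ℝ)) Filter.atTop
      (nhds (1 - 0)) := by
    refine tendsto_const_nhds.sub ?_
    have := (tendsto_one_div_add_atTop_nhds_zero_nat (𝕜 := ℝ))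
    refine this.comp (f := fun k : ℕ => n + 2 * k) ?_
    exact Filter.tendsto_atTop_mono (fun k => (by simp only [id]; omega : id k ≤ n + 2 * k)) Filter.tendsto_id
  have := le_of_tendsto hlim (Filter.Eventually.of_forall fun k =>
    (hlow (n + 2 * k) (by omega)).trans (hiter k))
  rw [sub_zero, one_le_div (by linarith)] at this
  exact this

theorem integral_mul_norm_stdGaussian {n : ℕ} [NeZero n] {ψ : EuclideanSpace ℝ (Fin n) → ℝ}
    (hψ : Measurable ψ) (hψn : ∀ x, 0 ≤ ψ x)
    (hψ0 : ∀ (r : ℝ) (x : EuclideanSpace ℝ (Fin n)), 0 < r → ψ (r • x) = ψ x) :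
    ∫ x, ψ x * ‖x‖ ∂stdGaussian (EuclideanSpace ℝ (Fin n))
      = (∫ x, ψ x ∂stdGaussian (EuclideanSpace ℝ (Fin n))) * chiMean n := by
  have h := lintegral_stdGaussian_mul_fun_norm (ψ := fun x => ENNReal.ofReal (ψ x))
    hψ.ennreal_ofReal (fun r x hr => by rw [hψ0 r x hr]) (G := fun r => ENNReal.ofReal r)
    ENNReal.measurable_ofReal
  rw [← integral_norm_stdGaussian, integral_eq_lintegral_of_nonneg_ae
      (Filter.Eventually.of_forall fun x => mul_nonneg (hψn x) (norm_nonneg x))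
      (hψ.mul measurable_norm).aestronglyMeasurable,
    integral_eq_lintegral_of_nonneg_ae (Filter.Eventually.of_forall hψn) hψ.aestronglyMeasurable,
    integral_eq_lintegral_of_nonneg_ae (Filter.Eventually.of_forall fun x => norm_nonneg x)
      measurable_norm.aestronglyMeasurable, ← ENNReal.toReal_mul, ← h]
  congr 1
  exact lintegral_congr fun x => ENNReal.ofReal_mul (hψn x)

/-! ### Concentration of Lipschitz gauges on the sphere. -/

theorem lintegral_stdGaussian_eq_pi {n : ℕ} {f : EuclideanSpace ℝ (Fin n) → ℝ≥0∞}
    (hf : Measurable f) : ∫⁻ x, f x ∂stdGaussian (EuclideanSpace ℝ (Fin n))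
      = ∫⁻ x, f (WithLp.toLp 2 x) ∂(Measure.pi fun _ : Fin n => gaussianReal 0 1) := by
  rw [← map_pi_eq_stdGaussian, lintegral_map hf (by fun_prop)]

/-- Moment generating function of the restriction of a Lipschitz gauge to the directions of a
standard Gaussian vector. -/
theorem integral_exp_direction_le {n : ℕ} [NeZero n] {N : EuclideanSpace ℝ (Fin n) → ℝ}
    (hN0 : ∀ x, 0 ≤ N x) (hNr : ∀ (r : ℝ) x, 0 < r → N (r • x) = r * N x)
    {l : ℝ} (hlip : ∀ x y, N x - N y ≤ l * ‖x - y‖) {s : ℝ} (hs : 0 ≤ s) :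
    Integrable (fun x => Real.exp (s * (N x / ‖x‖))) (stdGaussian (EuclideanSpace ℝ (Fin n))) ∧
    ∫ x, Real.exp (s * (N x / ‖x‖)) ∂stdGaussian (EuclideanSpace ℝ (Fin n))
      ≤ Real.exp (s * (∫ x, N x / ‖x‖ ∂stdGaussian (EuclideanSpace ℝ (Fin n)))
          + (s * l / chiMean n) ^ 2 / 2) := by
  set μ := stdGaussian (EuclideanSpace ℝ (Fin n)) with hμ
  have ha := chiMean_pos (Nat.pos_of_ne_zero (NeZero.ne n))
  set a := chiMean n with hadef
  have hNc : Continuous N := by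
    refine continuous_iff_continuousAt.2 fun x => ?_
    rw [ContinuousAt, tendsto_iff_norm_sub_tendsto_zero]
    have h0 : Filter.Tendsto (fun y => |l| * ‖y - x‖) (nhds x) (nhds 0) := by
      have : Continuous fun y : EuclideanSpace ℝ (Fin n) => |l| * ‖y - x‖ := by fun_prop
      simpa using this.tendsto x
    refine squeeze_zero (fun _ => norm_nonneg _) (fun y => ?_) h0
    rw [Real.norm_eq_abs, abs_sub_le_iff]
    have h1 := hlip y x
    have h2 := hlip x y
    rw [norm_sub_rev x y] at h2
    have h3 := mul_le_mul_of_nonneg_right (le_abs_self l) (norm_nonneg (y - x))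
    constructor <;> linarith
  have hNm := hNc.measurable
  have hN00 : N 0 = 0 := by
    have := hNr 2 0 two_pos
    rw [smul_zero] at this
    linarith
  have hNle : ∀ x, N x ≤ l * ‖x‖ := fun x => by simpa [hN00] using hlip x 0
  set f : EuclideanSpace ℝ (Fin n) → ℝ := fun x => N x / ‖x‖ with hf
  have hfm : Measurable f := hNm.div measurable_norm
  have hf0 : ∀ x, 0 ≤ f x := fun x => div_nonneg (hN0 x) (norm_nonneg x)
  have hfl : ∀ x, f x ≤ |l| := by
    intro x
    rcases eq_or_ne x 0 with rfl | hx
    · simp [hf]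
    · rw [hf]
      simp only
      rw [div_le_iff₀ (norm_pos_iff.2 hx)]
      exact (hNle x).trans (by gcongr; exact le_abs_self l)
  have hfr : ∀ (r : ℝ) x, 0 < r → f (r • x) = f x := by
    intro r x hr
    simp only [hf, hNr r x hr, norm_smul, Real.norm_eq_abs, abs_of_pos hr]
    rw [mul_div_mul_left _ _ hr.ne']
  have hNf : ∀ x, N x = f x * ‖x‖ := by
    intro x
    rcases eq_or_ne x 0 with rfl | hx
    · simp [hN00]
    · simp only [hf]
      rw [div_mul_cancel₀ _ (norm_ne_zero_iff.2 hx)]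
  have hNi : Integrable N μ := ((integrable_norm_stdGaussian n).const_mul l).mono'
    hNm.aestronglyMeasurable (Filter.Eventually.of_forall fun x => by
      rw [Real.norm_eq_abs, abs_of_nonneg (hN0 x)]; exact hNle x)
  have hEN : ∫ x, N x ∂μ = (∫ x, f x ∂μ) * a := by
    rw [← integral_mul_norm_stdGaussian hfm hf0 hfr]
    exact integral_congr_ae (Filter.Eventually.of_forall hNf)
  -- the Gaussian bound
  have hlap : ∫⁻ x, ENNReal.ofReal (Real.exp (s / a * N x)) ∂μ
      ≤ ENNReal.ofReal (Real.exp (s * (∫ x, f x ∂μ) + (s * l / a) ^ 2 / 2)) := by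
    have hme : MeasurableEmbedding (WithLp.toLp 2 : (Fin n → ℝ) → EuclideanSpace ℝ (Fin n)) :=
      (MeasurableEquiv.toLp 2 (Fin n → ℝ)).measurableEmbedding
    have hμ' : (Measure.pi (fun _ : Fin n => gaussianReal 0 1)).map (WithLp.toLp 2) = μ :=
      map_pi_eq_stdGaussian
    rw [lintegral_stdGaussian_eq_pi (hNm.const_mul _).exp.ennreal_ofReal]
    have hi : Integrable (fun x => s / a * N (WithLp.toLp 2 x))
        (Measure.pi fun _ : Fin n => gaussianReal 0 1) := by
      have := (hNi.const_mul (s / a))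
      rw [← hμ', hme.integrable_map_iff] at this
      exact this
    have := lintegral_exp_le_of_lipschitz (n := n) (F := fun x => s / a * N (WithLp.toLp 2 x))
      ((hNm.comp hme.measurable).const_mul _) (fun x => mul_nonneg (by positivity) (hN0 _)) hi
      (l := s * l / a) (fun x y => by
        have h1 := mul_le_mul_of_nonneg_left (hlip (WithLp.toLp 2 x) (WithLp.toLp 2 y))
          (show 0 ≤ s / a by positivity)
        rw [EuclideanSpace.norm_eq] at h1
        simp only [PiLp.sub_apply, Real.norm_eq_abs, sq_abs] at h1
        calc _ = s / a * (N (WithLp.toLp 2 x) - N (WithLp.toLp 2 y)) := by ring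
          _ ≤ _ := h1
          _ = _ := by ring)
    refine this.trans (le_of_eq ?_)
    congr 3
    rw [← hme.integral_map (g := fun x => s / a * N x), hμ', integral_const_mul, hEN]
    field_simp
  have hexp_i : Integrable (fun x => Real.exp (s / a * N x)) μ := by
    refine ⟨(hNm.const_mul _).exp.aestronglyMeasurable, ?_⟩
    rw [hasFiniteIntegral_iff_ofReal (Filter.Eventually.of_forall fun x => (Real.exp_pos _).le)]
    exact hlap.trans_lt ENNReal.ofReal_lt_top
  have hexp_le : ∫ x, Real.exp (s / a * N x) ∂μ
      ≤ Real.exp (s * (∫ x, f x ∂μ) + (s * l / a) ^ 2 / 2) := by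
    rw [integral_eq_lintegral_of_nonneg_ae (Filter.Eventually.of_forall fun x => (Real.exp_pos _).le)
      hexp_i.1]
    exact ENNReal.toReal_le_of_le_ofReal (Real.exp_pos _).le hlap
  -- Jensen in the radial direction
  set ψ : EuclideanSpace ℝ (Fin n) → ℝ := fun x => Real.exp (s * f x) * (s * f x) with hψ
  have hem : Measurable fun x => Real.exp (s * f x) := (hfm.const_mul s).exp
  have hψm : Measurable ψ := hem.mul (hfm.const_mul s)
  have hψn : ∀ x, 0 ≤ ψ x := fun x =>
    mul_nonneg (Real.exp_pos _).le (mul_nonneg hs (hf0 x))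
  have heb : ∀ x, Real.exp (s * f x) ≤ Real.exp (s * |l|) := fun x =>
    Real.exp_le_exp.2 (mul_le_mul_of_nonneg_left (hfl x) hs)
  have hψb : ∀ x, ψ x ≤ Real.exp (s * |l|) * (s * |l|) := fun x =>
    mul_le_mul (heb x) (mul_le_mul_of_nonneg_left (hfl x) hs) (mul_nonneg hs (hf0 x)) (Real.exp_pos _).le
  have hei : Integrable (fun x => Real.exp (s * f x)) μ :=
    (integrable_const (Real.exp (s * |l|))).mono' hem.aestronglyMeasurable
      (Filter.Eventually.of_forall fun x => by rw [Real.norm_eq_abs, Real.abs_exp]; exact heb x)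
  have hψi : Integrable ψ μ :=
    (integrable_const (Real.exp (s * |l|) * (s * |l|))).mono' hψm.aestronglyMeasurable
      (Filter.Eventually.of_forall fun x => by
        rw [Real.norm_eq_abs, abs_of_nonneg (hψn x)]; exact hψb x)
  have hψRi : Integrable (fun x => ψ x * ‖x‖) μ :=
    ((integrable_norm_stdGaussian n).const_mul (Real.exp (s * |l|) * (s * |l|))).mono'
      (hψm.mul measurable_norm).aestronglyMeasurable
      (Filter.Eventually.of_forall fun x => by
        rw [Real.norm_eq_abs, abs_of_nonneg (mul_nonneg (hψn x) (norm_nonneg x))]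
        exact mul_le_mul_of_nonneg_right (hψb x) (norm_nonneg x))
  have hψR : ∫ x, ψ x * ‖x‖ ∂μ = (∫ x, ψ x ∂μ) * a :=
    integral_mul_norm_stdGaussian hψm hψn fun r x hr => by simp only [hψ, hfr r x hr]
  refine ⟨hei, le_trans ?_ hexp_le⟩
  -- The added term is ψ(‖x‖/a - 1). It has mean zero because ψ depends on the direction only and a
  -- is the mean norm. It is also the linear term of exp(s f ‖x‖/a) at ‖x‖ = a, so the sum lies
  -- below exp(s N/a).
  calc ∫ x, Real.exp (s * f x) ∂μ
      = ∫ x, (Real.exp (s * f x) + (a⁻¹ * (ψ x * ‖x‖) - ψ x)) ∂μ := by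
        have hi2 : Integrable (fun x => a⁻¹ * (ψ x * ‖x‖) - ψ x) μ := (hψRi.const_mul _).sub hψi
        rw [integral_add hei hi2, integral_sub (hψRi.const_mul _) hψi, integral_const_mul, hψR]
        field_simp
        ring
    _ ≤ ∫ x, Real.exp (s / a * N x) ∂μ := by
        refine integral_mono (hei.add ((hψRi.const_mul _).sub hψi)) hexp_i fun x => ?_
        have h1 := Real.add_one_le_exp (s * f x * (‖x‖ / a - 1))
        have h2 : s / a * N x = s * f x + s * f x * (‖x‖ / a - 1) := by
          rw [hNf x]; field_simp; ring
        simp only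
        rw [h2, Real.exp_add]
        have h3 : Real.exp (s * f x) + (a⁻¹ * (ψ x * ‖x‖) - ψ x)
            = Real.exp (s * f x) * (s * f x * (‖x‖ / a - 1) + 1) := by
          simp only [hψ]; field_simp; ring
        rw [h3]
        exact mul_le_mul_of_nonneg_left h1 (Real.exp_pos _).le

/-- Concentration of a Lipschitz gauge on the sphere around its mean. -/
theorem stdGaussian_direction_tail {n : ℕ} (hn : 0 < n) {N : EuclideanSpace ℝ (Fin n) → ℝ}
    (hN0 : ∀ x, 0 ≤ N x) (hNr : ∀ (r : ℝ) x, 0 < r → N (r • x) = r * N x)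
    {l : ℝ} (hl : 0 < l) (hlip : ∀ x y, N x - N y ≤ l * ‖x - y‖) {y : ℝ} (hy : 0 ≤ y) :
    (stdGaussian (EuclideanSpace ℝ (Fin n))).real
      {x | (∫ x, N x / ‖x‖ ∂stdGaussian (EuclideanSpace ℝ (Fin n))) + l * y / √((n : ℝ) - 1 / 2)
        ≤ N x / ‖x‖} ≤ Real.exp (-y ^ 2 / 2) := by
  have : NeZero n := ⟨hn.ne'⟩
  have h1 : (1 : ℝ) ≤ n := by exact_mod_cast hn
  set w := √((n : ℝ) - 1 / 2) with hw
  have hw0 : 0 < w := Real.sqrt_pos.2 (by linarith)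
  have hwa : w ^ 2 ≤ chiMean n ^ 2 := by
    rw [hw, Real.sq_sqrt (by linarith)]; exact sub_half_le_chiMean_sq hn
  have ha := chiMean_pos hn
  -- The optimal Chernoff parameter when the mean norm is replaced by its lower bound `w`.
  set s := y * w / l with hs
  have hs0 : 0 ≤ s := by positivity
  obtain ⟨hi, hle⟩ := integral_exp_direction_le hN0 hNr hlip hs0
  set m := ∫ x, N x / ‖x‖ ∂stdGaussian (EuclideanSpace ℝ (Fin n))
  have hch := measure_ge_le_exp_mul_mgf (X := fun x => N x / ‖x‖) (m + l * y / w) hs0 hi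
  refine hch.trans ?_
  have hq : (s * l / chiMean n) ^ 2 ≤ y ^ 2 := by
    rw [hs, div_mul_cancel₀ _ hl.ne', div_pow, mul_pow, div_le_iff₀ (by positivity)]
    gcongr
  calc _ ≤ Real.exp (-s * (m + l * y / w)) * Real.exp (s * m + (s * l / chiMean n) ^ 2 / 2) := by
        gcongr; exact hle
    _ ≤ Real.exp (-y ^ 2 / 2) := by
        rw [← Real.exp_add]
        refine Real.exp_le_exp.2 ?_
        have : s * (l * y / w) = y ^ 2 := by rw [hs]; field_simp
        nlinarith

/-! ### Bounds for the standard normal tail. -/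

/-- The upper tail `P(G > x)` of the standard normal distribution. -/
noncomputable def normTail (x : ℝ) : ℝ := (gaussianReal 0 1).real (Set.Ioi x)

theorem normTail_eq_integral (x : ℝ) : normTail x = ∫ y in Set.Ioi x, gaussianPDFReal 0 1 y := by
  rw [normTail, Measure.real, gaussianReal_apply_eq_integral 0 one_ne_zero,
    ENNReal.toReal_ofReal (integral_nonneg fun y => gaussianPDFReal_nonneg 0 1 y)]

theorem normTail_nonneg (x : ℝ) : 0 ≤ normTail x := measureReal_nonneg

theorem continuous_stdGaussianPDF : Continuous (gaussianPDFReal 0 1) := by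
  unfold gaussianPDFReal; fun_prop

theorem stdGaussianPDF_eq (x : ℝ) :
    gaussianPDFReal 0 1 x = (√(2 * Real.pi))⁻¹ * Real.exp (-x ^ 2 / 2) := by
  simp [gaussianPDFReal]

theorem cdf_gaussianReal_eq (x : ℝ) : cdf (gaussianReal 0 1) x = 1 - normTail x := by
  rw [cdf_eq_real, normTail, ← Set.compl_Iic, probReal_compl_eq_one_sub measurableSet_Iic]
  ring

theorem normTail_sub {x y : ℝ} (h : x ≤ y) :
    normTail x - normTail y = ∫ u in x..y, gaussianPDFReal 0 1 u := by
  rw [normTail_eq_integral, normTail_eq_integral, sub_eq_iff_eq_add,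
    intervalIntegral.integral_of_le h, ← setIntegral_union (Set.Ioc_disjoint_Ioi le_rfl)
      measurableSet_Ioi (integrable_gaussianPDFReal 0 1).integrableOn
      (integrable_gaussianPDFReal 0 1).integrableOn, Set.Ioc_union_Ioi_eq_Ioi h]

theorem normTail_eq_sub_integral (x : ℝ) :
    normTail x = normTail 0 - ∫ u in (0 : ℝ)..x, gaussianPDFReal 0 1 u := by
  rcases le_total 0 x with h | h
  · rw [← normTail_sub h]; ring
  · rw [intervalIntegral.integral_symm, ← normTail_sub h]; ring

theorem hasDerivAt_normTail (x : ℝ) : HasDerivAt normTail (-gaussianPDFReal 0 1 x) x := by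
  have h := (intervalIntegral.integral_hasDerivAt_right
    (continuous_stdGaussianPDF.intervalIntegrable 0 x)
    (continuous_stdGaussianPDF.stronglyMeasurableAtFilter _ _)
    continuous_stdGaussianPDF.continuousAt).const_sub (normTail 0)
  exact h.congr_of_eventuallyEq (Filter.Eventually.of_forall normTail_eq_sub_integral)

theorem normTail_strictAnti : StrictAnti normTail :=
  strictAnti_of_hasDerivAt_neg hasDerivAt_normTail fun x =>
    neg_neg_of_pos (gaussianPDFReal_pos 0 1 x one_ne_zero)

theorem continuous_normTail : Continuous normTail :=
  continuous_iff_continuousAt.2 fun x => (hasDerivAt_normTail x).continuousAt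

theorem normTail_zero : normTail 0 = 1 / 2 := by
  have h : ((gaussianReal 0 1).map fun x => -x) = gaussianReal 0 1 := by
    rw [gaussianReal_map_neg, neg_zero]
  have h1 : (gaussianReal 0 1).real (Set.Iio 0) = normTail 0 := by
    rw [normTail, Measure.real, Measure.real]
    conv_lhs => rw [← h, Measure.map_apply measurable_neg measurableSet_Iio]
    simp
  have h2 : (gaussianReal 0 1).real (Set.Iic 0) = (gaussianReal 0 1).real (Set.Iio 0) := by
    have := nullSingletonClass_gaussianReal (μ := 0) (v := 1) one_ne_zero
    exact measureReal_congr Iio_ae_eq_Iic.symm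
  have h3 := cdf_gaussianReal_eq 0
  rw [cdf_eq_real, h2, h1] at h3
  linarith

theorem normTail_stdNormalQuantile {t : ℝ} (h0 : 0 < t) (h1 : t < 1) :
    normTail (stdNormalQuantile (1 - t)) = t := by
  have hset : {x : ℝ | 1 - t ≤ cdf (gaussianReal 0 1) x} = {x | normTail x ≤ t} := by
    ext x
    simp only [Set.mem_ofPred_eq, cdf_gaussianReal_eq]
    constructor <;> intro h <;> linarith
  have hbot : Filter.Tendsto normTail Filter.atBot (nhds 1) := by
    have := (tendsto_cdf_atBot (gaussianReal 0 1)).const_sub 1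
    simpa [cdf_gaussianReal_eq] using this
  have htop : Filter.Tendsto normTail Filter.atTop (nhds 0) := by
    have := (tendsto_cdf_atTop (gaussianReal 0 1)).const_sub 1
    simpa [cdf_gaussianReal_eq] using this
  obtain ⟨a, ha⟩ := (hbot.eventually (lt_mem_nhds h1)).exists
  obtain ⟨b, hb⟩ := (htop.eventually (gt_mem_nhds h0)).exists
  have hab : a ≤ b := by
    by_contra hcon
    have := normTail_strictAnti (not_le.1 hcon)
    linarith
  obtain ⟨q, -, hq⟩ := intermediate_value_Icc' hab continuous_normTail.continuousOn
    (Set.mem_Icc.2 ⟨hb.le, ha.le⟩)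
  have : {x | normTail x ≤ t} = Set.Ici q := by
    ext x
    simp only [Set.mem_ofPred_eq, Set.mem_Ici, ← hq]
    exact normTail_strictAnti.le_iff_ge
  rw [stdNormalQuantile, hset, this, csInf_Ici, hq]

theorem stdNormalQuantile_pos {t : ℝ} (h0 : 0 < t) (h1 : t < 1 / 2) :
    0 < stdNormalQuantile (1 - t) := by
  rw [← normTail_strictAnti.lt_iff_gt, normTail_stdNormalQuantile h0 (by linarith), normTail_zero]
  exact h1

theorem stdNormalQuantile_le {t t' : ℝ} (h0 : 0 < t) (h : t ≤ t') (h1 : t' < 1) :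
    stdNormalQuantile (1 - t') ≤ stdNormalQuantile (1 - t) := by
  rw [← normTail_strictAnti.le_iff_ge, normTail_stdNormalQuantile h0 (by linarith),
    normTail_stdNormalQuantile (by linarith) h1]
  exact h

/-- For x > y the density satisfies φ(x + h) ≤ exp(-h y) φ(x); integrate this over the half-line. It
supplies the exponential decay of excesses over a threshold. -/
theorem normTail_add_le (y : ℝ) {h : ℝ} (hh : 0 ≤ h) :
    normTail (y + h) ≤ Real.exp (-(h * y)) * normTail y := by
  rw [normTail_eq_integral, normTail_eq_integral, ← integral_const_mul]
  have hshift : ∫ x in Set.Ioi (y + h), gaussianPDFReal 0 1 x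
      = ∫ x in Set.Ioi y, gaussianPDFReal 0 1 (x + h) := by
    have := (measurePreserving_add_right (volume : Measure ℝ) h).setIntegral_preimage_emb
      (measurableEmbedding_addRight h) (gaussianPDFReal 0 1) (Set.Ioi (y + h))
    rw [← this]
    simp
  rw [hshift]
  refine setIntegral_mono_on ?_ ((integrable_gaussianPDFReal 0 1).const_mul _).integrableOn
    measurableSet_Ioi fun x hx => ?_
  · exact ((integrable_gaussianPDFReal 0 1).comp_add_right h).integrableOn
  · rw [stdGaussianPDF_eq, stdGaussianPDF_eq, mul_left_comm, ← Real.exp_add]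
    refine mul_le_mul_of_nonneg_left (Real.exp_le_exp.2 ?_) (by positivity)
    have : y < x := hx
    nlinarith

/-- The difference `D` between the tail and y φ(y)/(1 + y²) has derivative -2φ/(1 + y²)². It
decreases, yet it is at least -1/y, so it is nonnegative. -/
theorem normTail_ge_mills {x : ℝ} (hx : 0 < x) :
    x * gaussianPDFReal 0 1 x ≤ (1 + x ^ 2) * normTail x := by
  have hd : ∀ y, HasDerivAt (gaussianPDFReal 0 1) (-(y * gaussianPDFReal 0 1 y)) y := by
    intro y
    have h1 : HasDerivAt (fun y : ℝ => (√(2 * Real.pi))⁻¹ * Real.exp (-y ^ 2 / 2))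
        ((√(2 * Real.pi))⁻¹ * (Real.exp (-y ^ 2 / 2) * (-(2 * y) / 2))) y := by
      have := ((((hasDerivAt_pow 2 y).neg).div_const 2).exp).const_mul (√(2 * Real.pi))⁻¹
      simpa using this
    rw [stdGaussianPDF_eq]
    convert h1 using 1
    · ext y; exact stdGaussianPDF_eq y
    · ring
  set D : ℝ → ℝ := fun y => normTail y - y * gaussianPDFReal 0 1 y / (1 + y ^ 2) with hD
  have hDd : ∀ y, HasDerivAt D (-(2 * gaussianPDFReal 0 1 y / (1 + y ^ 2) ^ 2)) y := by
    intro y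
    have h1 : (1 + y ^ 2) ≠ 0 := by positivity
    have h2 := (hasDerivAt_normTail y).sub
      (((hasDerivAt_id y).mul (hd y)).div ((hasDerivAt_pow 2 y).const_add 1) h1)
    refine h2.congr_deriv ?_
    simp only [id, Pi.mul_apply]
    field_simp
    ring
  have hanti : Antitone D := antitone_of_hasDerivAt_nonpos hDd fun y => by
    have := gaussianPDFReal_nonneg 0 1 y
    exact neg_nonpos.2 (by positivity)
  have hge : ∀ y, 0 < y → -(1 / y) ≤ D y := by
    intro y hy
    have h1 := normTail_nonneg y
    have h2 : y * gaussianPDFReal 0 1 y / (1 + y ^ 2) ≤ 1 / y := by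
      rw [div_le_div_iff₀ (by positivity) hy]
      have : gaussianPDFReal 0 1 y ≤ 1 := by
        rw [stdGaussianPDF_eq]
        have h3 : (√(2 * Real.pi))⁻¹ ≤ 1 := inv_le_one_of_one_le₀ (by
          rw [Real.one_le_sqrt]; nlinarith [Real.pi_gt_three])
        have h4 : Real.exp (-y ^ 2 / 2) ≤ 1 := Real.exp_le_one_iff.2 (by nlinarith [sq_nonneg y])
        nlinarith [Real.exp_pos (-y ^ 2 / 2)]
      nlinarith [mul_le_mul_of_nonneg_left this (sq_nonneg y)]
    simp only [hD]
    linarith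
  have h0 : 0 ≤ D x := by
    have hlim : Filter.Tendsto (fun y : ℝ => -(1 / y)) Filter.atTop (nhds 0) := by
      have := (tendsto_inv_atTop_zero (𝕜 := ℝ)).neg
      simpa using this
    refine le_of_tendsto hlim ?_
    filter_upwards [Filter.eventually_ge_atTop x] with y hy
    exact (hge y (by linarith)).trans (hanti hy)
  simp only [hD] at h0
  rw [sub_nonneg, div_le_iff₀ (by positivity)] at h0
  linarith

theorem integral_Ioi_mul_stdGaussianPDF :
    IntegrableOn (fun u => u * gaussianPDFReal 0 1 u) (Set.Ioi 0) ∧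
    ∫ u in Set.Ioi (0 : ℝ), u * gaussianPDFReal 0 1 u = (√(2 * Real.pi))⁻¹ := by
  have hi : Integrable fun u : ℝ => u * gaussianPDFReal 0 1 u := by
    have := (integrable_mul_exp_neg_mul_sq (b := 1 / 2) (by norm_num)).const_mul (√(2 * Real.pi))⁻¹
    refine this.congr (Filter.Eventually.of_forall fun u => ?_)
    simp only [stdGaussianPDF_eq]
    rw [show -(1 / 2 : ℝ) * u ^ 2 = -u ^ 2 / 2 by ring]
    ring
  refine ⟨hi.integrableOn, ?_⟩
  have h := integral_pow_mul_exp_neg_mul_sq 1 (b := 1 / 2) (by norm_num)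
  have h2 : ((1 / 2 : ℝ) ^ (-(((1 : ℕ) : ℝ) + 1) / 2) * (1 / 2)
      * Real.Gamma ((((1 : ℕ) : ℝ) + 1) / 2)) = 1 := by
    rw [show (-(((1 : ℕ) : ℝ) + 1) / 2) = -1 by norm_num, show (((1 : ℕ) : ℝ) + 1) / 2 = 1 by norm_num,
      Real.Gamma_one, Real.rpow_neg_one]
    norm_num
  rw [h2] at h
  rw [← mul_one (√(2 * Real.pi))⁻¹, ← h, ← integral_const_mul]
  refine integral_congr_ae (Filter.Eventually.of_forall fun u => ?_)
  simp only [stdGaussianPDF_eq]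
  rw [show -(1 / 2 : ℝ) * u ^ 2 = -u ^ 2 / 2 by ring]
  ring

/-- After a shift the tail is exp(-x²/2) times the integral of exp(-x u) over the half-normal law,
which has mass 1/2 and mean 2/√(2π). The tangent line at that mean gives the bound. It is accurate
near zero, where the Mills bound is poor. -/
theorem normTail_ge_jensen (x : ℝ) :
    1 / 2 * Real.exp (-x ^ 2 / 2 - 2 * (√(2 * Real.pi))⁻¹ * x) ≤ normTail x := by
  set c := (√(2 * Real.pi))⁻¹ with hc
  obtain ⟨hi, hv⟩ := integral_Ioi_mul_stdGaussianPDF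
  have hshift : normTail x = ∫ u in Set.Ioi (0 : ℝ), gaussianPDFReal 0 1 (u + x) := by
    have := (measurePreserving_add_right (volume : Measure ℝ) x).setIntegral_preimage_emb
      (measurableEmbedding_addRight x) (gaussianPDFReal 0 1) (Set.Ioi x)
    rw [normTail_eq_integral, ← this]
    simp
  have hhalf : ∫ u in Set.Ioi (0 : ℝ), gaussianPDFReal 0 1 u = 1 / 2 := by
    rw [← normTail_eq_integral, normTail_zero]
  set E := Real.exp (-x ^ 2 / 2 - 2 * c * x) with hE
  have hlow : 1 / 2 * E = ∫ u in Set.Ioi (0 : ℝ),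
      (E * (1 + 2 * c * x) * gaussianPDFReal 0 1 u - E * x * (u * gaussianPDFReal 0 1 u)) := by
    rw [integral_sub ((integrable_gaussianPDFReal 0 1).integrableOn.const_mul _) (hi.const_mul _),
      integral_const_mul, integral_const_mul, hv, hhalf]
    ring
  rw [hlow, hshift]
  refine integral_mono
    (((integrable_gaussianPDFReal 0 1).integrableOn.const_mul _).sub (hi.const_mul _))
    ((integrable_gaussianPDFReal 0 1).comp_add_right x).integrableOn fun u => ?_
  have h1 := Real.add_one_le_exp (-(x * u) + 2 * c * x)
  have h2 : gaussianPDFReal 0 1 (u + x)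
      = gaussianPDFReal 0 1 u * E * Real.exp (-(x * u) + 2 * c * x) := by
    rw [stdGaussianPDF_eq, stdGaussianPDF_eq, hE, mul_assoc, mul_assoc, ← Real.exp_add,
      ← Real.exp_add]
    congr 2
    ring
  simp only
  rw [h2]
  have h3 : 0 ≤ gaussianPDFReal 0 1 u * E :=
    mul_nonneg (gaussianPDFReal_nonneg 0 1 u) (Real.exp_pos _).le
  nlinarith [mul_le_mul_of_nonneg_left h1 h3]

/-- Converts the sub-Gaussian bound at the deviation x + 1/√(2π) into a multiple of the normal tail
at x itself. This is the source of the summand with 1/√(2π) in the requirement on ε₁. -/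
theorem exp_neg_sq_le_three_normTail {x : ℝ} (hx : 0 ≤ x) :
    Real.exp (-(x + 1 / √(2 * Real.pi)) ^ 2 / 2) ≤ 3 * normTail x := by
  rw [one_div]
  set c := (√(2 * Real.pi))⁻¹ with hc
  have hc0 : 0 < c := by positivity
  have hc2 : c ^ 2 * (2 * Real.pi) = 1 := by
    rw [hc, inv_pow, Real.sq_sqrt (by positivity), inv_mul_cancel₀ (by positivity)]
  have p1 := Real.pi_gt_d4
  have p2 := Real.pi_lt_d4
  have hcl : 0.3989 ≤ c := by
    by_contra hcon
    push Not at hcon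
    nlinarith
  have hcu : c ≤ 0.399 := by
    by_contra hcon
    push Not at hcon
    nlinarith
  -- Up to 1.2 the Jensen bound loses at most exp(0.4) ≤ 1.5, and 1.5 · 2 = 3. Beyond 1.2 the Mills
  -- bound reduces the claim to 1 + x² ≤ 3c x exp(cx + c²/2).
  rcases le_or_gt x 1.2 with h | h
  · have hj := normTail_ge_jensen x
    rw [← hc] at hj
    have h4 : Real.exp 0.4 ≤ 1.5 := by
      have h5 : Real.exp 0.4 ^ 5 ≤ 1.5 ^ 5 := by
        rw [← Real.exp_nat_mul]
        have := Real.exp_one_lt_d9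
        calc Real.exp ((5 : ℕ) * 0.4) = Real.exp 1 ^ 2 := by rw [← Real.exp_nat_mul]; norm_num
          _ ≤ 2.7182818286 ^ 2 := by gcongr
          _ ≤ 1.5 ^ 5 := by norm_num
      exact le_of_pow_le_pow_left₀ (by norm_num) (by norm_num) h5
    calc Real.exp (-(x + c) ^ 2 / 2)
        = Real.exp (-x ^ 2 / 2 - 2 * c * x) * Real.exp (c * x - c ^ 2 / 2) := by
          rw [← Real.exp_add]; congr 1; ring
      _ ≤ Real.exp (-x ^ 2 / 2 - 2 * c * x) * 1.5 := by
          refine mul_le_mul_of_nonneg_left (le_trans (Real.exp_le_exp.2 ?_) h4) (Real.exp_pos _).le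
          nlinarith
      _ ≤ 3 * normTail x := by linarith
  · have hm := normTail_ge_mills (show 0 < x by linarith)
    rw [stdGaussianPDF_eq, ← hc] at hm
    have hw : 0.3989 * x + 0.0795 ≤ c * x + c ^ 2 / 2 := by nlinarith
    set w := 0.3989 * x + 0.0795 with hwdef
    have hw0 : 0 ≤ w := by rw [hwdef]; linarith
    have h5 : 1 + w + w ^ 2 / 2 + w ^ 3 / 6 ≤ Real.exp (c * x + c ^ 2 / 2) := by
      refine le_trans ?_ (Real.exp_le_exp.2 hw)
      have := Real.sum_le_exp_of_nonneg hw0 4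
      simpa [Finset.sum_range_succ, Nat.factorial] using this
    -- The factor 1.1967 is 3 · 0.3989, and the cubic is the Taylor polynomial of the exponential.
    have hpoly : 1 + x ^ 2 ≤ 1.1967 * x * (1 + w + w ^ 2 / 2 + w ^ 3 / 6) := by
      obtain ⟨d, hd, rfl⟩ : ∃ d, 0 ≤ d ∧ x = 1.2 + d := ⟨x - 1.2, by linarith, by ring⟩
      rw [hwdef]
      have := mul_nonneg hd hd
      have := mul_nonneg this hd
      have := mul_nonneg this hd
      nlinarith [sq_nonneg (d - 1)]
    have h6 : 1 + x ^ 2 ≤ 3 * c * x * Real.exp (c * x + c ^ 2 / 2) := by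
      refine hpoly.trans ?_
      gcongr
      linarith
    set E := Real.exp (-x ^ 2 / 2) with hE
    have h7 : Real.exp (-(x + c) ^ 2 / 2) * Real.exp (c * x + c ^ 2 / 2) = E := by
      rw [← Real.exp_add, hE]; congr 1; ring
    set F := Real.exp (-(x + c) ^ 2 / 2)
    have hF : 0 < F := Real.exp_pos _
    have h8 : (1 + x ^ 2) * F ≤ (1 + x ^ 2) * (3 * normTail x) := by
      calc (1 + x ^ 2) * F ≤ 3 * c * x * Real.exp (c * x + c ^ 2 / 2) * F := by gcongr
        _ = 3 * (x * (c * E)) := by rw [← h7]; ring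
        _ ≤ _ := by linarith
    exact le_of_mul_le_mul_left h8 (by positivity)

/-! ### Projections of the sphere compared with a normal variable. -/

theorem ae_ne_zero_stdGaussian {n : ℕ} (hn : 0 < n) :
    ∀ᵐ x ∂stdGaussian (EuclideanSpace ℝ (Fin n)), x ≠ 0 := by
  have : NeZero n := ⟨hn.ne'⟩
  rw [stdGaussian_eq_withDensity]
  exact (withDensity_absolutelyContinuous _ _).ae_le (compl_mem_ae_iff.2 (measure_singleton 0))

/-- The tail `E P(G > ρ ‖g‖)` of a ratio of independent Gaussian norms. -/
noncomputable def ratioTail (m : ℕ) (ρ : ℝ) : ℝ :=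
  ∫ y, normTail (ρ * ‖y‖) ∂stdGaussian (EuclideanSpace ℝ (Fin m))

theorem normTail_le_one (x : ℝ) : normTail x ≤ 1 := measureReal_le_one

theorem stdGaussianPDF_le_one (x : ℝ) : gaussianPDFReal 0 1 x ≤ 1 := by
  rw [stdGaussianPDF_eq]
  have h3 : (√(2 * Real.pi))⁻¹ ≤ 1 := inv_le_one_of_one_le₀ (by
    rw [Real.one_le_sqrt]; nlinarith [Real.pi_gt_three])
  have h4 : Real.exp (-x ^ 2 / 2) ≤ 1 := Real.exp_le_one_iff.2 (by nlinarith [sq_nonneg x])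
  nlinarith [Real.exp_pos (-x ^ 2 / 2)]

theorem integrable_normTail_mul_norm (m : ℕ) (ρ : ℝ) :
    Integrable (fun y => normTail (ρ * ‖y‖)) (stdGaussian (EuclideanSpace ℝ (Fin m))) :=
  (integrable_const (1 : ℝ)).mono'
    (continuous_normTail.comp (by fun_prop)).measurable.aestronglyMeasurable
    (Filter.Eventually.of_forall fun y => by
      rw [Real.norm_eq_abs, abs_of_nonneg (normTail_nonneg _)]; exact normTail_le_one _)

theorem hasDerivAt_ratioTail {m : ℕ} (hm : 0 < m) (ρ : ℝ) :
    HasDerivAt (ratioTail m)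
      (-((√(2 * Real.pi))⁻¹ * ((1 + ρ ^ 2) ^ (-((m : ℝ) + 1) / 2) * chiMean m))) ρ := by
  have : NeZero m := ⟨hm.ne'⟩
  have h := hasDerivAt_integral_of_dominated_loc_of_deriv_le
    (μ := stdGaussian (EuclideanSpace ℝ (Fin m)))
    (F := fun ρ y => normTail (ρ * ‖y‖)) (x₀ := ρ) (s := Set.univ)
    (F' := fun ρ y => -gaussianPDFReal 0 1 (ρ * ‖y‖) * ‖y‖) (bound := fun y => ‖y‖)
    Filter.univ_mem
    (Filter.Eventually.of_forall fun ρ => (integrable_normTail_mul_norm m ρ).1)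
    (integrable_normTail_mul_norm m ρ)
    (((continuous_stdGaussianPDF.comp (by fun_prop)).neg.mul
      continuous_norm).measurable.aestronglyMeasurable)
    (Filter.Eventually.of_forall fun y x _ => by
      rw [norm_mul, norm_neg, norm_norm, Real.norm_eq_abs,
        abs_of_nonneg (gaussianPDFReal_nonneg 0 1 _)]
      exact mul_le_of_le_one_left (norm_nonneg y) (stdGaussianPDF_le_one _))
    (integrable_norm_stdGaussian m)
    (Filter.Eventually.of_forall fun y x _ => by
      have := (hasDerivAt_normTail (x * ‖y‖)).comp x ((hasDerivAt_id x).mul_const ‖y‖)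
      rw [one_mul] at this
      exact this)
  refine h.2.congr_deriv ?_
  rw [← integral_norm_mul_exp_stdGaussian (sq_nonneg ρ), ← integral_const_mul, ← integral_neg]
  refine integral_congr_ae (Filter.Eventually.of_forall fun y => ?_)
  simp only [stdGaussianPDF_eq]
  rw [show -(ρ * ‖y‖) ^ 2 / 2 = -ρ ^ 2 * ‖y‖ ^ 2 / 2 by ring]
  ring

theorem ratioTail_zero (m : ℕ) : ratioTail m 0 = 1 / 2 := by
  simp [ratioTail, normTail_zero]

theorem tendsto_normTail_atTop : Filter.Tendsto normTail Filter.atTop (nhds 0) := by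
  have := (tendsto_cdf_atTop (gaussianReal 0 1)).const_sub 1
  simpa [cdf_gaussianReal_eq] using this

theorem tendsto_ratioTail_atTop {m : ℕ} (hm : 0 < m) :
    Filter.Tendsto (ratioTail m) Filter.atTop (nhds 0) := by
  have h := tendsto_integral_filter_of_dominated_convergence
    (μ := stdGaussian (EuclideanSpace ℝ (Fin m))) (l := Filter.atTop)
    (F := fun (ρ : ℝ) y => normTail (ρ * ‖y‖)) (f := fun _ => 0) (fun _ => 1)
    (Filter.Eventually.of_forall fun ρ => (integrable_normTail_mul_norm m ρ).1)
    (Filter.Eventually.of_forall fun ρ => Filter.Eventually.of_forall fun y => by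
      rw [Real.norm_eq_abs, abs_of_nonneg (normTail_nonneg _)]; exact normTail_le_one _)
    (integrable_const 1) (by
      filter_upwards [ae_ne_zero_stdGaussian hm] with y hy
      exact tendsto_normTail_atTop.comp
        (Filter.tendsto_id.atTop_mul_const (norm_pos_iff.2 hy)))
  rw [integral_zero] at h
  exact h

theorem hasDerivAt_div_sqrt_one_add_sq (ρ : ℝ) :
    HasDerivAt (fun ρ : ℝ => ρ / √(1 + ρ ^ 2)) ((1 + ρ ^ 2) ^ (-(3 : ℝ) / 2)) ρ := by
  have h0 : (0 : ℝ) < 1 + ρ ^ 2 := by positivity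
  have h1 : HasDerivAt (fun ρ : ℝ => √(1 + ρ ^ 2)) (ρ / √(1 + ρ ^ 2)) ρ := by
    have := ((hasDerivAt_pow 2 ρ).const_add 1).sqrt h0.ne'
    refine this.congr_deriv ?_
    simp only [Nat.cast_ofNat, Nat.add_one_sub_one, pow_one]
    field_simp
  have h2 := (hasDerivAt_id ρ).div h1 (by positivity)
  refine h2.congr_deriv ?_
  have hs : √(1 + ρ ^ 2) ^ 2 = 1 + ρ ^ 2 := Real.sq_sqrt h0.le
  have h3 : (1 + ρ ^ 2) ^ (-(3 : ℝ) / 2) = (√(1 + ρ ^ 2) ^ 3)⁻¹ := by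
    rw [neg_div, Real.rpow_neg h0.le, Real.sqrt_eq_rpow, ← Real.rpow_natCast ((1 + ρ ^ 2) ^ (1 / 2 : ℝ)),
      ← Real.rpow_mul h0.le]
    norm_num
  rw [h3]
  simp only [id]
  field_simp
  rw [hs]
  ring

/-- Both sides equal 1/2 at ρ = 0 and the right side stays nonnegative as the left one vanishes at
infinity. The derivative of the difference `D` changes sign at most once, from plus to minus, so `D`
cannot become negative in between. -/
theorem ratioTail_le {m : ℕ} (hm : 0 < m) {ρ : ℝ} (hρ : 0 ≤ ρ) :
    ratioTail m ρ ≤ normTail (√((m : ℝ) - 1 / 2) * (ρ / √(1 + ρ ^ 2))) := by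
  have hm1 : (1 : ℝ) ≤ m := by exact_mod_cast hm
  set ν : ℝ := (m : ℝ) - 1 / 2 with hν
  have hν0 : 0 < ν := by rw [hν]; linarith
  have hcp := chiMean_pos hm
  have hcν : √ν ≤ chiMean m := Real.sqrt_le_iff.2 ⟨hcp.le, sub_half_le_chiMean_sq hm⟩
  have hsν : 0 < √ν := Real.sqrt_pos.2 hν0
  set κ := Real.log (chiMean m / √ν) with hκ
  have hκ0 : 0 ≤ κ := Real.log_nonneg ((one_le_div hsν).2 hcν)
  -- `Q` is the logarithm of the quotient of the derivatives of the two tails, as a function of w =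
  -- log(1 + ρ²). It is concave, and nonnegative at 0 because chiMean(m)² ≥ m - 1/2; hence its sign
  -- changes at most once.
  set Q : ℝ → ℝ := fun w => κ - ((m : ℝ) - 2) * w / 2 + ν * (1 - Real.exp (-w)) / 2 with hQ
  have hQc : ∀ w w' : ℝ, 0 ≤ w → w ≤ w' → 0 ≤ Q w' → 0 ≤ Q w := by
    intro w w' hw hww h
    rcases hw.eq_or_lt with rfl | hw0
    · simpa [hQ] using hκ0
    have hw' : 0 < w' := hw0.trans_le hww
    set θ := w / w' with hθ
    have hθ0 : 0 ≤ θ := by positivity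
    have hθ1 : θ ≤ 1 := (div_le_one hw').2 hww
    have e1 : w = θ * w' := by rw [hθ]; field_simp
    have hconv := convexOn_exp.2 (Set.mem_univ 0) (Set.mem_univ (-w')) (sub_nonneg.2 hθ1) hθ0
      (by ring)
    simp only [smul_eq_mul, mul_zero, zero_add, Real.exp_zero, mul_one] at hconv
    have e2 : θ * -w' = -w := by rw [e1]; ring
    rw [e2] at hconv
    have h1 : 0 ≤ (1 - θ) * κ + θ * Q w' :=
      add_nonneg (mul_nonneg (sub_nonneg.2 hθ1) hκ0) (mul_nonneg hθ0 h)
    refine h1.trans ?_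
    simp only [hQ]
    have h2 : ((m : ℝ) - 2) * w = θ * (((m : ℝ) - 2) * w') := by rw [e1]; ring
    rw [h2]
    nlinarith
  set D : ℝ → ℝ := fun ρ => normTail (√ν * (ρ / √(1 + ρ ^ 2))) - ratioTail m ρ with hD
  set K : ℝ → ℝ := fun ρ => (√(2 * Real.pi))⁻¹ * √ν * Real.exp (-ν * (ρ / √(1 + ρ ^ 2)) ^ 2 / 2)
    * (1 + ρ ^ 2) ^ (-(3 : ℝ) / 2) with hK
  have hK0 : ∀ ρ, 0 ≤ K ρ := fun ρ => by positivity
  have hDd : ∀ ρ, HasDerivAt D (K ρ * (Real.exp (Q (Real.log (1 + ρ ^ 2))) - 1)) ρ := by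
    intro ρ
    have h0 : (0 : ℝ) < 1 + ρ ^ 2 := by positivity
    have h1 := ((hasDerivAt_normTail (√ν * (ρ / √(1 + ρ ^ 2)))).comp ρ
      ((hasDerivAt_div_sqrt_one_add_sq ρ).const_mul (√ν))).sub (hasDerivAt_ratioTail hm ρ)
    refine h1.congr_deriv ?_
    have hr2 : (ρ / √(1 + ρ ^ 2)) ^ 2 = 1 - Real.exp (-Real.log (1 + ρ ^ 2)) := by
      rw [Real.exp_neg, Real.exp_log h0, div_pow, Real.sq_sqrt h0.le]
      field_simp
      ring
    have hexp : Real.exp (Q (Real.log (1 + ρ ^ 2))) = chiMean m / √ν *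
        (1 + ρ ^ 2) ^ (-((m : ℝ) - 2) / 2) * Real.exp (ν * (ρ / √(1 + ρ ^ 2)) ^ 2 / 2) := by
      simp only [hQ]
      rw [hr2, Real.exp_add, Real.exp_sub, hκ, Real.exp_log (by positivity),
        Real.rpow_def_of_pos h0, div_eq_mul_inv, ← Real.exp_neg]
      congr 3
      ring
    have hpow : (1 + ρ ^ 2) ^ (-((m : ℝ) + 1) / 2)
        = (1 + ρ ^ 2) ^ (-(3 : ℝ) / 2) * (1 + ρ ^ 2) ^ (-((m : ℝ) - 2) / 2) := by
      rw [← Real.rpow_add h0]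
      congr 1
      ring
    rw [hexp, hpow, stdGaussianPDF_eq, mul_pow, Real.sq_sqrt hν0.le]
    simp only [hK]
    rw [show -(ν * (ρ / √(1 + ρ ^ 2)) ^ 2) / 2 = -ν * (ρ / √(1 + ρ ^ 2)) ^ 2 / 2 by ring]
    have he : Real.exp (-ν * (ρ / √(1 + ρ ^ 2)) ^ 2 / 2)
        * Real.exp (ν * (ρ / √(1 + ρ ^ 2)) ^ 2 / 2) = 1 := by
      rw [← Real.exp_add, ← Real.exp_zero]; congr 1; ring
    set e₁ := Real.exp (-ν * (ρ / √(1 + ρ ^ 2)) ^ 2 / 2)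
    set e₂ := Real.exp (ν * (ρ / √(1 + ρ ^ 2)) ^ 2 / 2)
    set p₁ := (1 + ρ ^ 2) ^ (-(3 : ℝ) / 2)
    set p₂ := (1 + ρ ^ 2) ^ (-((m : ℝ) - 2) / 2)
    have : (√(2 * Real.pi))⁻¹ * √ν * e₁ * p₁ * (chiMean m / √ν * p₂ * e₂ - 1)
        = (√(2 * Real.pi))⁻¹ * p₁ * p₂ * chiMean m * (√ν / √ν) * (e₁ * e₂)
          - (√(2 * Real.pi))⁻¹ * √ν * e₁ * p₁ := by ring
    rw [this, he, div_self hsν.ne']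
    ring
  have hDc : Continuous D := continuous_iff_continuousAt.2 fun x => (hDd x).continuousAt
  have hW : ∀ {a b : ℝ}, 0 ≤ a → a ≤ b → Real.log (1 + a ^ 2) ≤ Real.log (1 + b ^ 2) := by
    intro a b ha hab
    exact Real.log_le_log (by positivity) (by gcongr)
  have hW0 : ∀ a : ℝ, 0 ≤ Real.log (1 + a ^ 2) := fun a =>
    Real.log_nonneg (by nlinarith [sq_nonneg a])
  suffices h : 0 ≤ D ρ by simpa [hD] using h
  -- Either `D` increases on [0, ρ] from its value zero, or it decreases on [ρ, ∞) while staying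
  -- above a function that tends to zero.
  by_cases hq : 0 ≤ Q (Real.log (1 + ρ ^ 2))
  · have hmono : MonotoneOn D (Set.Icc 0 ρ) := by
      refine monotoneOn_of_deriv_nonneg (convex_Icc 0 ρ) hDc.continuousOn
        (fun x _ => (hDd x).differentiableAt.differentiableWithinAt) fun x hx => ?_
      rw [interior_Icc] at hx
      rw [(hDd x).deriv]
      exact mul_nonneg (hK0 x) (sub_nonneg.2 (Real.one_le_exp
        (hQc _ _ (hW0 x) (hW hx.1.le hx.2.le) hq)))
    have := hmono (Set.left_mem_Icc.2 hρ) (Set.right_mem_Icc.2 hρ) hρ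
    have h0 : D 0 = 0 := by simp [hD, normTail_zero, ratioTail_zero]
    linarith
  · have hanti : AntitoneOn D (Set.Ici ρ) := by
      refine antitoneOn_of_deriv_nonpos (convex_Ici ρ) hDc.continuousOn
        (fun x _ => (hDd x).differentiableAt.differentiableWithinAt) fun x hx => ?_
      rw [interior_Ici] at hx
      rw [(hDd x).deriv]
      have hneg : Q (Real.log (1 + x ^ 2)) ≤ 0 := by
        by_contra hcon
        exact hq (hQc _ _ (hW0 ρ) (hW hρ (le_of_lt hx)) (not_le.1 hcon).le)
      exact mul_nonpos_of_nonneg_of_nonpos (hK0 x) (sub_nonpos.2 (Real.exp_le_one_iff.2 hneg))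
    have hlim : Filter.Tendsto (fun x => -ratioTail m x) Filter.atTop (nhds 0) := by
      simpa using (tendsto_ratioTail_atTop hm).neg
    refine le_of_tendsto hlim ?_
    filter_upwards [Filter.eventually_ge_atTop ρ] with x hx
    have h1 := hanti Set.self_mem_Ici (Set.mem_Ici.2 hx) hx
    have h2 : -ratioTail m x ≤ D x := by
      have := normTail_nonneg (√ν * (x / √(1 + x ^ 2)))
      simp only [hD]
      linarith
    exact h2.trans h1

/-- The reflection in the hyperplane orthogonal to v - e₀ exchanges the two unit vectors. -/
theorem exists_isometry_map_single {n : ℕ} [NeZero n] {v : EuclideanSpace ℝ (Fin n)}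
    (hv : ‖v‖ = 1) : ∃ R : EuclideanSpace ℝ (Fin n) ≃ₗᵢ[ℝ] EuclideanSpace ℝ (Fin n),
      ∀ x, inner ℝ v x = (R x) 0 := by
  set w : EuclideanSpace ℝ (Fin n) := EuclideanSpace.single 0 1
  have hw : ‖v‖ = ‖w‖ := by simp [w, hv]
  refine ⟨(ℝ ∙ (v - w))ᗮ.reflection, fun x => ?_⟩
  rw [← LinearIsometryEquiv.inner_map_map (ℝ ∙ (v - w))ᗮ.reflection v x,
    Submodule.reflection_sub hw, EuclideanSpace.inner_single_left]
  simp

/-- The projection of a uniform point of the sphere `S^{n-1}` onto a line has a smaller upper tail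
than the normal distribution with variance `1 / (n - 3/2)`. -/
theorem stdGaussian_direction_inner_tail {n : ℕ} (hn : 2 ≤ n) {v : EuclideanSpace ℝ (Fin n)}
    (hv : ‖v‖ = 1) {r : ℝ} (hr : 0 ≤ r) :
    (stdGaussian (EuclideanSpace ℝ (Fin n))) {x | r * ‖x‖ < inner ℝ v x}
      ≤ ENNReal.ofReal (normTail (√((n : ℝ) - 3 / 2) * r)) := by
  rcases le_or_gt 1 r with hr1 | hr1
  · have : {x : EuclideanSpace ℝ (Fin n) | r * ‖x‖ < inner ℝ v x} = ∅ := by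
      ext x
      simp only [Set.mem_ofPred_eq, Set.mem_empty_iff_false, iff_false, not_lt]
      have := real_inner_le_norm v x
      rw [hv, one_mul] at this
      nlinarith [norm_nonneg x]
    simp [this]
  obtain ⟨m, rfl⟩ : ∃ m, n = m + 1 := ⟨n - 1, by omega⟩
  have hm : 0 < m := by omega
  obtain ⟨R, hR⟩ := exists_isometry_map_single hv
  have hmeas : MeasurableSet {x : EuclideanSpace ℝ (Fin (m + 1)) | r * ‖x‖ < x 0} :=
    measurableSet_lt (by fun_prop) (by fun_prop)
  have h1 : (stdGaussian (EuclideanSpace ℝ (Fin (m + 1)))) {x | r * ‖x‖ < inner ℝ v x}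
      = (stdGaussian (EuclideanSpace ℝ (Fin (m + 1)))) {x | r * ‖x‖ < x 0} := by
    conv_rhs => rw [← stdGaussian_map R, Measure.map_apply R.continuous.measurable hmeas]
    congr 1
    ext x
    simp only [Set.mem_ofPred_eq, Set.mem_preimage, hR x, LinearIsometryEquiv.norm_map]
  have h1r : 0 < 1 - r ^ 2 := by nlinarith
  -- For x = (a, y) the condition r‖x‖ < a amounts to ρ‖y‖ < a, where a and y are independent and y
  -- has n - 1 coordinates. Hence the variance parameter (n - 1) - 1/2 = n - 3/2.
  set ρ := r / √(1 - r ^ 2) with hρ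
  have hρ0 : 0 ≤ ρ := by positivity
  have hρr : ρ / √(1 + ρ ^ 2) = r := by
    have : 1 + ρ ^ 2 = 1 / (1 - r ^ 2) := by
      rw [hρ, div_pow, Real.sq_sqrt h1r.le]; field_simp; ring
    rw [this, Real.sqrt_div zero_le_one, Real.sqrt_one, hρ]
    have := Real.sqrt_pos.2 h1r
    field_simp
  have hsub : ∀ (a : ℝ) (y : Fin m → ℝ),
      r * ‖(WithLp.toLp 2 (Fin.cons a y : Fin (m + 1) → ℝ) : EuclideanSpace ℝ (Fin (m + 1)))‖ < a →
      ρ * ‖(WithLp.toLp 2 y : EuclideanSpace ℝ (Fin m))‖ < a := by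
    intro a y h
    have ha : 0 < a := lt_of_le_of_lt (by positivity) h
    have hn2 : ‖(WithLp.toLp 2 (Fin.cons a y : Fin (m + 1) → ℝ) : EuclideanSpace ℝ (Fin (m + 1)))‖ ^ 2
        = a ^ 2 + ‖(WithLp.toLp 2 y : EuclideanSpace ℝ (Fin m))‖ ^ 2 := by
      rw [EuclideanSpace.real_norm_sq_eq, EuclideanSpace.real_norm_sq_eq, Fin.sum_univ_succ]
      simp
    have h2 := pow_lt_pow_left₀ h (by positivity) two_ne_zero
    rw [mul_pow, hn2] at h2
    refine lt_of_pow_lt_pow_left₀ 2 ha.le ?_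
    rw [mul_pow, hρ, div_pow, Real.sq_sqrt h1r.le, div_mul_eq_mul_div, div_lt_iff₀ h1r]
    nlinarith
  have hint : ∫⁻ y, ENNReal.ofReal (normTail (ρ * ‖y‖)) ∂stdGaussian (EuclideanSpace ℝ (Fin m))
      = ENNReal.ofReal (ratioTail m ρ) := by
    rw [ratioTail, ofReal_integral_eq_lintegral_ofReal (integrable_normTail_mul_norm m ρ)
      (Filter.Eventually.of_forall fun y => normTail_nonneg _)]
  have hnt : ∀ x, (gaussianReal 0 1) (Set.Ioi x) = ENNReal.ofReal (normTail x) := fun x => by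
    rw [normTail, ofReal_measureReal]
  have hset : MeasurableSet {z : ℝ × (Fin m → ℝ) |
      ρ * ‖(WithLp.toLp 2 z.2 : EuclideanSpace ℝ (Fin m))‖ < z.1} :=
    measurableSet_lt (by fun_prop) measurable_fst
  calc (stdGaussian (EuclideanSpace ℝ (Fin (m + 1)))) {x | r * ‖x‖ < inner ℝ v x}
      = ∫⁻ x, {x | r * ‖x‖ < x 0}.indicator 1 x ∂stdGaussian (EuclideanSpace ℝ (Fin (m + 1))) := by
        rw [h1, lintegral_indicator_one hmeas]
    _ = ∫⁻ a, ∫⁻ y, {x | r * ‖x‖ < x 0}.indicator 1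
          (WithLp.toLp 2 (Fin.cons a y : Fin (m + 1) → ℝ) : EuclideanSpace ℝ (Fin (m + 1)))
          ∂(Measure.pi fun _ : Fin m => gaussianReal 0 1) ∂gaussianReal 0 1 := by
        rw [lintegral_stdGaussian_eq_pi (measurable_one.indicator hmeas), lintegral_pi_gaussian_succ]
        exact (measurable_one.indicator hmeas).comp (by fun_prop)
    _ ≤ ∫⁻ a, ∫⁻ y, {z : ℝ × (Fin m → ℝ) |
          ρ * ‖(WithLp.toLp 2 z.2 : EuclideanSpace ℝ (Fin m))‖ < z.1}.indicator 1 (a, y)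
          ∂(Measure.pi fun _ : Fin m => gaussianReal 0 1) ∂gaussianReal 0 1 := by
        refine lintegral_mono fun a => lintegral_mono fun y => ?_
        by_cases h : r * ‖(WithLp.toLp 2 (Fin.cons a y : Fin (m + 1) → ℝ) :
            EuclideanSpace ℝ (Fin (m + 1)))‖ < a
        · have h' := hsub a y h
          simp only [Set.indicator, Set.mem_ofPred_eq, h', if_true]
          split_ifs <;> simp
        · simp [Set.indicator, h]
    _ = ∫⁻ y, ∫⁻ a, {z : ℝ × (Fin m → ℝ) |
          ρ * ‖(WithLp.toLp 2 z.2 : EuclideanSpace ℝ (Fin m))‖ < z.1}.indicator 1 (a, y)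
          ∂gaussianReal 0 1 ∂(Measure.pi fun _ : Fin m => gaussianReal 0 1) :=
        lintegral_lintegral_swap (measurable_one.indicator hset).aemeasurable
    _ = ∫⁻ y, ENNReal.ofReal (normTail (ρ * ‖(WithLp.toLp 2 y : EuclideanSpace ℝ (Fin m))‖))
          ∂(Measure.pi fun _ : Fin m => gaussianReal 0 1) := by
        refine lintegral_congr fun y => ?_
        rw [← hnt, ← lintegral_indicator_one measurableSet_Ioi]
        rfl
    _ = ENNReal.ofReal (ratioTail m ρ) := by
        rw [← hint, lintegral_stdGaussian_eq_pi]
        exact (continuous_normTail.comp (by fun_prop)).measurable.ennreal_ofReal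
    _ ≤ _ := by
        have := ratioTail_le hm hρ0
        rw [hρr] at this
        refine ENNReal.ofReal_le_ofReal (this.trans_eq ?_)
        congr 3
        push_cast
        ring

/-! ### Correlations of a standardized design with a random direction. -/

/-- The inner products of the columns of a design with a vector. -/
def colDot {n p : ℕ} (X : Matrix (Fin n) (Fin p) ℝ) (e : Fin n → ℝ) (j : Fin p) : ℝ :=
  ∑ i, X i j * e i

/-- Nonnegative weights bounded by `1 / m` with total mass at most one. -/
def weightPolytope (p : ℕ) (m : ℝ) : Set (Fin p → ℝ) :=
  {a | (∀ j, 0 ≤ a j ∧ a j ≤ 1 / m) ∧ ∑ j, a j ≤ 1}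

theorem colDot_smul {n p : ℕ} (X : Matrix (Fin n) (Fin p) ℝ) (r : ℝ) (e : Fin n → ℝ) (j : Fin p) :
    colDot X (r • e) j = r * colDot X e j := by
  simp only [colDot, Pi.smul_apply, smul_eq_mul, Finset.mul_sum]
  exact Finset.sum_congr rfl fun i _ => by ring

theorem colDot_add {n p : ℕ} (X : Matrix (Fin n) (Fin p) ℝ) (e f : Fin n → ℝ) (j : Fin p) :
    colDot X (e + f) j = colDot X e j + colDot X f j := by
  simp only [colDot, Pi.add_apply, mul_add, Finset.sum_add_distrib]

theorem l2norm_smul {n : ℕ} (r : ℝ) (e : Fin n → ℝ) : l2norm (r • e) = |r| * l2norm e := by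
  simp [l2norm, WithLp.toLp_smul, norm_smul]

/-- A Gaussian vector with independent centered coordinates of equal variance gives cones the
same probability as a standard Gaussian vector. -/
theorem pi_gaussian_cone_eq {n : ℕ} {σ : ℝ} (hσ : 0 < σ) {S : Set (Fin n → ℝ)}
    (hS : MeasurableSet S) (hcone : ∀ (r : ℝ) e, 0 < r → (r • e ∈ S ↔ e ∈ S)) :
    (Measure.pi fun _ : Fin n => gaussianReal 0 (σ ^ 2).toNNReal) S
      = stdGaussian (EuclideanSpace ℝ (Fin n)) {x | x.ofLp ∈ S} := by
  have h1 : (Measure.pi fun _ : Fin n => gaussianReal 0 (σ ^ 2).toNNReal)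
      = (Measure.pi fun _ : Fin n => gaussianReal 0 1).map fun e => σ • e := by
    have := Measure.pi_map_pi (μ := fun _ : Fin n => gaussianReal 0 1)
      (f := fun _ x => σ * x) (fun _ => (measurable_const_mul σ).aemeasurable)
    have h2 : ((gaussianReal 0 1).map fun x => σ * x) = gaussianReal 0 (σ ^ 2).toNNReal := by
      rw [gaussianReal_map_const_mul]
      congr 1
      · simp
      · ext; simp [sq_nonneg]
    simp only [h2] at this
    rw [← this]
    rfl
  have hm : MeasurableSet {x : EuclideanSpace ℝ (Fin n) | x.ofLp ∈ S} :=
    (by fun_prop : Measurable fun x : EuclideanSpace ℝ (Fin n) => x.ofLp) hS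
  rw [h1, Measure.map_apply (by fun_prop) hS, ← map_pi_eq_stdGaussian,
    Measure.map_apply (by fun_prop) hm]
  congr 1
  ext e
  simp [hcone σ e hσ]

/-- The normalized column of a design as a unit vector. -/
noncomputable def unitCol {n p : ℕ} (X : Matrix (Fin n) (Fin p) ℝ) (j : Fin p) :
    EuclideanSpace ℝ (Fin n) := (√(n : ℝ))⁻¹ • WithLp.toLp 2 fun i => X i j

theorem norm_unitCol {n p : ℕ} (hn : 0 < n) {X : Matrix (Fin n) (Fin p) ℝ} (hX : Standardized X)
    (j : Fin p) : ‖unitCol X j‖ = 1 := by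
  have hn' : (0 : ℝ) < n := by exact_mod_cast hn
  have h : l2norm (fun i => X i j) = √(n : ℝ) := by
    rw [← hX j]
    exact (Real.sqrt_sq (norm_nonneg (WithLp.toLp 2 fun i => X i j))).symm
  rw [unitCol, norm_smul, show ‖WithLp.toLp 2 fun i => X i j‖ = √(n : ℝ) from h, Real.norm_eq_abs,
    abs_of_nonneg (by positivity), inv_mul_cancel₀ (Real.sqrt_pos.2 hn').ne']

theorem inner_unitCol {n p : ℕ} (X : Matrix (Fin n) (Fin p) ℝ) (j : Fin p)
    (x : EuclideanSpace ℝ (Fin n)) :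
    inner ℝ (unitCol X j) x = (√(n : ℝ))⁻¹ * colDot X x.ofLp j := by
  rw [unitCol, real_inner_smul_left, PiLp.inner_apply]
  simp [colDot, mul_comm]

theorem colDot_eq_inner {n p : ℕ} (hn : 0 < n) (X : Matrix (Fin n) (Fin p) ℝ) (j : Fin p)
    (x : EuclideanSpace ℝ (Fin n)) :
    colDot X x.ofLp j = √(n : ℝ) * inner ℝ (unitCol X j) x := by
  have hn' : (0 : ℝ) < n := by exact_mod_cast hn
  rw [inner_unitCol, mul_inv_cancel_left₀ (Real.sqrt_pos.2 hn').ne']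

theorem stdGaussian_abs_inner_tail {n : ℕ} (hn : 2 ≤ n) {v : EuclideanSpace ℝ (Fin n)}
    (hv : ‖v‖ = 1) {r : ℝ} (hr : 0 ≤ r) :
    (stdGaussian (EuclideanSpace ℝ (Fin n))) {x | r * ‖x‖ < |inner ℝ v x|}
      ≤ ENNReal.ofReal (2 * normTail (√((n : ℝ) - 3 / 2) * r)) := by
  have hsub : {x : EuclideanSpace ℝ (Fin n) | r * ‖x‖ < |inner ℝ v x|}
      ⊆ {x | r * ‖x‖ < inner ℝ v x} ∪ {x | r * ‖x‖ < inner ℝ (-v) x} := by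
    intro x hx
    have hx' : r * ‖x‖ < |inner ℝ v x| := hx
    rcases lt_abs.1 hx' with h | h
    · exact Or.inl h
    · exact Or.inr (by simpa [inner_neg_left] using h)
  refine (measure_mono hsub).trans ((measure_union_le _ _).trans ?_)
  rw [two_mul, ENNReal.ofReal_add (normTail_nonneg _) (normTail_nonneg _)]
  exact add_le_add (stdGaussian_direction_inner_tail hn hv hr)
    (stdGaussian_direction_inner_tail hn (by rwa [norm_neg]) hr)

/-- Uniform bound for the correlations of the noise with the columns of a standardized design. -/
theorem stdGaussian_max_colDot_tail {n p : ℕ} (hn : 2 ≤ n) {X : Matrix (Fin n) (Fin p) ℝ}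
    (hX : Standardized X) {r : ℝ} (hr : 0 ≤ r) :
    (stdGaussian (EuclideanSpace ℝ (Fin n)))
      {x | ∃ j, r * (√(n : ℝ) * l2norm x.ofLp) < |colDot X x.ofLp j|}
      ≤ ENNReal.ofReal (2 * p * normTail (√((n : ℝ) - 3 / 2) * r)) := by
  have hn0 : 0 < n := by omega
  have hn' : (0 : ℝ) < √(n : ℝ) := Real.sqrt_pos.2 (by exact_mod_cast hn0)
  have hsub : {x : EuclideanSpace ℝ (Fin n) | ∃ j, r * (√(n : ℝ) * l2norm x.ofLp)
      < |colDot X x.ofLp j|} ⊆ ⋃ j, {x | r * ‖x‖ < |inner ℝ (unitCol X j) x|} := by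
    rintro x ⟨j, hj⟩
    refine Set.mem_iUnion.2 ⟨j, ?_⟩
    rw [colDot_eq_inner hn0, abs_mul, abs_of_pos hn'] at hj
    have : √(n : ℝ) * (r * ‖x‖) < √(n : ℝ) * |inner ℝ (unitCol X j) x| :=
      lt_of_eq_of_lt (by simp only [l2norm]; ring) hj
    exact lt_of_mul_lt_mul_left this hn'.le
  refine (measure_mono hsub).trans ((measure_iUnion_fintype_le _ _).trans ?_)
  calc _ ≤ ∑ _j : Fin p, ENNReal.ofReal (2 * normTail (√((n : ℝ) - 3 / 2) * r)) :=
        Finset.sum_le_sum fun j _ => stdGaussian_abs_inner_tail hn (norm_unitCol hn0 hX j) hr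
    _ = _ := by
        rw [Finset.sum_const, Finset.card_univ, Fintype.card_fin, nsmul_eq_mul,
          ← ENNReal.ofReal_natCast, ← ENNReal.ofReal_mul (Nat.cast_nonneg p)]
        congr 1
        ring

/-- Mean excess of the projection of a uniform point of the sphere onto a line. -/
theorem lintegral_excess_inner_le {n : ℕ} (hn : 2 ≤ n) {v : EuclideanSpace ℝ (Fin n)}
    (hv : ‖v‖ = 1) {L τ : ℝ} (hL : 0 < L) (hτ : 0 ≤ τ) :
    ∫⁻ x, ENNReal.ofReal (|inner ℝ v x| / ‖x‖ - (1 + τ) * L / √((n : ℝ) - 3 / 2))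
        ∂stdGaussian (EuclideanSpace ℝ (Fin n))
      ≤ ENNReal.ofReal (2 * normTail L * Real.exp (-(τ * L ^ 2)) / (√((n : ℝ) - 3 / 2) * L)) := by
  have hn' : (2 : ℝ) ≤ n := by exact_mod_cast hn
  set q := √((n : ℝ) - 3 / 2) with hq
  have hq0 : 0 < q := Real.sqrt_pos.2 (by linarith)
  set c := (1 + τ) * L / q with hc
  have hc0 : 0 ≤ c := by positivity
  set f : EuclideanSpace ℝ (Fin n) → ℝ := fun x => max (|inner ℝ v x| / ‖x‖ - c) 0 with hf
  have hfm : Measurable f := by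
    refine Measurable.max (Measurable.sub_const ?_ c) measurable_const
    exact (by fun_prop : Continuous fun x : EuclideanSpace ℝ (Fin n) =>
      |inner ℝ v x|).measurable.div measurable_norm
  have h1 : ∀ x, ENNReal.ofReal (|inner ℝ v x| / ‖x‖ - c) = ENNReal.ofReal (f x) := by
    intro x
    simp [hf, ENNReal.ofReal_max]
  rw [lintegral_congr h1, lintegral_eq_lintegral_meas_lt _
    (show 0 ≤ᵐ[_] f from Filter.Eventually.of_forall fun x => le_max_right _ _) hfm.aemeasurable]
  have hK0 : 0 ≤ 2 * normTail L * Real.exp (-(τ * L ^ 2)) := by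
    have := normTail_nonneg L
    positivity
  have hpt : ∀ t ∈ Set.Ioi (0 : ℝ), stdGaussian (EuclideanSpace ℝ (Fin n)) {x | t < f x}
      ≤ ENNReal.ofReal (2 * normTail L * Real.exp (-(τ * L ^ 2)) * Real.exp (-(q * L) * t)) := by
    intro t ht
    have ht0 : 0 < t := ht
    have hsub : {x | t < f x} ⊆ {x | (c + t) * ‖x‖ < |inner ℝ v x|} := by
      intro x hx
      have hx1 : t < |inner ℝ v x| / ‖x‖ - c := by
        have hx' : t < max (|inner ℝ v x| / ‖x‖ - c) 0 := hx
        rcases lt_max_iff.1 hx' with h | h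
        · exact h
        · exact absurd h (not_lt.2 ht0.le)
      have hx0 : x ≠ 0 := by
        rintro rfl
        simp at hx1
        linarith
      have := norm_pos_iff.2 hx0
      have hx2 : c + t < |inner ℝ v x| / ‖x‖ := by linarith
      exact (lt_div_iff₀ this).1 hx2
    refine (measure_mono hsub).trans ((stdGaussian_abs_inner_tail hn hv (by positivity)).trans ?_)
    refine ENNReal.ofReal_le_ofReal ?_
    have h2 := normTail_add_le L (h := τ * L + q * t) (by positivity)
    -- The threshold `c` lies τL/q above L/q, so the shifted tail bound yields the gain exp(-τL²)
    -- and a rate `q * L` in `t`.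
    have h3 : q * (c + t) = L + (τ * L + q * t) := by rw [hc]; field_simp; ring
    rw [← hq, h3]
    have h4 : Real.exp (-((τ * L + q * t) * L))
        = Real.exp (-(τ * L ^ 2)) * Real.exp (-(q * L) * t) := by
      rw [← Real.exp_add]; congr 1; ring
    rw [h4] at h2
    nlinarith
  have hneg : -(q * L) < 0 := neg_neg_of_pos (by positivity)
  refine (setLIntegral_mono' measurableSet_Ioi hpt).trans ?_
  rw [← ofReal_integral_eq_lintegral_ofReal ((integrableOn_exp_mul_Ioi hneg 0).const_mul _)
    (Filter.Eventually.of_forall fun t => mul_nonneg hK0 (Real.exp_pos _).le),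
    integral_const_mul, integral_exp_mul_Ioi hneg]
  refine ENNReal.ofReal_le_ofReal (le_of_eq ?_)
  simp only [mul_zero, Real.exp_zero]
  rw [neg_div_neg_eq]
  ring

/-! ### The gauge of largest weighted averages: mean and tail. -/

theorem zero_mem_weightPolytope (p : ℕ) {m : ℝ} (hm : 0 < m) : (0 : Fin p → ℝ) ∈ weightPolytope p m :=
  ⟨fun _ => ⟨le_rfl, by simp only [Pi.zero_apply]; positivity⟩, by simp⟩

/-- The largest weighted average of the absolute projections onto the given directions. -/
noncomputable def averageGauge {n p : ℕ} (v : Fin p → EuclideanSpace ℝ (Fin n)) (m : ℝ)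
    (x : EuclideanSpace ℝ (Fin n)) : ℝ :=
  ⨆ a : weightPolytope p m, ∑ j, a.1 j * |inner ℝ (v j) x|

section averageGauge

variable {n p : ℕ} {v : Fin p → EuclideanSpace ℝ (Fin n)} {m : ℝ}

theorem bddAbove_averageGauge (x : EuclideanSpace ℝ (Fin n)) :
    BddAbove (Set.range fun a : weightPolytope p m => ∑ j, a.1 j * |inner ℝ (v j) x|) := by
  refine ⟨∑ j, 1 / m * |inner ℝ (v j) x|, ?_⟩
  rintro _ ⟨a, rfl⟩
  exact Finset.sum_le_sum fun j _ => mul_le_mul_of_nonneg_right (a.2.1 j).2 (abs_nonneg _)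

theorem le_averageGauge {a : Fin p → ℝ} (ha : a ∈ weightPolytope p m)
    (x : EuclideanSpace ℝ (Fin n)) : ∑ j, a j * |inner ℝ (v j) x| ≤ averageGauge v m x :=
  le_ciSup (bddAbove_averageGauge x) ⟨a, ha⟩

theorem averageGauge_le (hm : 0 < m) {x : EuclideanSpace ℝ (Fin n)} {b : ℝ}
    (h : ∀ a ∈ weightPolytope p m, ∑ j, a j * |inner ℝ (v j) x| ≤ b) :
    averageGauge v m x ≤ b :=
  have : Nonempty (weightPolytope p m) := ⟨⟨0, zero_mem_weightPolytope p hm⟩⟩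
  ciSup_le fun a => h a.1 a.2

theorem averageGauge_nonneg (hm : 0 < m) (x : EuclideanSpace ℝ (Fin n)) :
    0 ≤ averageGauge v m x := by
  simpa using le_averageGauge (v := v) (zero_mem_weightPolytope p hm) x

theorem averageGauge_smul {r : ℝ} (hr : 0 < r) (x : EuclideanSpace ℝ (Fin n)) :
    averageGauge v m (r • x) = r * averageGauge v m x := by
  rw [averageGauge, averageGauge, Real.mul_iSup_of_nonneg hr.le]
  congr 1
  funext a
  rw [Finset.mul_sum]
  refine Finset.sum_congr rfl fun j _ => ?_
  rw [inner_smul_right, abs_mul, abs_of_pos hr]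
  ring

theorem averageGauge_sub_le (hm : 0 < m) {l : ℝ}
    (hlip : ∀ a ∈ weightPolytope p m, ∀ x, ∑ j, a j * |inner ℝ (v j) x| ≤ l * ‖x‖)
    (x y : EuclideanSpace ℝ (Fin n)) :
    averageGauge v m x - averageGauge v m y ≤ l * ‖x - y‖ := by
  rw [sub_le_iff_le_add]
  refine averageGauge_le hm fun a ha => ?_
  have h1 := le_averageGauge (v := v) ha y
  have h2 := hlip a ha (x - y)
  have h3 : ∑ j, a j * |inner ℝ (v j) x|
      ≤ ∑ j, a j * |inner ℝ (v j) (x - y)| + ∑ j, a j * |inner ℝ (v j) y| := by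
    rw [← Finset.sum_add_distrib]
    refine Finset.sum_le_sum fun j _ => ?_
    rw [← mul_add]
    refine mul_le_mul_of_nonneg_left ?_ (ha.1 j).1
    calc |inner ℝ (v j) x| = |inner ℝ (v j) (x - y) + inner ℝ (v j) y| := by
          rw [← inner_add_right, sub_add_cancel]
      _ ≤ _ := abs_add_le _ _
  linarith

theorem continuous_averageGauge (hm : 0 < m) {l : ℝ}
    (hlip : ∀ a ∈ weightPolytope p m, ∀ x, ∑ j, a j * |inner ℝ (v j) x| ≤ l * ‖x‖) :
    Continuous (averageGauge v m) := by
  refine (LipschitzWith.of_le_add_mul' l fun x y => ?_).continuous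
  have := averageGauge_sub_le hm hlip x y
  rw [dist_eq_norm]
  linarith

/-- Weights of total mass at most one contribute at most `c` below the level `c`. Above it, each
weight is at most 1/m, so the excesses enter with that factor. Expectations can then be taken one
column at a time. -/
theorem averageGauge_div_norm_le (hm : 0 < m) {c : ℝ} (hc : 0 ≤ c) (x : EuclideanSpace ℝ (Fin n)) :
    averageGauge v m x / ‖x‖ ≤ c + ∑ j, 1 / m * max (|inner ℝ (v j) x| / ‖x‖ - c) 0 := by
  have hs : 0 ≤ ∑ j, 1 / m * max (|inner ℝ (v j) x| / ‖x‖ - c) 0 :=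
    Finset.sum_nonneg fun j _ => mul_nonneg (by positivity) (le_max_right _ _)
  rcases eq_or_ne x 0 with rfl | hx
  · simp only [norm_zero, div_zero] at hs ⊢
    linarith
  have hx0 := norm_pos_iff.2 hx
  rw [div_le_iff₀ hx0]
  refine averageGauge_le hm fun a ha => ?_
  have h1 : ∀ j, a j * |inner ℝ (v j) x|
      ≤ (c * a j + 1 / m * max (|inner ℝ (v j) x| / ‖x‖ - c) 0) * ‖x‖ := by
    intro j
    have hj : |inner ℝ (v j) x| = |inner ℝ (v j) x| / ‖x‖ * ‖x‖ := by field_simp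
    have h2 : |inner ℝ (v j) x| / ‖x‖ ≤ c + max (|inner ℝ (v j) x| / ‖x‖ - c) 0 := by
      linarith [le_max_left (|inner ℝ (v j) x| / ‖x‖ - c) 0]
    have h3 := mul_le_mul_of_nonneg_left h2 (ha.1 j).1
    have h4 := mul_le_mul_of_nonneg_right (ha.1 j).2 (le_max_right (|inner ℝ (v j) x| / ‖x‖ - c) 0)
    calc a j * |inner ℝ (v j) x| = a j * (|inner ℝ (v j) x| / ‖x‖) * ‖x‖ := by
          conv_lhs => rw [hj]
          ring
      _ ≤ _ := by
          refine mul_le_mul_of_nonneg_right ?_ hx0.le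
          linarith
  refine (Finset.sum_le_sum fun j _ => h1 j).trans ?_
  rw [← Finset.sum_mul, Finset.sum_add_distrib, ← Finset.mul_sum]
  refine mul_le_mul_of_nonneg_right ?_ hx0.le
  have := mul_le_mul_of_nonneg_left ha.2 hc
  linarith

/-- Mean of the largest weighted average of the projections of a uniform point of the sphere. -/
theorem integral_averageGauge_le (hn : 2 ≤ n) (hv : ∀ j, ‖v j‖ = 1) (hm : 0 < m) {l : ℝ}
    (hlip : ∀ a ∈ weightPolytope p m, ∀ x, ∑ j, a j * |inner ℝ (v j) x| ≤ l * ‖x‖)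
    {L τ : ℝ} (hL : 0 < L) (hτ : 0 ≤ τ) :
    ∫ x, averageGauge v m x / ‖x‖ ∂stdGaussian (EuclideanSpace ℝ (Fin n))
      ≤ (1 + τ) * L / √((n : ℝ) - 3 / 2)
        + p / m * (2 * normTail L * Real.exp (-(τ * L ^ 2)) / (√((n : ℝ) - 3 / 2) * L)) := by
  have hn' : (2 : ℝ) ≤ n := by exact_mod_cast hn
  have hq0 : 0 < √((n : ℝ) - 3 / 2) := Real.sqrt_pos.2 (by linarith)
  have hc : 0 ≤ (1 + τ) * L / √((n : ℝ) - 3 / 2) := by positivity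
  set c := (1 + τ) * L / √((n : ℝ) - 3 / 2)
  set Q := 2 * normTail L * Real.exp (-(τ * L ^ 2)) / (√((n : ℝ) - 3 / 2) * L)
  have hQ : 0 ≤ Q := by
    have := normTail_nonneg L
    positivity
  have hmeas : Measurable fun x => averageGauge v m x / ‖x‖ :=
    (continuous_averageGauge hm hlip).measurable.div measurable_norm
  rw [integral_eq_lintegral_of_nonneg_ae (Filter.Eventually.of_forall fun x =>
    div_nonneg (averageGauge_nonneg hm x) (norm_nonneg x)) hmeas.aestronglyMeasurable]
  refine ENNReal.toReal_le_of_le_ofReal (by positivity) ?_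
  calc ∫⁻ x, ENNReal.ofReal (averageGauge v m x / ‖x‖) ∂stdGaussian (EuclideanSpace ℝ (Fin n))
      ≤ ∫⁻ x, (ENNReal.ofReal c + ∑ j, ENNReal.ofReal (1 / m)
          * ENNReal.ofReal (|inner ℝ (v j) x| / ‖x‖ - c))
          ∂stdGaussian (EuclideanSpace ℝ (Fin n)) := by
        refine lintegral_mono fun x => ?_
        refine (ENNReal.ofReal_le_ofReal (averageGauge_div_norm_le hm hc x)).trans ?_
        rw [ENNReal.ofReal_add hc (Finset.sum_nonneg fun j _ =>
          mul_nonneg (by positivity) (le_max_right _ _)),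
          ENNReal.ofReal_sum_of_nonneg fun j _ => mul_nonneg (by positivity) (le_max_right _ _)]
        refine add_le_add le_rfl (Finset.sum_le_sum fun j _ => ?_)
        rw [ENNReal.ofReal_mul (by positivity), ENNReal.ofReal_max, ENNReal.ofReal_zero,
          max_eq_left zero_le]
    _ = ENNReal.ofReal c + ∑ j, ENNReal.ofReal (1 / m)
          * (∫⁻ x, ENNReal.ofReal (|inner ℝ (v j) x| / ‖x‖ - c)
            ∂stdGaussian (EuclideanSpace ℝ (Fin n))) := by
        have hjm : ∀ j, Measurable fun x : EuclideanSpace ℝ (Fin n) =>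
            ENNReal.ofReal (|inner ℝ (v j) x| / ‖x‖ - c) := fun j =>
          (((by fun_prop : Continuous fun x : EuclideanSpace ℝ (Fin n) =>
            |inner ℝ (v j) x|).measurable.div measurable_norm).sub_const c).ennreal_ofReal
        rw [lintegral_add_left measurable_const, lintegral_const, measure_univ, mul_one,
          lintegral_finsetSum _ fun j _ => (hjm j).const_mul _]
        congr 1
        exact Finset.sum_congr rfl fun j _ => lintegral_const_mul _ (hjm j)
    _ ≤ ENNReal.ofReal c + ∑ _j : Fin p, ENNReal.ofReal (1 / m) * ENNReal.ofReal Q :=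
        add_le_add le_rfl (Finset.sum_le_sum fun j _ =>
          mul_le_mul_right (lintegral_excess_inner_le hn (hv j) hL hτ) _)
    _ = ENNReal.ofReal (c + p / m * Q) := by
        rw [Finset.sum_const, Finset.card_univ, Fintype.card_fin, nsmul_eq_mul,
          ← ENNReal.ofReal_natCast, ← ENNReal.ofReal_mul (by positivity),
          ← ENNReal.ofReal_mul (by positivity), ← ENNReal.ofReal_add hc (by positivity)]
        congr 1
        ring

/-- Tail bound for the largest weighted average of the projections of a uniform point of the
sphere. -/
theorem stdGaussian_averageGauge_tail (hn : 2 ≤ n) (hv : ∀ j, ‖v j‖ = 1) (hm : 0 < m) {l : ℝ}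
    (hl : 0 < l) (hlip : ∀ a ∈ weightPolytope p m, ∀ x, ∑ j, a j * |inner ℝ (v j) x| ≤ l * ‖x‖)
    {L τ y r : ℝ} (hL : 0 < L) (hτ : 0 ≤ τ) (hy : 0 ≤ y)
    (hr : (1 + τ) * L + p / m * (2 * normTail L * Real.exp (-(τ * L ^ 2)) / L) + l * y
      ≤ √((n : ℝ) - 3 / 2) * r) :
    stdGaussian (EuclideanSpace ℝ (Fin n))
      {x | ∃ a ∈ weightPolytope p m, r * ‖x‖ < ∑ j, a j * |inner ℝ (v j) x|}
      ≤ ENNReal.ofReal (Real.exp (-y ^ 2 / 2)) := by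
  have hn' : (2 : ℝ) ≤ n := by exact_mod_cast hn
  have h1 := stdGaussian_direction_tail (by omega) (averageGauge_nonneg (v := v) hm)
    (fun r x hr => averageGauge_smul (v := v) (m := m) hr x) hl (averageGauge_sub_le hm hlip) hy
  have h2 := integral_averageGauge_le hn hv hm hlip hL hτ
  refine (measure_mono ?_).trans ((ENNReal.le_ofReal_iff_toReal_le (measure_ne_top _ _)
    (Real.exp_pos _).le).2 h1)
  rintro x ⟨a, ha, hx⟩
  have hq0 : 0 < √((n : ℝ) - 3 / 2) := Real.sqrt_pos.2 (by linarith)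
  have hq1 : √((n : ℝ) - 3 / 2) ≤ √((n : ℝ) - 1 / 2) := Real.sqrt_le_sqrt (by linarith)
  have hx0 : x ≠ 0 := by
    rintro rfl
    simp at hx
  have hx' := norm_pos_iff.2 hx0
  have h3 : r ≤ averageGauge v m x / ‖x‖ := by
    rw [le_div_iff₀ hx']
    exact hx.le.trans (le_averageGauge ha x)
  -- The fluctuation has the better normalisation n - 1/2; it is weakened to n - 3/2 to match the
  -- mean.
  have h4 : l * y / √((n : ℝ) - 1 / 2) ≤ l * y / √((n : ℝ) - 3 / 2) :=
    div_le_div_of_nonneg_left (by positivity) hq0 hq1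
  have h5 : (1 + τ) * L / √((n : ℝ) - 3 / 2)
      + p / m * (2 * normTail L * Real.exp (-(τ * L ^ 2)) / (√((n : ℝ) - 3 / 2) * L))
      + l * y / √((n : ℝ) - 3 / 2) ≤ r := by
    have : (1 + τ) * L / √((n : ℝ) - 3 / 2)
      + p / m * (2 * normTail L * Real.exp (-(τ * L ^ 2)) / (√((n : ℝ) - 3 / 2) * L))
      + l * y / √((n : ℝ) - 3 / 2) = ((1 + τ) * L
        + p / m * (2 * normTail L * Real.exp (-(τ * L ^ 2)) / L) + l * y)
        / √((n : ℝ) - 3 / 2) := by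
      field_simp
    rw [this, div_le_iff₀ hq0]
    linarith
  simp only [Set.mem_ofPred_eq]
  linarith

end averageGauge

/-! ### Top coordinates, sparse eigenvalues and the choice of threshold. -/

/-- A set of at most `m` indices with the largest values. -/
theorem exists_top_subset {ι : Type*} [DecidableEq ι] (y : ι → ℝ) (U : Finset ι) (m : ℕ) :
    ∃ T ⊆ U, T.card ≤ m ∧ ∀ j ∈ U \ T, T.card = m ∧ ∀ i ∈ T, y j ≤ y i := by
  induction m with
  | zero => exact ⟨∅, by simp, by simp, by simp⟩
  | succ m ih =>
    obtain ⟨T, hTU, hT, htop⟩ := ih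
    rcases (U \ T).eq_empty_or_nonempty with h | h
    · exact ⟨T, hTU, by omega, by simp [h]⟩
    obtain ⟨j, hj, hmax⟩ := Finset.exists_max_image (U \ T) y h
    have hj' := Finset.mem_sdiff.1 hj
    have hcard : (insert j T).card = m + 1 := by
      rw [Finset.card_insert_of_notMem hj'.2, (htop j hj).1]
    refine ⟨insert j T, Finset.insert_subset hj'.1 hTU, hcard.le, fun i hi => ⟨hcard, ?_⟩⟩
    simp only [Finset.mem_sdiff, Finset.mem_insert, not_or] at hi
    have hi' : i ∈ U \ T := Finset.mem_sdiff.2 ⟨hi.1, hi.2.2⟩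
    intro l hl
    rcases Finset.mem_insert.1 hl with rfl | hl
    · exact hmax i hi'
    · exact (htop i hi').2 l hl

/-- A weighted average with weights at most `1 / m` is at most the average over some set of at
most `m` indices. -/
theorem sum_mul_le_of_mem_weightPolytope {p m : ℕ} (hm : 0 < m) {a y : Fin p → ℝ}
    (ha : a ∈ weightPolytope p m) (hy : ∀ j, 0 ≤ y j) :
    ∃ T : Finset (Fin p), T.card ≤ m ∧ ∑ j, a j * y j ≤ 1 / m * ∑ j ∈ T, y j := by
  have hm' : (0 : ℝ) < m := by exact_mod_cast hm
  obtain ⟨T, -, hT, htop⟩ := exists_top_subset y Finset.univ m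
  refine ⟨T, hT, ?_⟩
  have hsplit := Finset.sum_add_sum_compl T fun j => a j * y j
  have hsplit' := Finset.sum_add_sum_compl T a
  rw [← hsplit]
  rcases (Finset.univ \ T).eq_empty_or_nonempty with h | ⟨j₀, hj₀⟩
  · have : Tᶜ = ∅ := by rw [Finset.compl_eq_univ_sdiff, h]
    rw [this, Finset.sum_empty, add_zero, Finset.mul_sum]
    exact Finset.sum_le_sum fun j _ => mul_le_mul_of_nonneg_right (ha.1 j).2 (hy j)
  have hcard := (htop j₀ hj₀).1
  obtain ⟨i₀, hi₀, hmin⟩ := Finset.exists_min_image T y (Finset.card_pos.1 (by omega))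
  -- Mass outside `T` is moved to the smallest value `y i₀` in `T`. The capacity 1/m - a j left on
  -- `T` is enough to hold it, since the total mass is at most one.
  have h1 : ∑ j ∈ Tᶜ, a j * y j ≤ ∑ j ∈ Tᶜ, a j * y i₀ :=
    Finset.sum_le_sum fun j hj => mul_le_mul_of_nonneg_left
      ((htop j (by simpa using hj)).2 i₀ hi₀) (ha.1 j).1
  have h2 : ∑ j ∈ T, (a j * y j + (1 / m - a j) * y i₀) ≤ ∑ j ∈ T, 1 / m * y j := by
    refine Finset.sum_le_sum fun j hj => ?_
    have := mul_le_mul_of_nonneg_left (hmin j hj) (sub_nonneg.2 (ha.1 j).2)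
    linarith
  have h3 : ∑ j ∈ T, (1 / m - a j) * y i₀ = (1 - ∑ j ∈ T, a j) * y i₀ := by
    rw [← Finset.sum_mul, Finset.sum_sub_distrib, Finset.sum_const, hcard, nsmul_eq_mul,
      mul_one_div_cancel hm'.ne']
  rw [Finset.sum_add_distrib, h3] at h2
  rw [← Finset.sum_mul] at h1
  rw [Finset.mul_sum]
  have h4 : (∑ j ∈ Tᶜ, a j) * y i₀ ≤ (1 - ∑ j ∈ T, a j) * y i₀ :=
    mul_le_mul_of_nonneg_right (by linarith [ha.2]) (hy i₀)
  linarith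

theorem l2norm_nonneg {m : ℕ} (v : Fin m → ℝ) : 0 ≤ l2norm v := norm_nonneg _

theorem l2norm_sq {m : ℕ} (v : Fin m → ℝ) : l2norm v ^ 2 = ∑ i, v i ^ 2 := by
  simp [l2norm, EuclideanSpace.norm_sq_eq]

theorem l2norm_eq_zero {m : ℕ} {v : Fin m → ℝ} : l2norm v = 0 ↔ v = 0 := by
  rw [l2norm, norm_eq_zero, WithLp.toLp_eq_zero]

theorem continuous_l2norm {m : ℕ} : Continuous (l2norm : (Fin m → ℝ) → ℝ) := by
  unfold l2norm
  fun_prop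

theorem sum_mul_le_l2norm_mul {m : ℕ} (v w : Fin m → ℝ) : ∑ i, v i * w i ≤ l2norm v * l2norm w := by
  have h := real_inner_le_norm (WithLp.toLp 2 v) (WithLp.toLp 2 w)
  rw [PiLp.inner_apply] at h
  simpa [l2norm, mul_comm] using h

theorem sum_mul_colDot {n p : ℕ} (X : Matrix (Fin n) (Fin p) ℝ) (e : Fin n → ℝ) (u : Fin p → ℝ) :
    ∑ j, u j * colDot X e j = ∑ i, X.mulVec u i * e i := by
  simp only [colDot, Matrix.mulVec, dotProduct, Finset.mul_sum, Finset.sum_mul]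
  rw [Finset.sum_comm]
  exact Finset.sum_congr rfl fun i _ => Finset.sum_congr rfl fun j _ => by ring

theorem CondEigen.l2norm_mulVec_sq_le {n p m : ℕ} (hn : 0 < n) {X : Matrix (Fin n) (Fin p) ℝ}
    {C : ℝ} (h : CondEigen X m C) (hC : 0 ≤ C) {u : Fin p → ℝ}
    (hu : (Finset.univ.filter fun j => u j ≠ 0).card ≤ m) :
    l2norm (X.mulVec u) ^ 2 ≤ n * C * l2norm u ^ 2 := by
  have hn' : (0 : ℝ) < n := by exact_mod_cast hn
  rcases eq_or_ne u 0 with rfl | hu0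
  · simp [l2norm]
  have hpos : 0 < l2norm u := lt_of_le_of_ne (l2norm_nonneg u) fun h => hu0 (l2norm_eq_zero.1 h.symm)
  have h1 : ENNReal.ofReal (l2norm (X.mulVec ((l2norm u)⁻¹ • u)) ^ 2 / n) ≤ ENNReal.ofReal C := by
    refine le_trans ?_ h
    refine le_iSup₂_of_le (f := fun (u : Fin p → ℝ) (_ : l2norm u = 1 ∧
      (Finset.univ.filter fun j => u j ≠ 0).card ≤ m) =>
      ENNReal.ofReal (l2norm (X.mulVec u) ^ 2 / n)) ((l2norm u)⁻¹ • u) ⟨?_, ?_⟩ le_rfl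
    · rw [l2norm_smul, abs_of_pos (inv_pos.2 hpos), inv_mul_cancel₀ hpos.ne']
    · refine le_trans (Finset.card_le_card ?_) hu
      intro j
      simp only [Finset.mem_filter, Finset.mem_univ, true_and, Pi.smul_apply, smul_eq_mul]
      exact right_ne_zero_of_mul
  rw [ENNReal.ofReal_le_ofReal_iff hC, Matrix.mulVec_smul, l2norm_smul,
    abs_of_pos (inv_pos.2 hpos), div_le_iff₀ hn', mul_pow, inv_pow, inv_mul_le_iff₀ (by positivity)]
    at h1
  linarith

/-- A coordinate vector is admissible and gives the value one, because the columns are standardized.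
-/
theorem CondEigen.one_le {n p m : ℕ} (hn : 0 < n) (hp : 0 < p) (hm : 0 < m)
    {X : Matrix (Fin n) (Fin p) ℝ} {C : ℝ} (h : CondEigen X m C) (hX : Standardized X) : 1 ≤ C := by
  have hn' : (0 : ℝ) < n := by exact_mod_cast hn
  have h1 : ENNReal.ofReal (l2norm (X.mulVec (Pi.single ⟨0, hp⟩ 1)) ^ 2 / n) ≤ ENNReal.ofReal C := by
    refine le_trans ?_ h
    refine le_iSup₂_of_le (f := fun (u : Fin p → ℝ) (_ : l2norm u = 1 ∧
      (Finset.univ.filter fun j => u j ≠ 0).card ≤ m) =>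
      ENNReal.ofReal (l2norm (X.mulVec u) ^ 2 / n)) (Pi.single ⟨0, hp⟩ 1) ⟨?_, ?_⟩ le_rfl
    · rw [← sq_eq_sq₀ (l2norm_nonneg _) zero_le_one, l2norm_sq]
      simp [Pi.single_apply]
    · refine le_trans (Finset.card_le_card (t := {⟨0, hp⟩}) ?_) (by rw [Finset.card_singleton]; exact hm)
      intro j
      simp [Pi.single_apply]
  have h2 : X.mulVec (Pi.single ⟨0, hp⟩ 1) = fun i => X i ⟨0, hp⟩ := by
    ext i; simp
  rw [h2, hX, div_self hn'.ne', ENNReal.ofReal_one, ENNReal.one_le_ofReal] at h1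
  exact h1

/-- Weighted averages of correlations under a bound for the upper sparse eigenvalue. -/
theorem CondEigen.sum_mul_abs_colDot_le {n p s m : ℕ} (hn : 0 < n) (hs : 0 < s) (hsm : s ≤ m)
    {X : Matrix (Fin n) (Fin p) ℝ} {C : ℝ} (h : CondEigen X m C) (hC : 0 ≤ C) {a : Fin p → ℝ}
    (ha : a ∈ weightPolytope p s) (g : Fin n → ℝ) :
    ∑ j, a j * |colDot X g j| ≤ √(C / s) * (√(n : ℝ) * l2norm g) := by
  have hs' : (0 : ℝ) < s := by exact_mod_cast hs
  have hn' : (0 : ℝ) < n := by exact_mod_cast hn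
  obtain ⟨T, hT, hle⟩ := sum_mul_le_of_mem_weightPolytope hs ha fun j => abs_nonneg (colDot X g j)
  refine hle.trans ?_
  -- The signs of the correlations on `T`: pairing with them gives the sum of absolute values, and
  -- the vector is sparse with squared norm at most `s`.
  set u : Fin p → ℝ := fun j => if j ∈ T then (if 0 ≤ colDot X g j then 1 else -1) else 0 with hu
  have h1 : ∑ j ∈ T, |colDot X g j| = ∑ j, u j * colDot X g j := by
    rw [← Finset.sum_filter_add_sum_filter_not Finset.univ (· ∈ T)]
    rw [Finset.sum_eq_zero (s := Finset.univ.filter fun j => j ∉ T) (fun j hj => by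
      simp [hu, (Finset.mem_filter.1 hj).2]), add_zero]
    rw [Finset.filter_mem_eq_inter, Finset.univ_inter]
    refine Finset.sum_congr rfl fun j hj => ?_
    simp only [hu, hj, if_true]
    split_ifs with h0
    · rw [abs_of_nonneg h0, one_mul]
    · rw [abs_of_neg (not_le.1 h0)]; ring
  have h2 : l2norm u ^ 2 ≤ s := by
    rw [l2norm_sq]
    have : ∀ j, u j ^ 2 = if j ∈ T then 1 else 0 := by
      intro j
      simp only [hu]
      split_ifs <;> norm_num
    rw [Finset.sum_congr rfl fun j _ => this j, Finset.sum_ite_mem]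
    simpa using hT
  have h3 : (Finset.univ.filter fun j => u j ≠ 0).card ≤ m := by
    refine le_trans (Finset.card_le_card (t := T) ?_) (hT.trans hsm)
    intro j
    simp only [hu, Finset.mem_filter, Finset.mem_univ, true_and]
    intro hj
    by_contra hjT
    exact hj (if_neg hjT)
  have h4 := h.l2norm_mulVec_sq_le hn hC h3
  have h5 : l2norm (X.mulVec u) ≤ s * (√(C / s) * √(n : ℝ)) := by
    refine (pow_le_pow_iff_left₀ (l2norm_nonneg _) (by positivity) two_ne_zero).1 ?_
    rw [mul_pow, mul_pow, Real.sq_sqrt (by positivity), Real.sq_sqrt hn'.le]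
    refine h4.trans ?_
    calc n * C * l2norm u ^ 2 ≤ n * C * s := by gcongr
      _ = s ^ 2 * (C / s * n) := by field_simp
  rw [h1, sum_mul_colDot]
  refine (mul_le_mul_of_nonneg_left ((sum_mul_le_l2norm_mul _ _).trans
    (mul_le_mul_of_nonneg_right h5 (l2norm_nonneg g))) (by positivity)).trans (le_of_eq ?_)
  field_simp

/-- Choice of a threshold balancing the two contributions to the mean of the largest weighted
average. -/
theorem exists_threshold {L q α : ℝ} (hL : 0 < L) (hq : 0 ≤ q) (hα : √2 ≤ α) :
    ∃ τ, 0 ≤ τ ∧ τ + q / (α * L ^ 2) * Real.exp (-(τ * L ^ 2))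
      ≤ 2 * q / (L ^ 4 + 2 * L ^ 2) + 0.65 / α := by
  have h2 : (1.4 : ℝ) ≤ √2 := Real.le_sqrt_of_sq_le (by norm_num)
  have hα0 : 0 < α := by linarith
  set T := 2 * q / (L ^ 4 + 2 * L ^ 2) with hT
  have hT0 : 0 ≤ T := by positivity
  have hq' : q / (α * L ^ 2) = T * (L ^ 2 + 2) / 2 / α := by
    rw [hT]; field_simp
  rw [hq']
  -- For L² ≤ 0.8 the choice τ = 0 works, because (L² + 2)/2 ≤ 1.4 ≤ α. Otherwise take τ = T: then
  -- (L² + 2)/2 ≤ 1.75 L², and z exp(-z) ≤ 1/e gives 1.75 · 0.3679 < 0.65.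
  rcases le_total (L ^ 2) 0.8 with h | h
  · refine ⟨0, le_rfl, ?_⟩
    have h3 : T * (L ^ 2 + 2) / 2 / α ≤ T := by
      rw [div_le_iff₀ hα0]
      nlinarith
    have : 0 ≤ 0.65 / α := by positivity
    simp only [zero_mul, neg_zero, Real.exp_zero, mul_one]
    linarith
  · refine ⟨T, hT0, ?_⟩
    have h3 : T * (L ^ 2 + 2) / 2 * Real.exp (-(T * L ^ 2)) ≤ 0.65 := by
      have h4 : T * L ^ 2 * Real.exp (-(T * L ^ 2)) ≤ Real.exp (-1) := by
        have h5 := Real.add_one_le_exp (T * L ^ 2 - 1)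
        have h6 : Real.exp (T * L ^ 2 - 1) * Real.exp (-(T * L ^ 2)) = Real.exp (-1) := by
          rw [← Real.exp_add]; congr 1; ring
        rw [← h6]
        exact mul_le_mul_of_nonneg_right (by linarith) (Real.exp_pos _).le
      have h7 : Real.exp (-1) ≤ 0.3679 := by
        have := Real.exp_neg_one_lt_d9
        linarith
      have h8 : T * (L ^ 2 + 2) / 2 ≤ 1.75 * (T * L ^ 2) := by nlinarith
      have h9 := mul_le_mul_of_nonneg_right h8 (Real.exp_pos (-(T * L ^ 2))).le
      nlinarith
    have h4 : T * (L ^ 2 + 2) / 2 / α * Real.exp (-(T * L ^ 2))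
        = T * (L ^ 2 + 2) / 2 * Real.exp (-(T * L ^ 2)) / α := by ring
    rw [h4]
    gcongr

/-! ### Transfer from the sphere to the Gaussian linear model. -/

namespace GaussianLinearModel

variable {Ω : Type*} [MeasurableSpace Ω] {μ : Measure Ω} {n p : ℕ}
  {X : Ω → Matrix (Fin n) (Fin p) ℝ} {Y : Ω → Fin n → ℝ} {γ : Ω → Fin p → ℝ} {σ : ℝ}

theorem measurable_noise (h : GaussianLinearModel μ X Y γ σ) :
    Measurable fun ω => Y ω - (X ω).mulVec (γ ω) := by
  refine h.measurable_response.sub (measurable_pi_lambda _ fun i => ?_)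
  simp only [Matrix.mulVec, dotProduct]
  exact Finset.measurable_sum _ fun j _ =>
    (h.measurable_design i j).mul ((measurable_pi_apply j).comp h.measurable_coef)

/-- An event for the design and the noise is unlikely if it is unlikely for each fixed design. -/
theorem measure_le_of_section [IsProbabilityMeasure μ] (h : GaussianLinearModel μ X Y γ σ)
    {S : Set ((Fin n → Fin p → ℝ) × (Fin n → ℝ))} (hS : MeasurableSet S) {η : ℝ≥0∞}
    (hη : ∀ x, (Measure.pi fun _ : Fin n => gaussianReal 0 (σ ^ 2).toNNReal) {e | (x, e) ∈ S} ≤ η) :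
    μ {ω | ((fun i j => X ω i j), Y ω - (X ω).mulVec (γ ω)) ∈ S} ≤ η := by
  have hXm : Measurable fun ω => (fun i j => X ω i j : Fin n → Fin p → ℝ) :=
    measurable_pi_lambda _ fun i => measurable_pi_lambda _ fun j => h.measurable_design i j
  have hm := (indepFun_iff_map_prod_eq_prod_map_map hXm.aemeasurable
    h.measurable_noise.aemeasurable).1 h.noise_indep
  have h1 : μ {ω | ((fun i j => X ω i j), Y ω - (X ω).mulVec (γ ω)) ∈ S}
      = (μ.map fun ω => ((fun i j => X ω i j : Fin n → Fin p → ℝ),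
        Y ω - (X ω).mulVec (γ ω))) S := by
    rw [Measure.map_apply (hXm.prodMk h.measurable_noise) hS]
    rfl
  have : IsProbabilityMeasure (μ.map fun ω => (fun i j => X ω i j : Fin n → Fin p → ℝ)) :=
    Measure.isProbabilityMeasure_map hXm.aemeasurable
  rw [h1, hm, h.noise_law, Measure.prod_apply hS]
  refine (lintegral_mono hη).trans ?_
  rw [lintegral_const, measure_univ, mul_one]

theorem ae_noise_ne_zero (hn : 0 < n) (h : GaussianLinearModel μ X Y γ σ) :
    ∀ᵐ ω ∂μ, Y ω - (X ω).mulVec (γ ω) ≠ 0 := by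
  have h1 : (μ.map fun ω => Y ω - (X ω).mulVec (γ ω)) {0} = 0 := by
    rw [h.noise_law, pi_gaussian_cone_eq h.sigma_pos (measurableSet_singleton 0)
      (fun r e hr => by simp [hr.ne'])]
    have := ae_ne_zero_stdGaussian hn
    rw [ae_iff] at this
    simpa using this
  rw [Measure.map_apply h.measurable_noise (measurableSet_singleton 0)] at h1
  rw [ae_iff]
  simp only [ne_eq, not_not]
  exact h1

end GaussianLinearModel

theorem sqrt_mul_negQuantile {m : ℝ} (hm : 0 < m) (t : ℝ) :
    √m * negQuantile m t = stdNormalQuantile (1 - t) := by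
  rw [negQuantile, mul_div_cancel₀ _ (Real.sqrt_pos.2 hm).ne']

theorem negQuantile_one (t : ℝ) : negQuantile 1 t = stdNormalQuantile (1 - t) := by
  simp [negQuantile]

theorem continuous_colDot {n p : ℕ} (j : Fin p) :
    Continuous fun z : (Fin n → Fin p → ℝ) × (Fin n → ℝ) => colDot (Matrix.of z.1) z.2 j := by
  simp only [colDot, Matrix.of_apply]
  fun_prop

theorem isClosed_standardized (n p : ℕ) :
    IsClosed {x : Fin n → Fin p → ℝ | Standardized (Matrix.of x)} := by
  simp only [Standardized, l2norm_sq, Matrix.of_apply, Set.ofPred_forall]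
  exact isClosed_iInter fun j => isClosed_eq (by fun_prop) continuous_const

/-- Lets the Lipschitz bound, proved for weights up to 1/s₂, serve for the smaller weights up to
1/(α s₂). -/
theorem weightPolytope_anti (p : ℕ) {m m' : ℝ} (hm : 0 < m) (h : m ≤ m') :
    weightPolytope p m' ⊆ weightPolytope p m := fun _ ha =>
  ⟨fun j => ⟨(ha.1 j).1, (ha.1 j).2.trans (one_div_le_one_div_of_le hm h)⟩, ha.2⟩

namespace GaussianLinearModel

variable {Ω : Type*} [MeasurableSpace Ω] {μ : Measure Ω} [IsProbabilityMeasure μ] {n p : ℕ}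
  {X : Ω → Matrix (Fin n) (Fin p) ℝ} {Y : Ω → Fin n → ℝ} {γ : Ω → Fin p → ℝ} {σ : ℝ}

/-- The noise has uniformly small correlations with the design. -/
theorem measure_max_colDot_le (h : GaussianLinearModel μ X Y γ σ) (hn : 2 ≤ n) {t : ℝ}
    (ht : 0 < t) (ht' : t < 1 / 2) :
    μ {ω | Standardized (X ω) ∧ ∃ j, negQuantile (n - 3 / 2) t
      * (√(n : ℝ) * l2norm (Y ω - (X ω).mulVec (γ ω)))
        < |colDot (X ω) (Y ω - (X ω).mulVec (γ ω)) j|} ≤ ENNReal.ofReal (2 * p * t) := by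
  have hn' : (2 : ℝ) ≤ n := by exact_mod_cast hn
  have hν : (0 : ℝ) < n - 3 / 2 := by linarith
  have hr : 0 ≤ negQuantile (n - 3 / 2) t :=
    div_nonneg (stdNormalQuantile_pos ht ht').le (Real.sqrt_nonneg _)
  set r := negQuantile (n - 3 / 2) t with hrdef
  set S : Set ((Fin n → Fin p → ℝ) × (Fin n → ℝ)) := {z | Standardized (Matrix.of z.1)} ∩
    ⋃ j, {z | r * (√(n : ℝ) * l2norm z.2) < |colDot (Matrix.of z.1) z.2 j|} with hS
  have hlt : ∀ j, IsOpen {z : (Fin n → Fin p → ℝ) × (Fin n → ℝ) |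
      r * (√(n : ℝ) * l2norm z.2) < |colDot (Matrix.of z.1) z.2 j|} := fun j =>
    isOpen_lt (continuous_const.mul (continuous_const.mul (continuous_l2norm.comp continuous_snd)))
      (continuous_colDot j).abs
  have hSm : MeasurableSet S :=
    ((isClosed_standardized n p).preimage continuous_fst).measurableSet.inter
      (isOpen_iUnion hlt).measurableSet
  refine le_trans (measure_mono ?_) (h.measure_le_of_section hSm fun x => ?_)
  · rintro ω ⟨h1, j, hj⟩
    exact ⟨h1, Set.mem_iUnion.2 ⟨j, hj⟩⟩
  by_cases hx : Standardized (Matrix.of x)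
  · have h1 : {e | (x, e) ∈ S} = ⋃ j, {e | r * (√(n : ℝ) * l2norm e) < |colDot (Matrix.of x) e j|} := by
      ext e
      simp [hS, hx]
    have hm : MeasurableSet (⋃ j, {e | r * (√(n : ℝ) * l2norm e) < |colDot (Matrix.of x) e j|}) :=
      (isOpen_iUnion fun j => (hlt j).preimage (Continuous.prodMk_right x)).measurableSet
    rw [h1, pi_gaussian_cone_eq h.sigma_pos hm]
    · have h2 := stdGaussian_max_colDot_tail hn hx hr
      rw [hrdef, sqrt_mul_negQuantile hν, normTail_stdNormalQuantile ht (by linarith)] at h2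
      refine le_trans (measure_mono ?_) h2
      intro x hx
      simpa using hx
    · intro c e hc
      simp only [Set.mem_iUnion, Set.mem_ofPred_eq, l2norm_smul, colDot_smul, abs_mul, abs_of_pos hc]
      refine exists_congr fun j => ?_
      rw [show r * (√(n : ℝ) * (c * l2norm e)) = c * (r * (√(n : ℝ) * l2norm e)) by ring]
      exact mul_lt_mul_iff_right₀ hc
  · have h1 : {e | (x, e) ∈ S} = ∅ := by
      ext e
      simp [hS, hx]
    rw [h1, measure_empty]
    exact zero_le

/-- The noise has small weighted averages of correlations with the design. -/
theorem measure_average_colDot_le (h : GaussianLinearModel μ X Y γ σ) (hn : 2 ≤ n) {m m' : ℝ}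
    (hm : 0 < m) (hmm : m ≤ m') {l : ℝ} (hl : 0 < l) {L τ y r : ℝ} (hL : 0 < L) (hτ : 0 ≤ τ)
    (hy : 0 ≤ y)
    (hr : (1 + τ) * L + p / m' * (2 * normTail L * Real.exp (-(τ * L ^ 2)) / L) + l * y
      ≤ √((n : ℝ) - 3 / 2) * r) :
    μ {ω | Standardized (X ω) ∧ (∀ a ∈ weightPolytope p m, ∀ g, ∑ j, a j * |colDot (X ω) g j|
        ≤ l * (√(n : ℝ) * l2norm g)) ∧
      ∃ a ∈ weightPolytope p m', r * (√(n : ℝ) * l2norm (Y ω - (X ω).mulVec (γ ω)))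
        < ∑ j, a j * |colDot (X ω) (Y ω - (X ω).mulVec (γ ω)) j|}
      ≤ ENNReal.ofReal (Real.exp (-y ^ 2 / 2)) := by
  have hn0 : 0 < n := by omega
  have hn' : 0 < √(n : ℝ) := Real.sqrt_pos.2 (by exact_mod_cast hn0)
  set V : Set (Fin n → Fin p → ℝ) := {x | ∀ a ∈ weightPolytope p m, ∀ g,
    ∑ j, a j * |colDot (Matrix.of x) g j| ≤ l * (√(n : ℝ) * l2norm g)} with hV
  have hVc : IsClosed V := by
    simp only [hV, Set.ofPred_forall]
    refine isClosed_iInter fun a => isClosed_iInter fun _ => isClosed_iInter fun g => ?_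
    refine isClosed_le (continuous_finsetSum _ fun j _ => continuous_const.mul ?_) continuous_const
    exact ((continuous_colDot j).comp (Continuous.prodMk_left g)).abs
  set S : Set ((Fin n → Fin p → ℝ) × (Fin n → ℝ)) :=
    ({z | Standardized (Matrix.of z.1)} ∩ {z | z.1 ∈ V}) ∩ ⋃ a ∈ weightPolytope p m',
      {z | r * (√(n : ℝ) * l2norm z.2) < ∑ j, a j * |colDot (Matrix.of z.1) z.2 j|} with hS
  have hlt : ∀ a : Fin p → ℝ, IsOpen {z : (Fin n → Fin p → ℝ) × (Fin n → ℝ) |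
      r * (√(n : ℝ) * l2norm z.2) < ∑ j, a j * |colDot (Matrix.of z.1) z.2 j|} := fun a =>
    isOpen_lt (continuous_const.mul (continuous_const.mul (continuous_l2norm.comp continuous_snd)))
      (continuous_finsetSum _ fun j _ => continuous_const.mul (continuous_colDot j).abs)
  have hSm : MeasurableSet S :=
    (((isClosed_standardized n p).preimage continuous_fst).measurableSet.inter
      (hVc.preimage continuous_fst).measurableSet).inter
      (isOpen_biUnion fun a _ => hlt a).measurableSet
  refine le_trans (measure_mono ?_) (h.measure_le_of_section hSm fun x => ?_)
  · rintro ω ⟨h1, h2, a, ha, h3⟩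
    exact ⟨⟨h1, h2⟩, Set.mem_biUnion ha h3⟩
  by_cases hx : Standardized (Matrix.of x) ∧ x ∈ V
  · have h1 : {e | (x, e) ∈ S} = ⋃ a ∈ weightPolytope p m',
        {e | r * (√(n : ℝ) * l2norm e) < ∑ j, a j * |colDot (Matrix.of x) e j|} := by
      ext e
      simp [hS, hx.1, hx.2]
    have hSx : MeasurableSet (⋃ a ∈ weightPolytope p m',
        {e | r * (√(n : ℝ) * l2norm e) < ∑ j, a j * |colDot (Matrix.of x) e j|}) :=
      (isOpen_biUnion fun a _ => (hlt a).preimage (Continuous.prodMk_right x)).measurableSet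
    have hsum : ∀ (a : Fin p → ℝ) (z : EuclideanSpace ℝ (Fin n)),
        ∑ j, a j * |colDot (Matrix.of x) z.ofLp j|
          = √(n : ℝ) * ∑ j, a j * |inner ℝ (unitCol (Matrix.of x) j) z| := by
      intro a z
      rw [Finset.mul_sum]
      refine Finset.sum_congr rfl fun j _ => ?_
      rw [colDot_eq_inner hn0, abs_mul, abs_of_pos hn']
      ring
    rw [h1, pi_gaussian_cone_eq h.sigma_pos hSx]
    · refine le_trans (measure_mono ?_) (stdGaussian_averageGauge_tail
        (v := unitCol (Matrix.of x)) hn (norm_unitCol hn0 hx.1) (hm.trans_le hmm) hl ?_ hL hτ hy hr)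
      · intro z hz
        simp only [Set.mem_iUnion, Set.mem_ofPred_eq, hsum] at hz
        obtain ⟨a, ha, hz⟩ := hz
        refine ⟨a, ha, ?_⟩
        have : √(n : ℝ) * (r * ‖z‖)
            < √(n : ℝ) * ∑ j, a j * |inner ℝ (unitCol (Matrix.of x) j) z| :=
          lt_of_eq_of_lt (by simp only [l2norm]; ring) hz
        exact lt_of_mul_lt_mul_left this hn'.le
      · intro a ha z
        have := hx.2 a (weightPolytope_anti p hm hmm ha) z.ofLp
        rw [hsum] at this
        have : √(n : ℝ) * ∑ j, a j * |inner ℝ (unitCol (Matrix.of x) j) z|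
            ≤ √(n : ℝ) * (l * ‖z‖) := this.trans_eq (by simp only [l2norm]; ring)
        exact le_of_mul_le_mul_left this hn'
    · intro c e hc
      simp only [Set.mem_iUnion, Set.mem_ofPred_eq, l2norm_smul, colDot_smul, abs_mul, abs_of_pos hc]
      refine exists_congr fun a => exists_congr fun _ => ?_
      rw [show r * (√(n : ℝ) * (c * l2norm e)) = c * (r * (√(n : ℝ) * l2norm e)) by ring,
        show ∑ j, a j * (c * |colDot (Matrix.of x) e j|)
          = c * ∑ j, a j * |colDot (Matrix.of x) e j| by
            rw [Finset.mul_sum]; exact Finset.sum_congr rfl fun j _ => by ring]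
      exact mul_lt_mul_iff_right₀ hc
  · have h1 : {e | (x, e) ∈ S} = ∅ := by
      ext e
      simp only [hS, Set.mem_ofPred_eq, Set.mem_inter_iff, Set.mem_empty_iff_false, iff_false]
      exact fun hz => hx hz.1
    rw [h1, measure_empty]
    exact zero_le

/-- Under a bound for the upper sparse eigenvalue, the largest weighted averages of the
correlations exceed the penalty threshold by a controlled factor only. -/
theorem measure_average_colDot_le_of_condEigen (h : GaussianLinearModel μ X Y γ σ) (hn : 2 ≤ n)
    {k e₁ C₃ ε₁ α : ℝ} {s₂ s₃ : ℕ} (hk : 1 ≤ k) (hkp : k < p / 2) (he : 0 < e₁) (he' : e₁ < 1)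
    (hC : 1 ≤ C₃) (hα : √2 ≤ α) (hs : 1 ≤ s₂) (hs₃ : s₂ ≤ s₃)
    (hε : epsOneBound n p k e₁ C₃ s₂ ≤ ε₁) :
    μ {ω | Standardized (X ω) ∧ CondEigen (X ω) s₃ C₃ ∧
      ∃ a ∈ weightPolytope p (α * s₂), negQuantile (n - 3 / 2) (k / p) * (1 + ε₁ + 0.65 / α)
        * (√(n : ℝ) * l2norm (Y ω - (X ω).mulVec (γ ω)))
          < ∑ j, a j * |colDot (X ω) (Y ω - (X ω).mulVec (γ ω)) j|} ≤ ENNReal.ofReal e₁ := by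
  have hn' : (2 : ℝ) ≤ n := by exact_mod_cast hn
  have hν : (0 : ℝ) < n - 3 / 2 := by linarith
  have hp2 : (2 : ℝ) < p := by linarith
  have hp3 : (3 : ℝ) ≤ p := by
    have : 2 < p := by exact_mod_cast hp2
    exact_mod_cast this
  have hp0 : (0 : ℝ) < p := by linarith
  have hs' : (1 : ℝ) ≤ s₂ := by exact_mod_cast hs
  have hs0 : (0 : ℝ) < s₂ := by linarith
  have h2 : (1 : ℝ) ≤ √2 := Real.one_le_sqrt.2 (by norm_num)
  have hα1 : 1 ≤ α := h2.trans hα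
  have hα0 : 0 < α := by linarith
  have hkp0 : 0 < k / p := by positivity
  have hkp' : k / p < 1 / 2 := by rw [div_lt_iff₀ hp0]; linarith
  have hep0 : 0 < e₁ / p := by positivity
  have hep' : e₁ / p < 1 / 2 := by rw [div_lt_iff₀ hp0]; linarith
  have hL := stdNormalQuantile_pos hkp0 hkp'
  have hLs := stdNormalQuantile_pos hep0 hep'
  have hnt := normTail_stdNormalQuantile hkp0 (by linarith)
  have hnts := normTail_stdNormalQuantile hep0 (by linarith)
  simp only [epsOneBound, negQuantile_one] at hε
  have hq := sqrt_mul_negQuantile hν (k / p)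
  set L := stdNormalQuantile (1 - k / p)
  set M := stdNormalQuantile (1 - e₁ / p)
  set l := √(C₃ / s₂) with hl
  have hl0 : 0 < l := Real.sqrt_pos.2 (by positivity)
  set E := Real.exp (1 / (4 * (n : ℝ) - 6) ^ 2)
  have hE : 1 ≤ E := Real.one_le_exp (by positivity)
  obtain ⟨τ, hτ, hτ'⟩ := exists_threshold (q := 2 * k / s₂) hL (by positivity) hα
  set c := 1 / √(2 * Real.pi) with hc
  have hc0 : 0 < c := by positivity
  -- The deviation parameter is M + 1/√(2π). As the normal tail at `L` is k/p, the mean divided by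
  -- `L` is the expression balanced by `exists_threshold` with q = 2k/s₂; its first term and the
  -- Lipschitz term add up to at most ε₁, leaving 0.65/α.
  have hmain : (1 + τ) * L + p / (α * s₂) * (2 * normTail L * Real.exp (-(τ * L ^ 2)) / L)
      + l * (M + c)
      ≤ √((n : ℝ) - 3 / 2) * (negQuantile (n - 3 / 2) (k / p) * (1 + ε₁ + 0.65 / α)) := by
    rw [← mul_assoc, hq, hnt]
    have h3 : 2 * (2 * k / s₂) / (L ^ 4 + 2 * L ^ 2) ≤ E * (4 * k / s₂) / (L ^ 4 + 2 * L ^ 2) := by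
      have : 0 ≤ 4 * k / s₂ := by positivity
      refine div_le_div_of_nonneg_right ?_ (by positivity)
      have : 2 * (2 * k / s₂) = 4 * k / s₂ := by ring
      rw [this]
      nlinarith
    have h4 : (M / L + c / L) * l ≤ (M / L + E / √(2 * Real.pi) / L) * l := by
      refine mul_le_mul_of_nonneg_right ?_ hl0.le
      rw [hc]
      gcongr
    have h5 : p / (α * s₂) * (2 * (k / p) * Real.exp (-(τ * L ^ 2)) / L)
        = L * (2 * k / s₂ / (α * L ^ 2) * Real.exp (-(τ * L ^ 2))) := by
      field_simp
    have h6 : l * (M + c) = L * ((M / L + c / L) * l) := by field_simp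
    rw [h5, h6]
    have h7 : (1 + τ) + 2 * k / s₂ / (α * L ^ 2) * Real.exp (-(τ * L ^ 2)) + (M / L + c / L) * l
        ≤ 1 + ε₁ + 0.65 / α := by linarith
    have := mul_le_mul_of_nonneg_left h7 hL.le
    linarith
  refine le_trans (measure_mono ?_) ((h.measure_average_colDot_le hn hs0
    (le_mul_of_one_le_left hs0.le hα1) hl0 hL hτ (by positivity) hmain).trans
    (ENNReal.ofReal_le_ofReal ?_))
  · rintro ω ⟨h1, h2, h3⟩
    exact ⟨h1, fun a ha g => h2.sum_mul_abs_colDot_le (by omega) hs hs₃ (by linarith) ha g, h3⟩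
  · refine (exp_neg_sq_le_three_normTail hLs.le).trans ?_
    -- The bound is 3 e₁/p, and p ≥ 3 because 1 ≤ k < p/2.
    rw [hnts, ← mul_div_assoc, div_le_iff₀ hp0]
    nlinarith

end GaussianLinearModel

/-! ### Deterministic inequalities for the square-root lasso criterion. -/

section norms

variable {n p : ℕ}

theorem l1norm_nonneg (u : Fin p → ℝ) : 0 ≤ l1norm u := Finset.sum_nonneg fun _ _ => abs_nonneg _

theorem l1normOn_nonneg (J : Finset (Fin p)) (u : Fin p → ℝ) : 0 ≤ l1normOn J u :=
  Finset.sum_nonneg fun _ _ => abs_nonneg _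

theorem l1normOn_add_compl (J : Finset (Fin p)) (u : Fin p → ℝ) :
    l1normOn J u + l1normOn Jᶜ u = l1norm u := Finset.sum_add_sum_compl J _

theorem l1norm_smul (r : ℝ) (u : Fin p → ℝ) : l1norm (r • u) = |r| * l1norm u := by
  simp [l1norm, abs_mul, Finset.mul_sum]

theorem l1norm_add_le (u v : Fin p → ℝ) : l1norm (u + v) ≤ l1norm u + l1norm v := by
  rw [l1norm, l1norm, l1norm, ← Finset.sum_add_distrib]
  exact Finset.sum_le_sum fun j _ => abs_add_le _ _

theorem l2norm_add_le (u v : Fin n → ℝ) : l2norm (u + v) ≤ l2norm u + l2norm v := by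
  simpa [l2norm] using norm_add_le (WithLp.toLp 2 u) (WithLp.toLp 2 v)

theorem l2norm_neg (u : Fin n → ℝ) : l2norm (-u) = l2norm u := by
  simp [l2norm]

/-- Cauchy–Schwarz in the form used for columns. -/
theorem abs_colDot_le (X : Matrix (Fin n) (Fin p) ℝ) (e : Fin n → ℝ) (j : Fin p) :
    |colDot X e j| ≤ l2norm (fun i => X i j) * l2norm e := by
  refine abs_le.2 ⟨?_, sum_mul_le_l2norm_mul _ _⟩
  have h := sum_mul_le_l2norm_mul (fun i => X i j) (-e)
  rw [l2norm_neg] at h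
  have h2 : ∑ i, X i j * (-e) i = -colDot X e j := by simp [colDot]
  linarith

theorem l2norm_sub_sq (u v : Fin n → ℝ) :
    l2norm (u - v) ^ 2 = l2norm u ^ 2 - 2 * ∑ i, v i * u i + l2norm v ^ 2 := by
  simp only [l2norm_sq, Finset.mul_sum, ← Finset.sum_sub_distrib, ← Finset.sum_add_distrib,
    Pi.sub_apply]
  exact Finset.sum_congr rfl fun i _ => by ring

theorem l1norm_sub_l1norm_add_le (J : Finset (Fin p)) (g w : Fin p → ℝ) :
    l1norm g - l1norm (g + w) ≤ l1normOn J w - l1normOn Jᶜ w + 2 * l1normOn Jᶜ g := by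
  rw [← l1normOn_add_compl J g, ← l1normOn_add_compl J (g + w)]
  have h1 : l1normOn J g ≤ l1normOn J (g + w) + l1normOn J w := by
    simp only [l1normOn, ← Finset.sum_add_distrib]
    refine Finset.sum_le_sum fun j _ => ?_
    have := abs_sub (g j + w j) (w j)
    simpa using this
  have h2 : l1normOn Jᶜ w ≤ l1normOn Jᶜ (g + w) + l1normOn Jᶜ g := by
    simp only [l1normOn, ← Finset.sum_add_distrib]
    refine Finset.sum_le_sum fun j _ => ?_
    have := abs_sub (g j + w j) (g j)
    simpa using this
  linarith

end norms

section scaledLasso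

variable {n p : ℕ} {X : Matrix (Fin n) (Fin p) ℝ} {Y : Fin n → ℝ} {lam : ℝ}

theorem sigmaOra_nonneg (g : Fin p → ℝ) : 0 ≤ sigmaOra X Y g :=
  div_nonneg (l2norm_nonneg _) (Real.sqrt_nonneg _)

theorem l2norm_residual (hn : 0 < n) (g : Fin p → ℝ) :
    l2norm (Y - X.mulVec g) = √(n : ℝ) * sigmaOra X Y g := by
  have : 0 < √(n : ℝ) := Real.sqrt_pos.2 (by exact_mod_cast hn)
  rw [sigmaOra, mul_div_cancel₀ _ this.ne']

theorem scaledLassoObjective_of_pos (hn : 0 < n) (hlam : 0 ≤ lam) (g : Fin p → ℝ) {t : ℝ}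
    (ht : 0 < t) : scaledLassoObjective X Y lam g t
      = ENNReal.ofReal (sigmaOra X Y g ^ 2 / (2 * t) + t / 2 + lam * l1norm g) := by
  have hn' : (0 : ℝ) < n := by exact_mod_cast hn
  have h1 : 0 ≤ lam * l1norm g := mul_nonneg hlam (l1norm_nonneg g)
  rw [scaledLassoObjective, l2norm_residual hn, mul_pow, Real.sq_sqrt hn'.le,
    ← ENNReal.ofReal_div_of_pos (by positivity), ← ENNReal.ofReal_add (by positivity) (by positivity),
    ← ENNReal.ofReal_add (by positivity) h1]
  congr 3
  field_simp

theorem scaledLassoObjective_sigmaOra (hn : 0 < n) (hlam : 0 ≤ lam) (g : Fin p → ℝ) :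
    scaledLassoObjective X Y lam g (sigmaOra X Y g)
      = ENNReal.ofReal (sigmaOra X Y g + lam * l1norm g) := by
  rcases (sigmaOra_nonneg (X := X) (Y := Y) g).eq_or_lt with h | h
  · rw [scaledLassoObjective, l2norm_residual hn, ← h]
    simp
  · rw [scaledLassoObjective_of_pos hn hlam g h]
    congr 2
    field_simp
    ring

/-- The scaled lasso estimates the noise level by the root mean square of the residuals. -/
theorem IsScaledLasso.eq_sigmaOra (hn : 0 < n) (hlam : 0 ≤ lam) {ghat : Fin p → ℝ} {that : ℝ}
    (h : IsScaledLasso X Y lam ghat that) : that = sigmaOra X Y ghat := by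
  have hr := sigmaOra_nonneg (X := X) (Y := Y) ghat
  have h1 := h.2 ghat _ hr
  have h0 : 0 ≤ lam * l1norm ghat := mul_nonneg hlam (l1norm_nonneg ghat)
  rw [scaledLassoObjective_sigmaOra hn hlam] at h1
  -- At scale zero a nonzero residual makes the criterion infinite. At a positive scale the excess
  -- over the optimum is (t - S)²/(2t).
  rcases h.1.eq_or_lt with ht | ht
  · by_contra hne
    have hr' : 0 < sigmaOra X Y ghat := lt_of_le_of_ne hr (by rwa [ht])
    have hpos : 0 < l2norm (Y - X.mulVec ghat) ^ 2 := by
      have : 0 < √(n : ℝ) := Real.sqrt_pos.2 (by exact_mod_cast hn)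
      rw [l2norm_residual hn]
      positivity
    rw [scaledLassoObjective, ← ht, mul_zero, ENNReal.ofReal_zero,
      ENNReal.div_zero (ENNReal.ofReal_pos.2 hpos).ne', top_add, top_add, top_le_iff] at h1
    exact ENNReal.ofReal_ne_top h1
  · rw [scaledLassoObjective_of_pos hn hlam ghat ht, ENNReal.ofReal_le_ofReal_iff (by positivity),
      add_le_add_iff_right] at h1
    have h2 : sigmaOra X Y ghat ^ 2 / (2 * that) + that / 2 - sigmaOra X Y ghat
        = (that - sigmaOra X Y ghat) ^ 2 / (2 * that) := by
      field_simp
      ring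
    have h3 : (that - sigmaOra X Y ghat) ^ 2 / (2 * that) ≤ 0 := by linarith
    rw [div_le_iff₀ (by positivity), zero_mul] at h3
    have := pow_eq_zero_iff (two_ne_zero) |>.1 (le_antisymm h3 (sq_nonneg _))
    linarith

/-- The coefficient part of the scaled lasso minimizes the square-root lasso criterion. -/
theorem IsScaledLasso.sigmaOra_add_le (hn : 0 < n) (hlam : 0 ≤ lam) {ghat : Fin p → ℝ} {that : ℝ}
    (h : IsScaledLasso X Y lam ghat that) (g : Fin p → ℝ) :
    sigmaOra X Y ghat + lam * l1norm ghat ≤ sigmaOra X Y g + lam * l1norm g := by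
  have h1 := h.2 g _ (sigmaOra_nonneg (X := X) (Y := Y) g)
  have h0 : 0 ≤ lam * l1norm g := mul_nonneg hlam (l1norm_nonneg g)
  have hr := sigmaOra_nonneg (X := X) (Y := Y) g
  rwa [h.eq_sigmaOra hn hlam, scaledLassoObjective_sigmaOra hn hlam,
    scaledLassoObjective_sigmaOra hn hlam, ENNReal.ofReal_le_ofReal_iff (by positivity)] at h1

theorem residual_add (g w : Fin p → ℝ) :
    Y - X.mulVec (g + w) = (Y - X.mulVec g) - X.mulVec w := by
  rw [Matrix.mulVec_add]; abel

theorem sigmaOra_convex {θ : ℝ} (h0 : 0 ≤ θ) (h1 : θ ≤ 1) (g w : Fin p → ℝ) :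
    sigmaOra X Y (g + θ • w) ≤ (1 - θ) * sigmaOra X Y g + θ * sigmaOra X Y (g + w) := by
  have h : Y - X.mulVec (g + θ • w)
      = (1 - θ) • (Y - X.mulVec g) + θ • (Y - X.mulVec (g + w)) := by
    simp only [Matrix.mulVec_add, Matrix.mulVec_smul]
    module
  simp only [sigmaOra]
  rw [← mul_div_assoc, ← mul_div_assoc, ← add_div, h]
  refine div_le_div_of_nonneg_right ((l2norm_add_le _ _).trans (le_of_eq ?_)) (Real.sqrt_nonneg _)
  rw [l2norm_smul, l2norm_smul, abs_of_nonneg h0, abs_of_nonneg (sub_nonneg.2 h1)]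

/-- Perturbations that do not increase the square-root lasso criterion are star-shaped. -/
theorem sigmaOra_add_smul_le (hlam : 0 ≤ lam) {θ : ℝ} (h0 : 0 ≤ θ) (h1 : θ ≤ 1) {g w : Fin p → ℝ}
    (hw : sigmaOra X Y (g + w) + lam * l1norm (g + w) ≤ sigmaOra X Y g + lam * l1norm g) :
    sigmaOra X Y (g + θ • w) + lam * l1norm (g + θ • w) ≤ sigmaOra X Y g + lam * l1norm g := by
  have h2 := sigmaOra_convex (X := X) (Y := Y) h0 h1 g w
  have h3 : l1norm (g + θ • w) ≤ (1 - θ) * l1norm g + θ * l1norm (g + w) := by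
    have h : g + θ • w = (1 - θ) • g + θ • (g + w) := by module
    rw [h]
    refine (l1norm_add_le _ _).trans (le_of_eq ?_)
    rw [l1norm_smul, l1norm_smul, abs_of_nonneg h0, abs_of_nonneg (sub_nonneg.2 h1)]
  have h4 := mul_le_mul_of_nonneg_left h3 hlam
  have h5 := mul_le_mul_of_nonneg_left hw h0
  linarith

theorem sum_mul_colDot_le {e : Fin n → ℝ} {B : ℝ} (hB : ∀ j, |colDot X e j| ≤ B)
    (J : Finset (Fin p)) (w : Fin p → ℝ) : ∑ j ∈ J, w j * colDot X e j ≤ B * l1normOn J w := by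
  rw [l1normOn, Finset.mul_sum]
  refine Finset.sum_le_sum fun j _ => ?_
  calc w j * colDot X e j ≤ |w j * colDot X e j| := le_abs_self _
    _ = |colDot X e j| * |w j| := by rw [abs_mul, mul_comm]
    _ ≤ _ := mul_le_mul_of_nonneg_right (hB j) (abs_nonneg _)

/-- The root mean square of the residuals lies above its tangent. -/
theorem sigmaOra_sub_le (hn : 0 < n) (g w : Fin p → ℝ) :
    n * sigmaOra X Y g * (sigmaOra X Y g - sigmaOra X Y (g + w))
      ≤ ∑ j, w j * colDot X (Y - X.mulVec g) j := by
  have hn' : (0 : ℝ) < n := by exact_mod_cast hn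
  have h1 := sum_mul_le_l2norm_mul (Y - X.mulVec g) (Y - X.mulVec (g + w))
  rw [l2norm_residual hn, l2norm_residual hn] at h1
  have h2 : ∑ i, (Y - X.mulVec g) i * (Y - X.mulVec (g + w)) i
      = l2norm (Y - X.mulVec g) ^ 2 - ∑ i, X.mulVec w i * (Y - X.mulVec g) i := by
    rw [residual_add, l2norm_sq, ← Finset.sum_sub_distrib]
    refine Finset.sum_congr rfl fun i _ => ?_
    simp only [Pi.sub_apply]
    ring
  rw [h2, l2norm_residual hn, mul_pow, Real.sq_sqrt hn'.le] at h1
  rw [sum_mul_colDot]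
  have h3 : √(n : ℝ) * √(n : ℝ) = n := Real.mul_self_sqrt hn'.le
  have h4 : √(n : ℝ) * sigmaOra X Y g * (√(n : ℝ) * sigmaOra X Y (g + w))
      = n * sigmaOra X Y g * sigmaOra X Y (g + w) := by
    linear_combination (sigmaOra X Y g * sigmaOra X Y (g + w)) * h3
  nlinarith

/-- The basic inequality for perturbations that do not increase the criterion. -/
theorem lam_mul_l1normOn_compl_le (hn : 0 < n) (hlam : 0 ≤ lam) {g w : Fin p → ℝ}
    (hS : 0 < sigmaOra X Y g)
    (hw : sigmaOra X Y (g + w) + lam * l1norm (g + w) ≤ sigmaOra X Y g + lam * l1norm g)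
    (J : Finset (Fin p)) :
    n * sigmaOra X Y g * (lam * l1normOn Jᶜ w) ≤ n * sigmaOra X Y g * (lam * l1normOn J w)
      + n * sigmaOra X Y g * (2 * lam * l1normOn Jᶜ g)
      + ∑ j, w j * colDot X (Y - X.mulVec g) j := by
  have hn' : (0 : ℝ) < n := by exact_mod_cast hn
  have h1 := sigmaOra_sub_le (X := X) (Y := Y) hn g w
  have h2 := mul_le_mul_of_nonneg_left (l1norm_sub_l1norm_add_le J g w) hlam
  have h3 : sigmaOra X Y (g + w) - sigmaOra X Y g
      ≤ lam * (l1normOn J w - l1normOn Jᶜ w + 2 * l1normOn Jᶜ g) := by linarith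
  have h4 := mul_le_mul_of_nonneg_left h3 (show 0 ≤ n * sigmaOra X Y g by positivity)
  nlinarith

theorem sigmaOra_add_le_of_criterion (hlam : 0 ≤ lam) {g w : Fin p → ℝ}
    (hw : sigmaOra X Y (g + w) + lam * l1norm (g + w) ≤ sigmaOra X Y g + lam * l1norm g) :
    sigmaOra X Y (g + w) ≤ sigmaOra X Y g + lam * l1norm w := by
  have h := l1norm_add_le (g + w) (-w)
  rw [add_neg_cancel_right, show l1norm (-w) = l1norm w by simp [l1norm]] at h
  have := mul_le_mul_of_nonneg_left h hlam
  linarith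

/-- Prediction error of perturbations that do not increase the criterion. -/
theorem l2norm_mulVec_sq_le (hn : 0 < n) (hlam : 0 ≤ lam) {g w : Fin p → ℝ}
    {lbar : ℝ}
    (hz : ∀ j, |colDot X (Y - X.mulVec g) j| ≤ n * sigmaOra X Y g * lbar)
    (hw : sigmaOra X Y (g + w) + lam * l1norm (g + w) ≤ sigmaOra X Y g + lam * l1norm g)
    (hwS : lam * l1norm w ≤ sigmaOra X Y g) :
    l2norm (X.mulVec w) ^ 2 ≤ n * ((3 * lam + 2 * lbar) * sigmaOra X Y g * l1norm w) := by
  have hn' : (0 : ℝ) < n := by exact_mod_cast hn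
  have h1 := l2norm_sub_sq (Y - X.mulVec g) (X.mulVec w)
  rw [← residual_add, l2norm_residual hn, l2norm_residual hn, mul_pow, mul_pow,
    Real.sq_sqrt hn'.le, ← sum_mul_colDot] at h1
  have h2 := sum_mul_colDot_le hz Finset.univ w
  have h3 := sigmaOra_add_le_of_criterion hlam hw
  have hw0 := mul_nonneg hlam (l1norm_nonneg w)
  -- With x = λ‖w‖₁ ≤ S the increase is at most 2Sx + x² ≤ 3Sx. This is where localization makes the
  -- prediction error linear in ‖w‖₁.
  have h4 : sigmaOra X Y (g + w) ^ 2 - sigmaOra X Y g ^ 2 ≤ 3 * (sigmaOra X Y g * (lam * l1norm w)) := by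
    have h5 := pow_le_pow_left₀ (sigmaOra_nonneg _) h3 2
    have h6 := mul_le_mul_of_nonneg_right hwS hw0
    nlinarith
  have h5 := mul_le_mul_of_nonneg_left h4 hn'.le
  change _ ≤ _ * l1norm w at h2
  nlinarith

/-- Global error bounds from bounds for localized perturbations. -/
theorem IsScaledLasso.error_bounds (hn : 0 < n) (hlam : 0 < lam) {ghat : Fin p → ℝ} {that : ℝ}
    (h : IsScaledLasso X Y lam ghat that) {g : Fin p → ℝ} (hS : 0 < sigmaOra X Y g) {lbar R : ℝ}
    (hz : ∀ j, |colDot X (Y - X.mulVec g) j| ≤ n * sigmaOra X Y g * lbar)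
    (hR : lam * R < sigmaOra X Y g)
    (hloc : ∀ w, sigmaOra X Y (g + w) + lam * l1norm (g + w) ≤ sigmaOra X Y g + lam * l1norm g →
      lam * l1norm w ≤ sigmaOra X Y g → l1norm w ≤ R) :
    l1norm (ghat - g) ≤ R ∧
    l2norm (X.mulVec (ghat - g)) ^ 2
      ≤ n * ((3 * lam + 2 * lbar) * sigmaOra X Y g * l1norm (ghat - g)) ∧
    |that - sigmaOra X Y g| ≤ (lam + |lbar|) * l1norm (ghat - g) := by
  have hn' : (0 : ℝ) < n := by exact_mod_cast hn
  have hcrit := h.sigmaOra_add_le hn hlam.le g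
  rw [← add_sub_cancel g ghat] at hcrit
  rw [h.eq_sigmaOra hn hlam.le]
  have heq : sigmaOra X Y ghat = sigmaOra X Y (g + (ghat - g)) := by rw [add_sub_cancel]
  rw [heq]
  set w := ghat - g with hw
  -- A larger `w` could be shrunk towards zero until λ‖w‖₁ = S without increasing the criterion
  -- above its value at `g`; the local bound would then give S ≤ λR < S.
  have hsmall : lam * l1norm w ≤ sigmaOra X Y g := by
    by_contra hbig
    push Not at hbig
    have hpos : 0 < lam * l1norm w := hS.trans hbig
    set θ := sigmaOra X Y g / (lam * l1norm w) with hθ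
    have hθ0 : 0 ≤ θ := by positivity
    have hθ1 : θ ≤ 1 := (div_le_one hpos).2 hbig.le
    have h1 : lam * l1norm (θ • w) = sigmaOra X Y g := by
      rw [l1norm_smul, abs_of_nonneg hθ0, hθ]
      field_simp
      exact div_self (right_ne_zero_of_mul hpos.ne')
    have h2 := hloc (θ • w) (sigmaOra_add_smul_le hlam.le hθ0 hθ1 hcrit) h1.le
    have := mul_le_mul_of_nonneg_left h2 hlam.le
    linarith
  refine ⟨hloc w hcrit hsmall, l2norm_mulVec_sq_le hn hlam.le hz hcrit hsmall, ?_⟩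
  have h1 := sigmaOra_add_le_of_criterion hlam.le hcrit
  have h2 := sigmaOra_sub_le (X := X) (Y := Y) hn g w
  have h3 : ∑ j, w j * colDot X (Y - X.mulVec g) j ≤ n * sigmaOra X Y g * lbar * l1norm w :=
    sum_mul_colDot_le hz Finset.univ w
  have h4 : sigmaOra X Y g - sigmaOra X Y (g + w) ≤ lbar * l1norm w := by
    have : n * sigmaOra X Y g * (sigmaOra X Y g - sigmaOra X Y (g + w))
        ≤ n * sigmaOra X Y g * (lbar * l1norm w) := by linarith
    exact le_of_mul_le_mul_left this (by positivity)
  have h5 := mul_le_mul_of_nonneg_right (le_abs_self lbar) (l1norm_nonneg w)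
  have h6 := mul_nonneg (abs_nonneg lbar) (l1norm_nonneg w)
  have h7 := mul_nonneg hlam.le (l1norm_nonneg w)
  exact abs_le.2 ⟨by nlinarith, by nlinarith⟩

end scaledLasso

/-! ### Compatibility and localized ℓ₁ bounds. -/

/-- The form of compatibility without infima. The maximum with one keeps the constant positive for
every real `C`. If `Xu` vanished while `u` does not on `J`, the inverse square would be infinite,
contrary to the hypothesis. -/
theorem CondCompat.sq_l1normOn_le {n p : ℕ} (hn : 0 < n) {X : Matrix (Fin n) (Fin p) ℝ}
    {K J : Finset (Fin p)} {α C : ℝ} {s₂ : ℕ} (h : CondCompat X K α s₂ C)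
    (hJ : (J \ K).card ≤ s₂) {u : Fin p → ℝ} (hu : l1normOn Jᶜ u ≤ α * l1normOn J u) :
    n * l1normOn J u ^ 2 ≤ max C 1 * J.card * l2norm (X.mulVec u) ^ 2 := by
  have hn' : (0 : ℝ) < n := by exact_mod_cast hn
  have hC : 0 < max C 1 := lt_max_of_lt_right one_pos
  rcases (l1normOn_nonneg J u).eq_or_lt with h0 | h0
  · rw [← h0]
    have := sq_nonneg (l2norm (X.mulVec u))
    simp only [ne_eq, OfNat.ofNat_ne_zero, not_false_eq_true, zero_pow, mul_zero]
    positivity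
  have hu0 : u ≠ 0 := by
    rintro rfl
    simp [l1normOn] at h0
  set q := √(J.card : ℝ) * l2norm (X.mulVec u) / (√(n : ℝ) * l1normOn J u) with hq
  have hq0 : 0 ≤ q := by
    have := l2norm_nonneg (X.mulVec u)
    positivity
  have h1 : phiComp α J X ≤ ENNReal.ofReal q := iInf₂_le u ⟨hu, hu0⟩
  have h2 : (ENNReal.ofReal (q ^ 2))⁻¹ ≤ ENNReal.ofReal (max C 1) := by
    rw [ENNReal.ofReal_pow hq0]
    refine le_trans (ENNReal.inv_le_inv.2 (pow_le_pow_left₀ zero_le h1 2)) ?_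
    refine le_trans ?_ (h.trans (ENNReal.ofReal_le_ofReal (le_max_left C 1)))
    exact le_iSup₂_of_le (f := fun (J : Finset (Fin p)) (_ : (J \ K).card ≤ s₂) =>
      (phiComp α J X ^ 2)⁻¹) J hJ le_rfl
  have hqpos : 0 < q ^ 2 := by
    refine lt_of_le_of_ne (sq_nonneg q) fun h0 => ?_
    rw [← h0, ENNReal.ofReal_zero, ENNReal.inv_zero, top_le_iff] at h2
    exact ENNReal.ofReal_ne_top h2
  rw [← ENNReal.ofReal_inv_of_pos hqpos, ENNReal.ofReal_le_ofReal_iff hC.le,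
    inv_le_iff_one_le_mul₀ hqpos] at h2
  have h3 : q ^ 2 = J.card * l2norm (X.mulVec u) ^ 2 / (n * l1normOn J u ^ 2) := by
    rw [hq, div_pow, mul_pow, mul_pow, Real.sq_sqrt hn'.le, Real.sq_sqrt (Nat.cast_nonneg _)]
  rw [h3, ← mul_div_assoc, le_div_iff₀ (by positivity)] at h2
  linarith

section localized

variable {n p : ℕ} {X : Matrix (Fin n) (Fin p) ℝ} {Y : Fin n → ℝ} {lam : ℝ}

/-- Localized `ℓ₁` bound when weighted averages of the correlations lie below the penalty. -/
theorem l1norm_le_of_average (hn : 0 < n) (hlam : 0 < lam) {g w : Fin p → ℝ}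
    (hS : 0 < sigmaOra X Y g) {K : Finset (Fin p)} {s₂ : ℕ} (hs₂ : 1 ≤ s₂) {α C lbar ρ c s G : ℝ}
    (hα : 1 ≤ α) (hlbar : 0 ≤ lbar) (hc : 0 < c) (hcompat : CondCompat X K α s₂ C)
    (hz : ∀ j, |colDot X (Y - X.mulVec g) j| ≤ n * sigmaOra X Y g * lbar)
    (hρ : ∀ a ∈ weightPolytope p (α * s₂), ∑ j, a j * |colDot X (Y - X.mulVec g) j|
      ≤ n * sigmaOra X Y g * ρ)
    (hgap : c * lam ≤ lam - ρ - (lam + lbar) / α) (hs : (K.card : ℝ) + s₂ ≤ s)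
    (hG : l1normOn Kᶜ g ≤ G)
    (hw : sigmaOra X Y (g + w) + lam * l1norm (g + w) ≤ sigmaOra X Y g + lam * l1norm g)
    (hwS : lam * l1norm w ≤ sigmaOra X Y g) :
    l1norm w ≤ (1 + α) ^ 2 * max C 1 * (3 * lam + 2 * lbar) * s * sigmaOra X Y g + 4 * G / c := by
  have hn' : (0 : ℝ) < n := by exact_mod_cast hn
  have hs₂' : (0 : ℝ) < s₂ := by exact_mod_cast hs₂
  have hC : 0 < max C 1 := lt_max_of_lt_right one_pos
  have hs0 : 0 ≤ s := le_trans (by positivity) hs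
  have hG0 : 0 ≤ G := (l1normOn_nonneg _ _).trans hG
  have hα0 : 0 < α := by linarith
  obtain ⟨T, hTK, hT, htop⟩ := exists_top_subset (fun j => |w j|) Kᶜ s₂
  set J := K ∪ T with hJ
  have hJK : (J \ K).card ≤ s₂ := by
    refine le_trans (Finset.card_le_card ?_) hT
    intro j hj
    simp only [hJ, Finset.mem_sdiff, Finset.mem_union] at hj
    exact hj.1.resolve_left hj.2
  have hJcard : (J.card : ℝ) ≤ s := by
    refine le_trans ?_ hs
    have h2 : J.card ≤ K.card + s₂ := (Finset.card_union_le K T).trans (by omega)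
    exact_mod_cast h2
  have hJG : l1normOn Jᶜ g ≤ G := by
    refine le_trans (Finset.sum_le_sum_of_subset_of_nonneg ?_ fun _ _ _ => abs_nonneg _) hG
    exact Finset.compl_subset_compl.2 Finset.subset_union_left
  set a := l1normOn J w with ha
  set b := l1normOn Jᶜ w with hb
  have ha0 : 0 ≤ a := l1normOn_nonneg _ _
  have hb0 : 0 ≤ b := l1normOn_nonneg _ _
  have hab : l1norm w = a + b := (l1normOn_add_compl J w).symm
  have hnS : 0 < n * sigmaOra X Y g := by positivity
  -- Inside the cone, compatibility bounds `a` by the prediction error, which is linear in `a`.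
  -- Outside it, the mass off `J` is spread thinly and only weighted averages of the correlations
  -- enter.
  rcases le_or_gt b (α * a) with hcone | hcone
  · have h1 := hcompat.sq_l1normOn_le hn hJK hcone
    have h2 := l2norm_mulVec_sq_le hn hlam.le hz hw hwS
    set S := sigmaOra X Y g
    set β := 3 * lam + 2 * lbar
    have hβ : 0 ≤ β := by positivity
    have h3 : n * a ^ 2 ≤ n * (max C 1 * s * β * S * (1 + α) * a) := by
      refine h1.trans ?_
      calc max C 1 * J.card * l2norm (X.mulVec w) ^ 2
          ≤ max C 1 * s * (n * (β * S * l1norm w)) := by gcongr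
        _ ≤ max C 1 * s * (n * (β * S * ((1 + α) * a))) := by
            gcongr
            linarith
        _ = _ := by ring
    have h4 : a * a ≤ (max C 1 * s * β * S * (1 + α)) * a := by
      have := le_of_mul_le_mul_left h3 hn'
      linarith
    have h5 : a ≤ max C 1 * s * β * S * (1 + α) := by
      rcases ha0.eq_or_lt with h0 | h0
      · rw [← h0]; positivity
      · exact le_of_mul_le_mul_right h4 h0
    have h6 : 0 ≤ 4 * G / c := by positivity
    have h7 : l1norm w ≤ (1 + α) * a := by linarith
    have h8 := mul_le_mul_of_nonneg_left h5 (show 0 ≤ 1 + α by linarith)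
    calc l1norm w ≤ (1 + α) * (max C 1 * s * β * S * (1 + α)) := h7.trans h8
      _ = (1 + α) ^ 2 * max C 1 * β * s * S := by ring
      _ ≤ _ := by linarith
  · have hbpos : 0 < b := lt_of_le_of_lt (by positivity) hcone
    -- A coordinate off `J` is at most the average of the s₂ coordinates in `T`, hence at most a/s₂
    -- < b/(α s₂).
    have hsmall : ∀ j ∈ Jᶜ, |w j| * (α * s₂) ≤ b := by
      intro j hj
      have hj' : j ∈ Kᶜ \ T := by
        simp only [hJ, Finset.mem_compl, Finset.mem_union, not_or] at hj
        simp [hj.1, hj.2]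
      obtain ⟨hcard, hle⟩ := htop j hj'
      have h1 : (s₂ : ℝ) * |w j| ≤ ∑ i ∈ T, |w i| := by
        rw [← hcard, ← nsmul_eq_mul]
        exact Finset.card_nsmul_le_sum T _ _ hle
      have h2 : ∑ i ∈ T, |w i| ≤ a :=
        Finset.sum_le_sum_of_subset_of_nonneg Finset.subset_union_right fun _ _ _ => abs_nonneg _
      nlinarith
    set v : Fin p → ℝ := fun j => if j ∈ Jᶜ then |w j| / b else 0 with hv
    have hvmem : v ∈ weightPolytope p (α * s₂) := by
      refine ⟨fun j => ?_, ?_⟩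
      · simp only [hv]
        split_ifs with hj
        · refine ⟨by positivity, ?_⟩
          rw [div_le_div_iff₀ hbpos (by positivity), one_mul]
          exact hsmall j hj
        · exact ⟨le_rfl, by positivity⟩
      · rw [hv, Finset.sum_ite_mem, Finset.univ_inter, ← Finset.sum_div]
        exact (div_self hbpos.ne').le
    have h1 := hρ v hvmem
    have h2 : ∑ j ∈ Jᶜ, w j * colDot X (Y - X.mulVec g) j ≤ n * sigmaOra X Y g * ρ * b := by
      have h3 : ∑ j ∈ Jᶜ, w j * colDot X (Y - X.mulVec g) j
          ≤ b * ∑ j, v j * |colDot X (Y - X.mulVec g) j| := by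
        have h4 : ∑ j, v j * |colDot X (Y - X.mulVec g) j|
            = ∑ j ∈ Jᶜ, |w j| / b * |colDot X (Y - X.mulVec g) j| := by
          simp only [hv, ite_mul, zero_mul]
          rw [Finset.sum_ite_mem, Finset.univ_inter]
        rw [h4, Finset.mul_sum]
        refine Finset.sum_le_sum fun j _ => ?_
        calc w j * colDot X (Y - X.mulVec g) j ≤ |w j * colDot X (Y - X.mulVec g) j| := le_abs_self _
          _ = b * (|w j| / b * |colDot X (Y - X.mulVec g) j|) := by
              rw [abs_mul]; field_simp
      have := mul_le_mul_of_nonneg_left h1 hbpos.le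
      linarith
    have h3 := sum_mul_colDot_le hz J w
    have h4 := lam_mul_l1normOn_compl_le hn hlam.le hS hw J
    rw [← Finset.sum_add_sum_compl J] at h4
    have h5 : n * sigmaOra X Y g * (lam * b) ≤ n * sigmaOra X Y g
        * (lam * a + 2 * lam * G + lbar * a + ρ * b) := by
      have := mul_le_mul_of_nonneg_left hJG (show 0 ≤ n * sigmaOra X Y g * (2 * lam) by positivity)
      linarith
    have h6 := le_of_mul_le_mul_left h5 hnS
    -- As a < b/α, the mass on `J` costs only (λ + lbar)/α per unit of `b`; the gap hypothesis then
    -- leaves cλb ≤ 2λG.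
    have h7 : (lam + lbar) * a ≤ (lam + lbar) / α * b := by
      rw [div_mul_eq_mul_div, le_div_iff₀ hα0]
      nlinarith
    have h8 := mul_le_mul_of_nonneg_right hgap hb0
    have h9 : lam * (c * b) ≤ lam * (2 * G) := by linarith
    have h10 : b ≤ 2 * G / c := by
      rw [le_div_iff₀ hc]
      linarith [le_of_mul_le_mul_left h9 hlam]
    have h11 : a ≤ b := by nlinarith
    have h12 : 4 * G / c = 2 * (2 * G / c) := by ring
    have h13 : 0 ≤ (1 + α) ^ 2 * max C 1 * (3 * lam + 2 * lbar) * s * sigmaOra X Y g := by positivity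
    linarith

/-- Signs for which a signed sum of columns is no longer than for orthogonal columns. -/
theorem exists_signs (hX : Standardized X) (B : Finset (Fin p)) :
    ∃ ξ : Fin p → ℝ, (∀ j ∈ B, |ξ j| = 1) ∧ (∀ j ∉ B, ξ j = 0) ∧
      l2norm (X.mulVec ξ) ^ 2 ≤ n * B.card := by
  induction B using Finset.induction_on with
  | empty => exact ⟨0, by simp, by simp, by simp [l2norm]⟩
  | insert j B hj ih =>
    obtain ⟨ξ, h1, h2, h3⟩ := ih
    -- The sign is chosen so that the cross term with the part already built does not lengthen the
    -- sum.
    obtain ⟨x, hx, hx'⟩ : ∃ x : ℝ, |x| = 1 ∧ 0 ≤ x * colDot X (X.mulVec ξ) j := by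
      rcases le_total 0 (colDot X (X.mulVec ξ) j) with h | h
      · exact ⟨1, by simp, by simpa using h⟩
      · exact ⟨-1, by simp, by simpa using h⟩
    refine ⟨ξ - Pi.single j x, fun i hi => ?_, fun i hi => ?_, ?_⟩
    · rcases Finset.mem_insert.1 hi with rfl | hi
      · simp [h2 i hj, hx]
      · have : i ≠ j := fun h => hj (h ▸ hi)
        simp [this, h1 i hi]
    · simp only [Finset.mem_insert, not_or] at hi
      simp [hi.1, h2 i hi.2]
    · have h4 : X.mulVec (Pi.single j x) = x • fun i => X i j := by
        ext i
        simp [mul_comm]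
      rw [Matrix.mulVec_sub, l2norm_sub_sq, h4, l2norm_smul, hx, one_mul, hX j,
        Finset.card_insert_of_notMem hj]
      have h5 : ∑ i, (x • fun i => X i j) i * X.mulVec ξ i = x * colDot X (X.mulVec ξ) j := by
        simp only [colDot, Finset.mul_sum, Pi.smul_apply, smul_eq_mul]
        exact Finset.sum_congr rfl fun i _ => by ring
      rw [h5]
      push_cast
      linarith

theorem l2norm_mulVec_le (hX : Standardized X) (u : Fin p → ℝ) :
    l2norm (X.mulVec u) ≤ √(n : ℝ) * l1norm u := by
  have hcol : ∀ j, l2norm (fun i => X i j) = √(n : ℝ) := fun j => by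
    rw [← hX j]
    exact (Real.sqrt_sq (l2norm_nonneg _)).symm
  have h1 : l2norm (X.mulVec u) ^ 2 ≤ l2norm (X.mulVec u) * (√(n : ℝ) * l1norm u) := by
    have h2 : l2norm (X.mulVec u) ^ 2 = ∑ j, u j * colDot X (X.mulVec u) j := by
      rw [sum_mul_colDot, l2norm_sq]
      exact Finset.sum_congr rfl fun i _ => sq _
    rw [h2]
    refine (sum_mul_colDot_le (B := √(n : ℝ) * l2norm (X.mulVec u)) (fun j => ?_)
      Finset.univ u).trans (le_of_eq ?_)
    · rw [← hcol j]; exact abs_colDot_le X _ j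
    · rw [show l1normOn Finset.univ u = l1norm u from rfl]; ring
  rcases (l2norm_nonneg (X.mulVec u)).eq_or_lt with h | h
  · rw [← h]; exact mul_nonneg (Real.sqrt_nonneg _) (l1norm_nonneg u)
  · rw [sq] at h1
    exact le_of_mul_le_mul_left h1 h

theorem CondCompat.sqrt_mul_l1normOn_le (hn : 0 < n) {K : Finset (Fin p)} {α C : ℝ} {s₂ : ℕ}
    (h : CondCompat X K α s₂ C) {u : Fin p → ℝ} (hu : l1normOn Kᶜ u ≤ α * l1normOn K u) :
    √(n : ℝ) * l1normOn K u ≤ √(max C 1 * K.card) * l2norm (X.mulVec u) := by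
  have hC : 0 < max C 1 := lt_max_of_lt_right one_pos
  have h1 := h.sq_l1normOn_le hn (by simp) hu
  refine (pow_le_pow_iff_left₀ (mul_nonneg (Real.sqrt_nonneg _) (l1normOn_nonneg _ _))
    (mul_nonneg (Real.sqrt_nonneg _) (l2norm_nonneg _)) two_ne_zero).1 ?_
  rwa [mul_pow, mul_pow, Real.sq_sqrt (Nat.cast_nonneg n), Real.sq_sqrt (by positivity)]

/-- Compatibility for vectors in a small neighbourhood of the cone. -/
theorem CondCompat.sqrt_mul_l1normOn_le_of_relaxed (hn : 0 < n) (hX : Standardized X)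
    {K : Finset (Fin p)} {α C D : ℝ} {s₂ : ℕ} (h : CondCompat X K α s₂ C) (hα : 1 ≤ α) (hD : 0 ≤ D)
    {w : Fin p → ℝ} (hw : l1normOn Kᶜ w ≤ α * l1normOn K w + D) :
    √(n : ℝ) * l1normOn K w ≤ 2 * (√(max C 1 * K.card) * l2norm (X.mulVec w))
      + √(n : ℝ) * (200 * max C 1 * D) := by
  set C' := max C 1
  have hC : 1 ≤ C' := le_max_right _ _
  have hα0 : 0 < α := by linarith
  set a := l1normOn K w with ha
  have hm : 0 ≤ √(C' * K.card) * l2norm (X.mulVec w) :=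
    mul_nonneg (Real.sqrt_nonneg _) (l2norm_nonneg _)
  have hn0 := Real.sqrt_nonneg (n : ℝ)
  rcases le_or_gt a (200 * C' * D) with hsmall | hbig
  · have := mul_le_mul_of_nonneg_left hsmall hn0
    linarith
  have ha0 : 0 < a := lt_of_le_of_lt (by positivity) hbig
  -- Two ways to push `w` into the cone. For small `K`, shrink the coordinates off `K`: this changes
  -- ‖Xw‖ by at most √n D, and the factor √(C'|K|) is bounded. For large `K` that factor is too big,
  -- so ‖w_K‖₁ is increased instead along a random-like sign vector.
  rcases le_or_gt (K.card : ℝ) (200 * C') with hK | hK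
  · set θ := D / (α * a + D) with hθ
    have hθ0 : 0 ≤ θ := by positivity
    have hθ1 : θ ≤ 1 := (div_le_one (by positivity)).2 (by linarith [mul_pos hα0 ha0])
    have hθD : θ * (α * a + D) = D := div_mul_cancel₀ _ (by positivity)
    set v : Fin p → ℝ := fun j => if j ∈ Kᶜ then θ * w j else 0 with hv
    have h1 : l1normOn K (w - v) = a := by
      refine Finset.sum_congr rfl fun j hj => ?_
      simp [hv, hj]
    have h2 : l1normOn Kᶜ (w - v) = (1 - θ) * l1normOn Kᶜ w := by
      rw [l1normOn, l1normOn, Finset.mul_sum]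
      refine Finset.sum_congr rfl fun j hj => ?_
      simp only [hv, Pi.sub_apply, hj, if_true]
      rw [show w j - θ * w j = (1 - θ) * w j by ring, abs_mul, abs_of_nonneg (by linarith)]
    have h3 : l1norm v = θ * l1normOn Kᶜ w := by
      rw [l1norm, l1normOn, Finset.mul_sum]
      simp only [hv, apply_ite abs, abs_zero, abs_mul, abs_of_nonneg hθ0]
      rw [Finset.sum_ite_mem, Finset.univ_inter]
    have h4 : l1normOn Kᶜ (w - v) ≤ α * l1normOn K (w - v) := by
      rw [h1, h2]
      have := mul_le_mul_of_nonneg_left hw (show 0 ≤ 1 - θ by linarith)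
      linarith
    have h5 := h.sqrt_mul_l1normOn_le hn h4
    rw [h1] at h5
    have h6 : l1norm v ≤ D := by
      rw [h3, ← hθD]
      exact mul_le_mul_of_nonneg_left hw hθ0
    have h7 : l2norm (X.mulVec (w - v)) ≤ l2norm (X.mulVec w) + √(n : ℝ) * D := by
      rw [Matrix.mulVec_sub, sub_eq_add_neg]
      refine (l2norm_add_le _ _).trans (add_le_add le_rfl ?_)
      rw [l2norm_neg]
      exact (l2norm_mulVec_le hX v).trans (mul_le_mul_of_nonneg_left h6 hn0)
    have h8 : √(C' * K.card) ≤ 200 * C' := by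
      refine Real.sqrt_le_iff.2 ⟨by positivity, ?_⟩
      nlinarith
    have h9 := mul_le_mul_of_nonneg_left h7 (Real.sqrt_nonneg (C' * K.card))
    have h10 := mul_le_mul_of_nonneg_right h8 (show 0 ≤ √(n : ℝ) * D by positivity)
    nlinarith
  · have hK0 : (0 : ℝ) < K.card := lt_trans (by positivity) hK
    set κ : ℝ := (K.card : ℝ) with hκ
    -- By Markov's inequality at least half of the coordinates in `K` are at most twice the average
    -- `a / κ`.
    set K' := K.filter fun j => |w j| * κ ≤ 2 * a with hK'
    have hcard : κ ≤ 2 * K'.card := by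
      have h1 : ∑ j ∈ K.filter (fun j => ¬ |w j| * κ ≤ 2 * a), 2 * a ≤ a * κ := by
        calc ∑ j ∈ K.filter (fun j => ¬ |w j| * κ ≤ 2 * a), 2 * a
            ≤ ∑ j ∈ K.filter (fun j => ¬ |w j| * κ ≤ 2 * a), |w j| * κ :=
              Finset.sum_le_sum fun j hj => (not_le.1 (Finset.mem_filter.1 hj).2).le
          _ ≤ ∑ j ∈ K, |w j| * κ :=
              Finset.sum_le_sum_of_subset_of_nonneg (Finset.filter_subset _ _)
                fun _ _ _ => by positivity
          _ = a * κ := by rw [← Finset.sum_mul]; rfl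
      rw [Finset.sum_const, nsmul_eq_mul] at h1
      have h2 : (K'.card : ℝ) + (K.filter fun j => ¬ |w j| * κ ≤ 2 * a).card = κ := by
        rw [hκ, hK']
        exact_mod_cast Finset.card_filter_add_card_filter_not (s := K) fun j => |w j| * κ ≤ 2 * a
      have h3 : a * (2 * ((K.filter fun j => ¬ |w j| * κ ≤ 2 * a).card : ℝ)) ≤ a * κ := by linarith
      have h4 := le_of_mul_le_mul_left h3 ha0
      linarith
    -- Enough coordinates, each gaining at least a/κ, to raise ‖w_K‖₁ by D/α; this makes up for the
    -- excess `D`.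
    set N := ⌈D * κ / (α * a)⌉₊ with hN
    have hN1 : D * κ / (α * a) ≤ N := Nat.le_ceil _
    have hN2 : (N : ℝ) * (100 * C') ≤ κ := by
      have h1 : (N : ℝ) < D * κ / (α * a) + 1 := Nat.ceil_lt_add_one (by positivity)
      have h2 : D * κ / (α * a) * (200 * C') ≤ κ := by
        rw [div_mul_eq_mul_div, div_le_iff₀ (by positivity)]
        have : D * (200 * C') ≤ α * a := by nlinarith
        nlinarith
      nlinarith
    have hN3 : N ≤ K'.card := by
      have : (N : ℝ) ≤ K'.card := by nlinarith [Nat.cast_nonneg (α := ℝ) N]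
      exact_mod_cast this
    obtain ⟨B, hBK', hB⟩ := Finset.exists_subset_card_eq hN3
    have hBK : B ⊆ K := hBK'.trans (Finset.filter_subset _ _)
    obtain ⟨ξ, hξ1, hξ0, hξ⟩ := exists_signs hX B
    rw [hB] at hξ
    -- A shift by 5a/κ of a coordinate of size at most 2a/κ increases its absolute value by at least
    -- a/κ, whatever its sign.
    set r := 5 * a / κ with hr
    have hr0 : 0 < r := by positivity
    have h1 : a + N * (a / κ) ≤ l1normOn K (w + r • ξ) := by
      have h2 : ∀ j ∈ K, |w j| + (if j ∈ B then a / κ else 0) ≤ |(w + r • ξ) j| := by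
        intro j hj
        split_ifs with hjB
        · have h3 : |w j| ≤ 2 * a / κ := by
            rw [le_div_iff₀ hK0]
            exact (Finset.mem_filter.1 (hBK' hjB)).2
          have h4 : |r * ξ j| = r := by rw [abs_mul, hξ1 j hjB, mul_one, abs_of_pos hr0]
          have h5 := abs_sub (w j + r * ξ j) (w j)
          rw [add_sub_cancel_left, h4] at h5
          simp only [Pi.add_apply, Pi.smul_apply, smul_eq_mul]
          have h6 : r = 2 * a / κ + 2 * a / κ + a / κ := by rw [hr]; ring
          linarith
        · simp [hξ0 j hjB]
      refine le_trans (le_of_eq ?_) (Finset.sum_le_sum h2)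
      rw [Finset.sum_add_distrib, Finset.sum_ite_mem, Finset.inter_eq_right.2 hBK, Finset.sum_const,
        hB, nsmul_eq_mul]
      rfl
    have h2 : l1normOn Kᶜ (w + r • ξ) = l1normOn Kᶜ w := by
      refine Finset.sum_congr rfl fun j hj => ?_
      have : j ∉ B := fun hjB => Finset.mem_compl.1 hj (hBK hjB)
      simp [hξ0 j this]
    have h3 : D ≤ α * (N * (a / κ)) := by
      rw [div_le_iff₀ (by positivity)] at hN1
      have : α * (N * (a / κ)) = N * (α * a) / κ := by ring
      rw [this, le_div_iff₀ hK0]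
      exact hN1
    have h4 : l1normOn Kᶜ (w + r • ξ) ≤ α * l1normOn K (w + r • ξ) := by
      rw [h2]
      have := mul_le_mul_of_nonneg_left h1 hα0.le
      linarith
    have h5 := h.sqrt_mul_l1normOn_le hn h4
    have h6 : l2norm (X.mulVec (w + r • ξ)) ≤ l2norm (X.mulVec w) + r * (√(n : ℝ) * √(N : ℝ)) := by
      rw [Matrix.mulVec_add, Matrix.mulVec_smul]
      refine (l2norm_add_le _ _).trans (add_le_add le_rfl ?_)
      rw [l2norm_smul, abs_of_pos hr0, ← Real.sqrt_mul (Nat.cast_nonneg n)]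
      exact mul_le_mul_of_nonneg_left (Real.le_sqrt_of_sq_le hξ) hr0.le
    -- From 100 C'N ≤ κ. The added vector therefore costs at most half of √n a, which explains the
    -- factor 2 in the conclusion.
    have h7 : √(C' * κ) * √(N : ℝ) ≤ κ / 10 := by
      rw [← Real.sqrt_mul (by positivity)]
      refine Real.sqrt_le_iff.2 ⟨by positivity, ?_⟩
      nlinarith
    have h8 : √(C' * κ) * (r * (√(n : ℝ) * √(N : ℝ))) ≤ √(n : ℝ) * a / 2 := by
      calc √(C' * κ) * (r * (√(n : ℝ) * √(N : ℝ)))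
          = r * √(n : ℝ) * (√(C' * κ) * √(N : ℝ)) := by ring
        _ ≤ r * √(n : ℝ) * (κ / 10) := mul_le_mul_of_nonneg_left h7 (by positivity)
        _ = √(n : ℝ) * a / 2 := by rw [hr]; field_simp; norm_num
    have h9 := mul_le_mul_of_nonneg_left h6 (Real.sqrt_nonneg (C' * κ))
    have h10 : √(n : ℝ) * a ≤ √(n : ℝ) * l1normOn K (w + r • ξ) := by
      refine mul_le_mul_of_nonneg_left (le_trans ?_ h1) hn0
      have : (0 : ℝ) ≤ N * (a / κ) := by positivity
      linarith
    have h11 : 0 ≤ √(n : ℝ) * (200 * C' * D) := by positivity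
    linarith

/-- Localized `ℓ₁` bound when all correlations lie below the penalty. -/
theorem l1norm_le_of_uniform (hn : 0 < n) (hX : Standardized X) (hlam : 0 < lam) {g w : Fin p → ℝ}
    (hS : 0 < sigmaOra X Y g) {K : Finset (Fin p)} {α C lbar s G : ℝ} {s₂ : ℕ}
    (hα : 1 ≤ α) (hcompat : CondCompat X K α s₂ C)
    (hz : ∀ j, |colDot X (Y - X.mulVec g) j| ≤ n * sigmaOra X Y g * lbar)
    (hgap : lam + lbar ≤ α * (lam - lbar)) (hs : (K.card : ℝ) ≤ s) (hG : l1normOn Kᶜ g ≤ G)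
    (hw : sigmaOra X Y (g + w) + lam * l1norm (g + w) ≤ sigmaOra X Y g + lam * l1norm g)
    (hwS : lam * l1norm w ≤ sigmaOra X Y g) :
    l1norm w ≤ (1 + α) * (20 * max C 1 * (1 + α) * lam * s * sigmaOra X Y g
      + 402 * max C 1 * ((1 + α) * G)) := by
  have hn' : (0 : ℝ) < n := by exact_mod_cast hn
  have hsn : 0 < √(n : ℝ) := Real.sqrt_pos.2 hn'
  have hG0 : 0 ≤ G := (l1normOn_nonneg _ _).trans hG
  have hs0 : 0 ≤ s := le_trans (by positivity) hs
  have hnS : 0 < n * sigmaOra X Y g := by positivity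
  have hlt : 0 < lam - lbar := by
    by_contra hle
    push Not at hle
    nlinarith
  have h1 := lam_mul_l1normOn_compl_le hn hlam.le hS hw K
  have h2 : ∑ j, w j * colDot X (Y - X.mulVec g) j ≤ n * sigmaOra X Y g * lbar * l1norm w :=
    sum_mul_colDot_le hz Finset.univ w
  have hab := l1normOn_add_compl K w
  set a := l1normOn K w with ha
  set b := l1normOn Kᶜ w with hb
  have ha0 : 0 ≤ a := l1normOn_nonneg _ _
  have hb0 : 0 ≤ b := l1normOn_nonneg _ _
  set D := (1 + α) * G with hD
  have hD0 : 0 ≤ D := by positivity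
  have hcone : b ≤ α * a + D := by
    have h3 : n * sigmaOra X Y g * (lam * b)
        ≤ n * sigmaOra X Y g * (lam * a + 2 * lam * G + lbar * (a + b)) := by
      have := mul_le_mul_of_nonneg_left hG (show 0 ≤ n * sigmaOra X Y g * (2 * lam) by positivity)
      rw [← hab] at h2
      linarith
    have h4 := le_of_mul_le_mul_left h3 hnS
    have h5 : (lam - lbar) * b ≤ (lam - lbar) * (α * a + D) := by
      have h6 := mul_le_mul_of_nonneg_right hgap ha0
      have h7 : 2 * lam * G ≤ (1 + α) * (lam - lbar) * G :=
        mul_le_mul_of_nonneg_right (by linarith) hG0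
      rw [hD]
      linarith
    exact le_of_mul_le_mul_left h5 hlt
  have h3 := hcompat.sqrt_mul_l1normOn_le_of_relaxed hn hX hα hD0 hcone
  have h4 := l2norm_mulVec_sq_le hn hlam.le hz hw hwS
  have hC : 1 ≤ max C 1 := le_max_right _ _
  set C' := max C 1
  set S := sigmaOra X Y g
  set P := 20 * C' * (1 + α) * lam * s * S with hP
  have hP0 : 0 ≤ P := by positivity
  -- The square of the left side is at most n P(a + D), and P(a + D) ≤ ((P + a + D)/2)². Half of `a`
  -- can thus be absorbed on the left.
  have h5 : 2 * (√(C' * K.card) * l2norm (X.mulVec w)) ≤ √(n : ℝ) * ((P + (a + D)) / 2) := by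
    refine (pow_le_pow_iff_left₀ (mul_nonneg zero_le_two (mul_nonneg (Real.sqrt_nonneg _)
      (l2norm_nonneg _))) (by positivity) two_ne_zero).1 ?_
    rw [mul_pow, mul_pow, mul_pow, Real.sq_sqrt hn'.le, Real.sq_sqrt (by positivity)]
    calc 2 ^ 2 * (C' * K.card * l2norm (X.mulVec w) ^ 2)
        ≤ 2 ^ 2 * (C' * s * (n * ((5 * lam) * S * ((1 + α) * (a + D))))) := by
          have h6 : (3 * lam + 2 * lbar) * S * l1norm w ≤ (5 * lam) * S * ((1 + α) * (a + D)) := by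
            have : l1norm w ≤ (1 + α) * (a + D) := by
              have := mul_nonneg (zero_le_one.trans hα) hD0
              linarith
            have h7 := l1norm_nonneg w
            have h8 : 3 * lam + 2 * lbar ≤ 5 * lam := by linarith
            gcongr
          have h9 := h4.trans (mul_le_mul_of_nonneg_left h6 hn'.le)
          gcongr
      _ = n * (P * (a + D)) := by rw [hP]; ring
      _ ≤ n * ((P + (a + D)) / 2) ^ 2 := by
          refine mul_le_mul_of_nonneg_left ?_ hn'.le
          nlinarith [sq_nonneg (P - (a + D))]
  have h6 : √(n : ℝ) * a ≤ √(n : ℝ) * ((P + (a + D)) / 2 + 200 * C' * D) := by linarith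
  have h7 := le_of_mul_le_mul_left h6 hsn
  have hCD : D ≤ C' * D := le_mul_of_one_le_left hD0 hC
  have h8 : a ≤ P + 401 * C' * D := by linarith
  have h9 : l1norm w ≤ (1 + α) * a + D := by linarith
  have h10 : D ≤ (1 + α) * (C' * D) :=
    hCD.trans (le_mul_of_one_le_left (by positivity) (by linarith))
  have h11 := mul_le_mul_of_nonneg_left h8 (show 0 ≤ 1 + α by linarith)
  linarith

end localized

/-! ### Error bounds on the good event. -/

section pointwise

variable {n p : ℕ} {X : Matrix (Fin n) (Fin p) ℝ} {Y : Fin n → ℝ} {lam : ℝ}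

theorem log_pos_of_two_le (hp : 2 ≤ p) : 0 < Real.log p :=
  Real.log_pos (by exact_mod_cast hp)

theorem sq_rate (hn : 0 < n) (hp : 2 ≤ p) {δ : ℝ} (hδ : 1 ≤ δ) :
    n * √(δ * Real.log p / n) ^ 2 = δ * Real.log p := by
  have hn' : (0 : ℝ) < n := by exact_mod_cast hn
  have := log_pos_of_two_le hp
  rw [Real.sq_sqrt (by positivity)]
  field_simp

theorem rate_pos (hn : 0 < n) (hp : 2 ≤ p) {δ : ℝ} (hδ : 1 ≤ δ) : 0 < √(δ * Real.log p / n) := by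
  have hn' : (0 : ℝ) < n := by exact_mod_cast hn
  have := log_pos_of_two_le hp
  exact Real.sqrt_pos.2 (by positivity)

/-- The three error bounds from a localized `ℓ₁` bound of the optimal order. -/
theorem IsScaledLasso.scaled_error_bounds (hn : 0 < n) (hp : 2 ≤ p) (hlam : 0 < lam)
    {ghat : Fin p → ℝ} {that : ℝ} (h : IsScaledLasso X Y lam ghat that) {g : Fin p → ℝ}
    (hS : 0 < sigmaOra X Y g) {lbar A B C₁ C₀ s δ c₀ : ℝ} (hδ : 1 ≤ δ) (hlbar : 0 ≤ lbar)
    (hz : ∀ j, |colDot X (Y - X.mulVec g) j| ≤ n * sigmaOra X Y g * lbar)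
    (hA : lam ≤ A * √(δ * Real.log p / n)) (hB : lbar ≤ B * √(δ * Real.log p / n)) (hs : 0 ≤ s)
    (hC₁ : 0 ≤ C₁) (hC₀ : 0 < C₀) (hC : (3 * A + 2 * B + 1) * C₁ ≤ C₀)
    (hc : δ * s * Real.log p / n ≤ c₀) (hc₀ : C₀ * c₀ ≤ 1 / 2)
    (hloc : ∀ w, sigmaOra X Y (g + w) + lam * l1norm (g + w) ≤ sigmaOra X Y g + lam * l1norm g →
      lam * l1norm w ≤ sigmaOra X Y g →
      l1norm w ≤ C₁ * s * √(δ * Real.log p / n) * sigmaOra X Y g) :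
    l2norm (X.mulVec (ghat - g)) ^ 2 ≤ C₀ * s * sigmaOra X Y g ^ 2 * δ * Real.log p ∧
    l1norm (ghat - g) ≤ C₀ * s * sigmaOra X Y g * √(δ * Real.log p / n) ∧
    (|that / sigmaOra X Y g - 1| ≤ C₀ * s * δ * Real.log p / n ∧
      C₀ * s * δ * Real.log p / n ≤ 1 / 2) := by
  have hn' : (0 : ℝ) < n := by exact_mod_cast hn
  have hτ := rate_pos hn hp hδ
  have hτ2 := sq_rate hn hp hδ
  set τ := √(δ * Real.log p / n)
  set S := sigmaOra X Y g with hSdef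
  have hA0 : 0 < A := by
    by_contra hneg
    push Not at hneg
    nlinarith
  have hB0 : 0 ≤ B := by
    by_contra hneg
    push Not at hneg
    nlinarith
  have hhalf : C₀ * s * δ * Real.log p / n ≤ 1 / 2 := by
    have h1 := mul_le_mul_of_nonneg_left hc hC₀.le
    have h2 : C₀ * s * δ * Real.log p / n = C₀ * (δ * s * Real.log p / n) := by ring
    linarith
  have hrate : ∀ c, c * s * δ * Real.log p / n = c * s * τ ^ 2 := by
    intro c
    rw [mul_assoc (c * s), ← hτ2]
    field_simp
  rw [hrate] at hhalf ⊢
  have hsτ : 0 ≤ s * τ ^ 2 := by positivity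
  have hAC : A * C₁ ≤ C₀ := le_trans (by nlinarith [mul_nonneg hA0.le hC₁, mul_nonneg hB0 hC₁]) hC
  have hABC : (A + B) * C₁ ≤ C₀ :=
    le_trans (by nlinarith [mul_nonneg hA0.le hC₁, mul_nonneg hB0 hC₁]) hC
  have hABC' : (3 * A + 2 * B) * C₁ ≤ C₀ := le_trans (by linarith) hC
  have hCC : C₁ ≤ C₀ := le_trans (by nlinarith [mul_nonneg hA0.le hC₁, mul_nonneg hB0 hC₁]) hC
  -- The smallness C₀ c₀ ≤ 1/2 ensures that the local radius stays strictly inside the localized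
  -- region.
  have hR : lam * (C₁ * s * τ * S) < S := by
    have h1 : lam * (C₁ * s * τ * S) ≤ (A * τ) * (C₁ * s * τ * S) :=
      mul_le_mul_of_nonneg_right hA (by positivity)
    have h2 : (A * τ) * (C₁ * s * τ * S) = (A * C₁) * (s * τ ^ 2) * S := by ring
    have h3 : (A * C₁) * (s * τ ^ 2) ≤ 1 / 2 :=
      (mul_le_mul_of_nonneg_right hAC hsτ).trans (by linarith)
    have h4 := mul_le_mul_of_nonneg_right h3 hS.le
    linarith
  obtain ⟨h1, h2, h3⟩ := h.error_bounds hn hlam hS hz hR hloc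
  rw [abs_of_nonneg hlbar] at h3
  rw [← hSdef] at h2 h3
  refine ⟨?_, ?_, ?_, hhalf⟩
  · calc l2norm (X.mulVec (ghat - g)) ^ 2
        ≤ n * ((3 * lam + 2 * lbar) * S * l1norm (ghat - g)) := h2
      _ ≤ n * ((3 * (A * τ) + 2 * (B * τ)) * S * (C₁ * s * τ * S)) := by
          have := l1norm_nonneg (ghat - g)
          gcongr
      _ = ((3 * A + 2 * B) * C₁) * (s * S ^ 2 * (n * τ ^ 2)) := by ring
      _ ≤ C₀ * (s * S ^ 2 * (n * τ ^ 2)) := mul_le_mul_of_nonneg_right hABC' (by positivity)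
      _ = _ := by rw [hτ2]; ring
  · calc l1norm (ghat - g) ≤ C₁ * s * τ * S := h1
      _ ≤ C₀ * s * τ * S := by gcongr
      _ = _ := by ring
  · have h4 : that / S - 1 = (that - S) / S := by field_simp
    rw [h4, abs_div, abs_of_pos hS, div_le_iff₀ hS]
    calc |that - S| ≤ (lam + lbar) * l1norm (ghat - g) := h3
      _ ≤ (A * τ + B * τ) * (C₁ * s * τ * S) := by
          have := l1norm_nonneg (ghat - g)
          gcongr
      _ = ((A + B) * C₁) * (s * τ ^ 2 * S) := by ring
      _ ≤ C₀ * (s * τ ^ 2 * S) := mul_le_mul_of_nonneg_right hABC (by positivity)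
      _ = _ := by ring

theorem CondSparse.card_le {g : Fin p → ℝ} {K : Finset (Fin p)} {s₁ : ℝ}
    (h : CondSparse X Y g K s₁) : (K.card : ℝ) ≤ s₁ :=
  le_trans (le_add_of_nonneg_right (Finset.sum_nonneg fun _ _ => by positivity)) h

/-- The capped sparsity condition also bounds the coefficients off `K`, at the rate of the penalty;
they enter the basic inequality as a bias. -/
theorem CondSparse.l1normOn_compl_le (hn : 0 < n) (hp : 2 ≤ p) {g : Fin p → ℝ}
    {K : Finset (Fin p)} {s₁ s δ : ℝ} (hδ : 1 ≤ δ) (hS : 0 < sigmaOra X Y g)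
    (h : CondSparse X Y g K s₁) (hs : s₁ ≤ s) :
    l1normOn Kᶜ g ≤ 2 * s * √(δ * Real.log p / n) * sigmaOra X Y g := by
  have hn' : (0 : ℝ) < n := by exact_mod_cast hn
  have hlog := log_pos_of_two_le hp
  set d := √(2 / (n : ℝ) * Real.log p) with hd
  have hd0 : 0 < d := Real.sqrt_pos.2 (by positivity)
  have hdτ : d ≤ 2 * √(δ * Real.log p / n) := by
    rw [hd]
    refine Real.sqrt_le_iff.2 ⟨by positivity, ?_⟩
    rw [mul_pow, Real.sq_sqrt (by positivity), ← mul_div_assoc, div_mul_eq_mul_div]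
    refine div_le_div_of_nonneg_right ?_ hn'.le
    nlinarith
  have h1 : ∑ j ∈ Kᶜ, |g j / sigmaOra X Y g| / d = l1normOn Kᶜ g / (sigmaOra X Y g * d) := by
    rw [l1normOn, Finset.sum_div]
    refine Finset.sum_congr rfl fun j _ => ?_
    rw [abs_div, abs_of_pos hS, div_div]
  have h2 : l1normOn Kᶜ g / (sigmaOra X Y g * d) ≤ s := by
    rw [← h1]
    refine le_trans (le_add_of_nonneg_left (Nat.cast_nonneg _)) (le_trans h hs)
  rw [div_le_iff₀ (by positivity)] at h2
  have hs0 : 0 ≤ s := (Nat.cast_nonneg _).trans (h.card_le.trans hs)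
  calc l1normOn Kᶜ g ≤ s * (sigmaOra X Y g * d) := h2
    _ ≤ s * (sigmaOra X Y g * (2 * √(δ * Real.log p / n))) := by gcongr
    _ = _ := by ring

/-- The penalty exceeds the noise level by a fixed proportion. -/
theorem penalty_gap {ℓ ε η α b : ℝ} (hℓ : 0 < ℓ) (hε : 0 < ε) (hη : 0 ≤ η) (hηε : η < ε)
    (hb : 0 ≤ b) (hα : 1 ≤ α) (hαb : 1 + ε + b + 0.65 ≤ 0.94 * (α * (ε - η)))
    (hlam : (1 + ε) * ℓ ≤ lam) :
    0.06 * (ε - η) / (1 + ε) * lam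
      ≤ lam - ℓ * (1 + η + 0.65 / α) - (lam + ℓ * b) / α := by
  have hα0 : 0 < α := by linarith
  have he : 0 < 1 + ε := by linarith
  have hd : 0 < ε - η := by linarith
  set c := 0.06 * (ε - η) / (1 + ε) with hc
  have hce : c * (1 + ε) = 0.06 * (ε - η) := div_mul_cancel₀ _ he.ne'
  have h0 : (1 + ε + b + 0.65) / α ≤ 0.94 * (ε - η) := by
    rw [div_le_iff₀ hα0]; linarith
  have h1 : 0 ≤ 1 - 1 / α - c := by
    have h2 : (1 + ε) / α ≤ (1 + ε + b + 0.65) / α :=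
      div_le_div_of_nonneg_right (by linarith) hα0.le
    have h3 : (1 + ε) * (1 - 1 / α - c) = (1 + ε) - (1 + ε) / α - c * (1 + ε) := by ring
    have h4 : 0 ≤ (1 + ε) * (1 - 1 / α - c) := by rw [h3, hce]; linarith
    exact nonneg_of_mul_nonneg_right h4 he
  have h2 := mul_le_mul_of_nonneg_right hlam h1
  -- The expression increases with `lam`, so the smallest penalty (1 + ε)ℓ decides. There the budget
  -- ε - η is split: 0.94 of it pays for the terms divided by α, and 0.06 remains as the gap.
  have h3 : (1 + ε) * ℓ * (1 - 1 / α - c) - ℓ * (1 + η + 0.65 / α) - ℓ * b / α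
      = ℓ * (ε - η - (1 + ε + b + 0.65) / α - c * (1 + ε)) := by ring
  have h4 : 0 ≤ ℓ * (ε - η - (1 + ε + b + 0.65) / α - c * (1 + ε)) := by
    rw [hce]
    exact mul_nonneg hℓ.le (by linarith)
  have h5 : (lam + ℓ * b) / α = lam * (1 / α) + ℓ * b / α := by ring
  rw [h5]
  linarith

/-- Constant in the error bounds for the smaller penalty levels. -/
noncomputable def averageConst (α ε η C A : ℝ) : ℝ :=
  (1 + α) ^ 2 * max C 1 * (3 * A + 2 * (α * A)) + 8 / (0.06 * (ε - η) / (1 + ε))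

/-- Error bounds when the largest weighted averages of the correlations are controlled. -/
theorem IsScaledLasso.error_bounds_of_average (hn : 0 < n) (hp : 2 ≤ p) {ghat : Fin p → ℝ}
    {that : ℝ} (h : IsScaledLasso X Y lam ghat that) {g : Fin p → ℝ} (hS : 0 < sigmaOra X Y g)
    {K : Finset (Fin p)} {s₂ : ℕ} (hs₂ : 1 ≤ s₂) {ℓ ε η α b C A C₀ s s₁ δ c₀ : ℝ}
    (hℓ : 0 < ℓ) (hε : 0 < ε) (hη : 0 ≤ η) (hηε : η < ε) (hb : 0 ≤ b) (hα : 1 ≤ α)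
    (hαb : 1 + ε + b + 0.65 ≤ 0.94 * (α * (ε - η))) (hlam : (1 + ε) * ℓ ≤ lam)
    (hA : lam ≤ A * √(δ * Real.log p / n)) (hδ : 1 ≤ δ)
    (hsparse : CondSparse X Y g K s₁) (hs : s₁ + s₂ ≤ s) (hcompat : CondCompat X K α s₂ C)
    (hz : ∀ j, |colDot X (Y - X.mulVec g) j| ≤ n * sigmaOra X Y g * (ℓ * b))
    (hρ : ∀ a ∈ weightPolytope p (α * s₂), ∑ j, a j * |colDot X (Y - X.mulVec g) j|
      ≤ n * sigmaOra X Y g * (ℓ * (1 + η + 0.65 / α)))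
    (hC₀ : 0 < C₀) (hC : (3 * A + 2 * (α * A) + 1) * averageConst α ε η C A ≤ C₀)
    (hc : δ * s * Real.log p / n ≤ c₀) (hc₀ : C₀ * c₀ ≤ 1 / 2) :
    l2norm (X.mulVec (ghat - g)) ^ 2 ≤ C₀ * s * sigmaOra X Y g ^ 2 * δ * Real.log p ∧
    l1norm (ghat - g) ≤ C₀ * s * sigmaOra X Y g * √(δ * Real.log p / n) ∧
    (|that / sigmaOra X Y g - 1| ≤ C₀ * s * δ * Real.log p / n ∧
      C₀ * s * δ * Real.log p / n ≤ 1 / 2) := by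
  have hlam0 : 0 < lam := lt_of_lt_of_le (by positivity) hlam
  have hτ := rate_pos hn hp hδ
  have hs₁0 : 0 ≤ s₁ := (Nat.cast_nonneg _).trans hsparse.card_le
  have hs0 : 0 ≤ s := le_trans (by positivity) hs
  have hA0 : 0 < A := by
    by_contra hneg
    push Not at hneg
    nlinarith
  have hα0 : 0 < α := by linarith
  have hd : 0 < ε - η := by linarith
  have hc1 : 0 < 0.06 * (ε - η) / (1 + ε) := by positivity
  have hmax : 0 < max C 1 := lt_max_of_lt_right one_pos
  have hlbar : ℓ * b ≤ α * lam := by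
    have h1 : b ≤ α * (1 + ε) := by nlinarith
    have h2 := mul_le_mul_of_nonneg_left h1 hℓ.le
    have h3 := mul_le_mul_of_nonneg_left hlam hα0.le
    linarith
  have hlbar' : ℓ * b ≤ α * A * √(δ * Real.log p / n) :=
    hlbar.trans ((mul_le_mul_of_nonneg_left hA hα0.le).trans (le_of_eq (by ring)))
  have hC1 : 0 ≤ averageConst α ε η C A := by
    unfold averageConst
    positivity
  have hG := hsparse.l1normOn_compl_le hn hp hδ hS
    (show s₁ ≤ s by linarith [Nat.cast_nonneg (α := ℝ) s₂])
  refine h.scaled_error_bounds hn hp hlam0 hS hδ (by positivity) hz hA hlbar' hs0 hC1 hC₀ hC hc hc₀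
    fun w hw hwS => ?_
  refine (l1norm_le_of_average (s := s) hn hlam0 hS hs₂ hα (by positivity) hc1 hcompat hz hρ
    (penalty_gap hℓ hε hη hηε hb hα hαb hlam) (by linarith [hsparse.card_le]) hG hw hwS).trans ?_
  set τ := √(δ * Real.log p / n)
  set S := sigmaOra X Y g
  set c := 0.06 * (ε - η) / (1 + ε)
  have h1 : 3 * lam + 2 * (ℓ * b) ≤ (3 * A + 2 * (α * A)) * τ := by linarith
  calc (1 + α) ^ 2 * max C 1 * (3 * lam + 2 * (ℓ * b)) * s * S + 4 * (2 * s * τ * S) / c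
      ≤ (1 + α) ^ 2 * max C 1 * ((3 * A + 2 * (α * A)) * τ) * s * S + 4 * (2 * s * τ * S) / c := by
        gcongr
    _ = ((1 + α) ^ 2 * max C 1 * (3 * A + 2 * (α * A)) + 8 / c) * s * τ * S := by ring

/-- Constant in the error bounds for the large penalty level. -/
noncomputable def uniformConst (α C A : ℝ) : ℝ :=
  (1 + α) ^ 2 * max C 1 * (20 * A + 804)

/-- Error bounds when all correlations are controlled. -/
theorem IsScaledLasso.error_bounds_of_uniform (hn : 0 < n) (hp : 2 ≤ p) (hX : Standardized X)
    {ghat : Fin p → ℝ} {that : ℝ} (h : IsScaledLasso X Y lam ghat that) {g : Fin p → ℝ}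
    (hS : 0 < sigmaOra X Y g) {K : Finset (Fin p)} {ℓ ε α C A C₀ s s₁ δ c₀ : ℝ} {s₂ : ℕ}
    (hℓ : 0 < ℓ) (hε : 0 < ε) (hα : α = 1 + 2 / ε) (hlam : (1 + ε) * ℓ ≤ lam)
    (hA : lam ≤ A * √(δ * Real.log p / n)) (hδ : 1 ≤ δ)
    (hsparse : CondSparse X Y g K s₁) (hs : s₁ ≤ s) (hcompat : CondCompat X K α s₂ C)
    (hz : ∀ j, |colDot X (Y - X.mulVec g) j| ≤ n * sigmaOra X Y g * ℓ)
    (hC₀ : 0 < C₀) (hC : (3 * A + 2 * A + 1) * uniformConst α C A ≤ C₀)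
    (hc : δ * s * Real.log p / n ≤ c₀) (hc₀ : C₀ * c₀ ≤ 1 / 2) :
    l2norm (X.mulVec (ghat - g)) ^ 2 ≤ C₀ * s * sigmaOra X Y g ^ 2 * δ * Real.log p ∧
    l1norm (ghat - g) ≤ C₀ * s * sigmaOra X Y g * √(δ * Real.log p / n) ∧
    (|that / sigmaOra X Y g - 1| ≤ C₀ * s * δ * Real.log p / n ∧
      C₀ * s * δ * Real.log p / n ≤ 1 / 2) := by
  have hlam0 : 0 < lam := lt_of_lt_of_le (by positivity) hlam
  have hτ := rate_pos hn hp hδ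
  have hs0 : 0 ≤ s := (Nat.cast_nonneg _).trans (hsparse.card_le.trans hs)
  have hA0 : 0 < A := by
    by_contra hneg
    push Not at hneg
    nlinarith
  have hα1 : 1 ≤ α := by
    have : 0 < 2 / ε := by positivity
    linarith
  have hmax : 0 < max C 1 := lt_max_of_lt_right one_pos
  have hℓlam : ℓ ≤ lam := by nlinarith
  have hgap : lam + ℓ ≤ α * (lam - ℓ) := by
    -- The aperture 1 + 2/ε is exact: there is equality at the smallest penalty (1 + ε)ℓ.
    have h1 : α * (lam - ℓ) = (lam + ℓ) + 2 * (lam - (1 + ε) * ℓ) / ε := by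
      rw [hα]; field_simp; ring
    have h2 : 0 ≤ 2 * (lam - (1 + ε) * ℓ) / ε := div_nonneg (by linarith) hε.le
    linarith
  have hC1 : 0 ≤ uniformConst α C A := by
    unfold uniformConst
    positivity
  have hG := hsparse.l1normOn_compl_le hn hp hδ hS hs
  refine h.scaled_error_bounds hn hp hlam0 hS hδ hℓ.le hz hA (hℓlam.trans hA) hs0 hC1 hC₀ hC hc hc₀
    fun w hw hwS => ?_
  refine (l1norm_le_of_uniform hn hX hlam0 hS hα1 hcompat hz hgap (hsparse.card_le.trans hs) hG hw
    hwS).trans ?_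
  set τ := √(δ * Real.log p / n)
  set S := sigmaOra X Y g
  calc (1 + α) * (20 * max C 1 * (1 + α) * lam * s * S
        + 402 * max C 1 * ((1 + α) * (2 * s * τ * S)))
      ≤ (1 + α) * (20 * max C 1 * (1 + α) * (A * τ) * s * S
        + 402 * max C 1 * ((1 + α) * (2 * s * τ * S))) := by gcongr
    _ = (1 + α) ^ 2 * max C 1 * (20 * A + 804) * s * τ * S := by ring

end pointwise

/-! ### Passing from the noise to the residuals of a biased target. -/

/-- Stability of a bound for correlations under a change of the residual vector. -/
theorem le_mul_add_of_le_mul {x ρ N N' d : ℝ} (h1 : x ≤ ρ * N) (h2 : x ≤ N) (hρ : 0 ≤ ρ)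
    (hN' : 0 ≤ N') (hd : 0 ≤ d) (hN : N ≤ N' + d) : x ≤ ρ * N' + d := by
  rcases le_total ρ 1 with h | h
  · have := mul_le_mul_of_nonneg_left hN hρ
    nlinarith
  · nlinarith

section bias

variable {n p : ℕ} {X : Matrix (Fin n) (Fin p) ℝ} {Y : Fin n → ℝ} {g γ : Fin p → ℝ}

theorem sqrt_mul_l2norm_residual (hn : 0 < n) (g : Fin p → ℝ) :
    √(n : ℝ) * l2norm (Y - X.mulVec g) = n * sigmaOra X Y g := by
  rw [l2norm_residual hn, ← mul_assoc, Real.mul_self_sqrt (Nat.cast_nonneg n)]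

theorem sigmaOra_pos (hn : 0 < n) (h : Y - X.mulVec g ≠ 0) : 0 < sigmaOra X Y g := by
  have : 0 < √(n : ℝ) := Real.sqrt_pos.2 (by exact_mod_cast hn)
  exact div_pos (lt_of_le_of_ne (l2norm_nonneg _) fun h0 => h (l2norm_eq_zero.1 h0.symm)) this

theorem residual_eq_add (g γ : Fin p → ℝ) :
    Y - X.mulVec γ = (Y - X.mulVec g) + X.mulVec (g - γ) := by
  rw [Matrix.mulVec_sub]; abel

/-- The lower bound for C₄ is chosen so that the factor √log(p/e₁) cancels and the bias is a
fraction of S L. -/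
theorem CondBias.two_mul_l2norm_le {C₄ e₁ L m : ℝ} (hL : 0 < L) (hm : 0 < m)
    (hlog : 0 < Real.log (p / e₁)) (h : CondBias X Y g γ C₄ e₁)
    (hC₄ : √(4 / L ^ 2 * Real.log (p / e₁)) / m ≤ C₄) :
    2 * l2norm (X.mulVec (g - γ)) ≤ sigmaOra X Y g * L * m := by
  have hq : 0 < √(Real.log (p / e₁)) := Real.sqrt_pos.2 hlog
  have h1 : √(4 / L ^ 2 * Real.log (p / e₁)) = 2 / L * √(Real.log (p / e₁)) := by
    rw [Real.sqrt_mul (by positivity), show (4 : ℝ) / L ^ 2 = (2 / L) ^ 2 by ring,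
      Real.sqrt_sq (by positivity)]
  rw [h1] at hC₄
  have h2 := (mul_le_mul_of_nonneg_right hC₄ (l2norm_nonneg (X.mulVec (g - γ)))).trans h
  have h3 : √(Real.log (p / e₁)) * (2 * l2norm (X.mulVec (g - γ)))
      ≤ √(Real.log (p / e₁)) * (sigmaOra X Y g * L * m) := by
    have h4 : 2 / L * √(Real.log (p / e₁)) / m * l2norm (X.mulVec (g - γ)) * (L * m)
        = √(Real.log (p / e₁)) * (2 * l2norm (X.mulVec (g - γ))) := by
      field_simp
    have h5 := mul_le_mul_of_nonneg_right h2 (show 0 ≤ L * m by positivity)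
    rw [h4] at h5
    linarith
  exact le_of_mul_le_mul_left h3 hq

/-- Weighted averages of the correlations of the biased residuals with the design. -/
theorem sum_mul_abs_colDot_le_of_bias (hX : Standardized X) {a : Fin p → ℝ}
    (ha : ∀ j, 0 ≤ a j) (ha' : ∑ j, a j ≤ 1) {ρ : ℝ} (hρ : 0 ≤ ρ)
    (h : ∑ j, a j * |colDot X (Y - X.mulVec γ) j| ≤ ρ * (√(n : ℝ) * l2norm (Y - X.mulVec γ))) :
    ∑ j, a j * |colDot X (Y - X.mulVec g) j| ≤ ρ * (√(n : ℝ) * l2norm (Y - X.mulVec g))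
      + √(n : ℝ) * (2 * l2norm (X.mulVec (g - γ))) := by
  have hcol : ∀ j, l2norm (fun i => X i j) = √(n : ℝ) := fun j => by
    rw [← hX j]
    exact (Real.sqrt_sq (l2norm_nonneg _)).symm
  have hsn := Real.sqrt_nonneg (n : ℝ)
  have havg : ∀ e : Fin n → ℝ, ∑ j, a j * |colDot X e j| ≤ √(n : ℝ) * l2norm e := by
    intro e
    calc ∑ j, a j * |colDot X e j| ≤ ∑ j, a j * (√(n : ℝ) * l2norm e) :=
          Finset.sum_le_sum fun j _ => mul_le_mul_of_nonneg_left
            (by rw [← hcol j]; exact abs_colDot_le X e j) (ha j)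
      _ = (∑ j, a j) * (√(n : ℝ) * l2norm e) := by rw [Finset.sum_mul]
      _ ≤ 1 * (√(n : ℝ) * l2norm e) :=
          mul_le_mul_of_nonneg_right ha' (mul_nonneg hsn (l2norm_nonneg e))
      _ = _ := one_mul _
  have h1 : l2norm (Y - X.mulVec γ) ≤ l2norm (Y - X.mulVec g) + l2norm (X.mulVec (g - γ)) := by
    rw [residual_eq_add g γ]; exact l2norm_add_le _ _
  -- The bias enters twice: here when the noise norm is replaced by the residual norm, and below
  -- through its own correlations. Using the trivial bound √n‖e‖ as well, the first cost has factor
  -- one even when ρ exceeds one.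
  have h2 := le_mul_add_of_le_mul h (havg _) hρ (mul_nonneg hsn (l2norm_nonneg (Y - X.mulVec g)))
    (mul_nonneg hsn (l2norm_nonneg (X.mulVec (g - γ))))
    ((mul_le_mul_of_nonneg_left h1 hsn).trans (le_of_eq (mul_add _ _ _)))
  have h3 : ∑ j, a j * |colDot X (Y - X.mulVec g) j|
      ≤ ∑ j, a j * |colDot X (Y - X.mulVec γ) j| + ∑ j, a j * |colDot X (X.mulVec (g - γ)) j| := by
    rw [← Finset.sum_add_distrib]
    refine Finset.sum_le_sum fun j _ => ?_
    rw [← mul_add]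
    refine mul_le_mul_of_nonneg_left ?_ (ha j)
    rw [residual_eq_add (X := X) (Y := Y) g γ, colDot_add]
    have := abs_sub (colDot X (Y - X.mulVec g) j + colDot X (X.mulVec (g - γ)) j)
      (colDot X (X.mulVec (g - γ)) j)
    simpa using this
  have h4 := havg (X.mulVec (g - γ))
  linarith

theorem abs_colDot_le_of_bias (hX : Standardized X) {ρ : ℝ} (hρ : 0 ≤ ρ) {j : Fin p}
    (h : |colDot X (Y - X.mulVec γ) j| ≤ ρ * (√(n : ℝ) * l2norm (Y - X.mulVec γ))) :
    |colDot X (Y - X.mulVec g) j| ≤ ρ * (√(n : ℝ) * l2norm (Y - X.mulVec g))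
      + √(n : ℝ) * (2 * l2norm (X.mulVec (g - γ))) := by
  have hsum : ∀ y : Fin p → ℝ, ∑ i, (Pi.single j 1 : Fin p → ℝ) i * y i = y j := fun y => by
    simp [Pi.single_apply]
  have h1 := sum_mul_abs_colDot_le_of_bias (g := g) (a := Pi.single j 1) hX
    (fun i => by by_cases hij : i = j <;> simp [hij])
    (by simp [Pi.single_apply]) hρ (by rw [hsum]; exact h)
  rwa [hsum] at h1

end bias

/-! ### Exceptional events and the three regimes. -/

section assembly

variable {Ω : Type*} [MeasurableSpace Ω] {μ : Measure Ω} {n p : ℕ}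
  {X : Ω → Matrix (Fin n) (Fin p) ℝ} {Y : Ω → Fin n → ℝ} {g : Ω → Fin p → ℝ}
  {ghat : Ω → Fin p → ℝ} {σhat : Ω → ℝ} {C₀ s δ e₀ : ℝ}

/-- The error bounds hold if they hold almost everywhere outside of an unlikely set. -/
theorem ErrorBounds.of_exceptional {N : Set Ω} (hN : μ N ≤ ENNReal.ofReal ((p : ℝ) ^ (1 - δ) * e₀))
    (h : ∀ᵐ ω ∂μ, ω ∉ N →
      l2norm ((X ω).mulVec (ghat ω - g ω)) ^ 2
        ≤ C₀ * s * sigmaOra (X ω) (Y ω) (g ω) ^ 2 * δ * Real.log p ∧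
      l1norm (ghat ω - g ω) ≤ C₀ * s * sigmaOra (X ω) (Y ω) (g ω) * √(δ * Real.log p / n) ∧
      (|σhat ω / sigmaOra (X ω) (Y ω) (g ω) - 1| ≤ C₀ * s * δ * Real.log p / n ∧
        C₀ * s * δ * Real.log p / n ≤ 1 / 2)) :
    ErrorBounds μ X Y g ghat σhat C₀ s δ e₀ := by
  have key : ∀ E : Ω → Prop, (∀ᵐ ω ∂μ, ω ∉ N → E ω) →
      ProbAtLeast μ E ((p : ℝ) ^ (1 - δ) * e₀) := by
    intro E hE
    refine le_trans (measure_mono_ae ?_) hN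
    filter_upwards [hE] with ω hω hω'
    by_contra hωN
    exact hω' (hω hωN)
  exact ⟨key _ (h.mono fun ω hω hN => (hω hN).1), key _ (h.mono fun ω hω hN => (hω hN).2.1),
    key _ (h.mono fun ω hω hN => (hω hN).2.2)⟩

theorem measure_union_le_ofReal {A B : Set Ω} {x y : ℝ} (hx : 0 ≤ x) (hy : 0 ≤ y)
    (hA : μ A ≤ ENNReal.ofReal x) (hB : μ B ≤ ENNReal.ofReal y) :
    μ (A ∪ B) ≤ ENNReal.ofReal (x + y) := by
  rw [ENNReal.ofReal_add hx hy]
  exact (measure_union_le A B).trans (add_le_add hA hB)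

theorem epsOneBound_nonneg {k e₁ C₃ : ℝ} {s₂ : ℕ} (hk : 0 ≤ k)
    (hL : 0 ≤ negQuantile 1 (k / p)) (hM : 0 ≤ negQuantile 1 (e₁ / p)) :
    0 ≤ epsOneBound n p k e₁ C₃ s₂ := by
  unfold epsOneBound
  positivity

/-- As e₁ < 1, the eigenvalue condition cannot fail almost surely, so it holds for some standardized
design and forces C₃ ≥ 1. The Lipschitz constant √(C₃/s₂) is then positive. -/
theorem one_le_of_probAtLeast_condEigen [IsProbabilityMeasure μ] (hn : 0 < n) (hp : 0 < p)
    {s₃ : ℕ} (hs : 0 < s₃) {C₃ e₁ : ℝ} (he : e₁ < 1) (hX : ∀ᵐ ω ∂μ, Standardized (X ω))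
    (h : ProbAtLeast μ (fun ω => CondEigen (X ω) s₃ C₃) e₁) : 1 ≤ C₃ := by
  by_contra hC
  have h1 : ∀ᵐ ω ∂μ, ω ∈ {ω | ¬ CondEigen (X ω) s₃ C₃} := by
    filter_upwards [hX] with ω hω hE
    exact hC (hE.one_le hn hp hs hω)
  have h2 : μ {ω | ¬ CondEigen (X ω) s₃ C₃} = 1 := by
    refine le_antisymm prob_le_one ?_
    rw [← measure_univ (μ := μ)]
    exact measure_mono_ae (h1.mono fun ω hω _ => hω)
  have h3 : (1 : ℝ≥0∞) ≤ ENNReal.ofReal e₁ := h2 ▸ h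
  rw [ENNReal.one_le_ofReal] at h3
  linarith

end assembly

theorem negQuantile_pos {m t : ℝ} (hm : 0 < m) (ht : 0 < t) (ht' : t < 1 / 2) :
    0 < negQuantile m t := div_pos (stdNormalQuantile_pos ht ht') (Real.sqrt_pos.2 hm)

/-- Ratios of the quantiles do not depend on the variance parameter, so every level is a multiple of
ℓ. -/
theorem negQuantile_eq_mul {m t t' : ℝ} (ht : 0 < t) (ht' : t < 1 / 2) :
    negQuantile m t' = negQuantile m t * (negQuantile 1 t' / negQuantile 1 t) := by
  have h := stdNormalQuantile_pos ht ht'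
  rw [negQuantile_one, negQuantile_one, negQuantile, negQuantile, div_mul_div_comm, mul_comm (√m),
    mul_div_mul_left _ _ h.ne']

namespace LassoSetting

variable {Ω : Type*} [MeasurableSpace Ω] {μ : Measure Ω} [IsProbabilityMeasure μ] {n p : ℕ}
  {X : Ω → Matrix (Fin n) (Fin p) ℝ} {Y : Ω → Fin n → ℝ} {γ γt : Ω → Fin p → ℝ} {σ : ℝ}
  {ghat : Ω → Fin p → ℝ} {σhat : Ω → ℝ} {K : Ω → Finset (Fin p)}
  {lam A ε k δ s s₁ c₀ e₀ e₁ ε₁ ε₂ α C₀ C₂ C₃ C₄ : ℝ} {s₂ s₃ : ℕ}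

/-- Error bounds for the large penalty level. -/
theorem errorBounds_of_uniform (hset : LassoSetting μ X Y γ σ ghat σhat lam A ε k δ s c₀ e₁)
    (hs : s₁ ≤ s) (hk : k ≤ e₁) (hα : α = 1 + 2 / ε) (he₀ : 4 * e₁ ≤ (p : ℝ) ^ (1 - δ) * e₀)
    (hC₀ : 0 < C₀) (hC : (3 * A + 2 * A + 1) * uniformConst α C₂ A ≤ C₀) (hc₀ : C₀ * c₀ ≤ 1 / 2)
    (hsparse : ProbAtLeast μ (fun ω => CondSparse (X ω) (Y ω) (γ ω) (K ω) s₁) e₁)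
    (hcompat : ProbAtLeast μ (fun ω => CondCompat (X ω) (K ω) α 0 C₂) e₁) :
    ErrorBounds μ X Y γ ghat σhat C₀ s δ e₀ := by
  have hn := hset.two_le_n
  have hn0 : 0 < n := by omega
  have hn' : (2 : ℝ) ≤ n := by exact_mod_cast hn
  have hp0 : (0 : ℝ) < p := by exact_mod_cast (show 0 < p by linarith [hset.two_le_p])
  have ht0 : 0 < k / p := div_pos hset.k_pos hp0
  have ht1 : k / p < 1 / 2 := by rw [div_lt_iff₀ hp0]; linarith [hset.k_lt]
  have hℓ := negQuantile_pos (m := (n : ℝ) - 3 / 2) (by linarith) ht0 ht1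
  have hA := hset.model.measure_max_colDot_le hn ht0 ht1
  have h2k : 2 * p * (k / p) ≤ 2 * e₁ := by
    rw [mul_assoc, mul_div_cancel₀ _ hp0.ne']; linarith
  have he := hset.e₁_pos.le
  -- Budget: e₁ for each of the two conditions and 2k ≤ 2e₁ for the correlations.
  refine ErrorBounds.of_exceptional ((measure_union_le_ofReal (add_nonneg he he)
    (mul_nonneg zero_le_two he) (measure_union_le_ofReal he he hsparse hcompat)
    (hA.trans (ENNReal.ofReal_le_ofReal h2k))).trans (ENNReal.ofReal_le_ofReal (by linarith))) ?_
  filter_upwards [hset.model.standardized, hset.estimator, hset.model.ae_noise_ne_zero hn0]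
    with ω hX hest hne hω
  simp only [Set.mem_union, Set.mem_ofPred_eq, not_or, not_not, not_and, not_exists, not_lt] at hω
  obtain ⟨⟨h1, h2⟩, h3⟩ := hω
  refine hest.error_bounds_of_uniform hn0 hset.two_le_p hX (sigmaOra_pos hn0 hne) hℓ hset.eps_pos hα
    hset.penalty_ge hset.penalty_le hset.one_le_delta h1 hs h2 (fun j => ?_) hC₀ hC hset.sample_size
    hc₀
  have := h3 hX j
  rwa [sqrt_mul_l2norm_residual hn0, mul_comm] at this

/-- Error bounds for the smaller penalty levels. -/
theorem errorBounds_of_average (hset : LassoSetting μ X Y γ σ ghat σhat lam A ε k δ s c₀ e₁)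
    (hs : s₁ + s₂ ≤ s) (hs₂ : 1 ≤ s₂) (hs₃ : s₂ ≤ s₃) (hk : 1 ≤ k)
    (hε₁ : epsOneBound n p k e₁ C₃ s₂ ≤ ε₁) (hε₁ε : ε₁ < ε)
    (hα : √2 * (ε - ε₁)⁻¹ * (1 + ε + negQuantile 1 (e₁ / p) / negQuantile 1 (k / p)) ≤ α)
    (he₀ : (5 + Real.exp (1 / (4 * (n : ℝ) - 6) ^ 2)) * e₁ ≤ (p : ℝ) ^ (1 - δ) * e₀)
    (hC₀ : 0 < C₀) (hC : (3 * A + 2 * (α * A) + 1) * averageConst α ε ε₁ C₂ A ≤ C₀)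
    (hc₀ : C₀ * c₀ ≤ 1 / 2)
    (hsparse : ProbAtLeast μ (fun ω => CondSparse (X ω) (Y ω) (γ ω) (K ω) s₁) e₁)
    (hcompat : ProbAtLeast μ (fun ω => CondCompat (X ω) (K ω) α s₂ C₂) e₁)
    (heigen : ProbAtLeast μ (fun ω => CondEigen (X ω) s₃ C₃) e₁) :
    ErrorBounds μ X Y γ ghat σhat C₀ s δ e₀ := by
  have hn := hset.two_le_n
  have hn0 : 0 < n := by omega
  have hn' : (2 : ℝ) ≤ n := by exact_mod_cast hn
  have hp := hset.two_le_p
  have hp0 : (0 : ℝ) < p := by exact_mod_cast (show 0 < p by omega)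
  have hν : (0 : ℝ) < n - 3 / 2 := by linarith
  have he := hset.e₁_pos
  have he1 := hset.e₁_lt_one
  have hkp := hset.k_lt
  have hε := hset.eps_pos
  have ht0 : 0 < k / p := div_pos hset.k_pos hp0
  have ht1 : k / p < 1 / 2 := by rw [div_lt_iff₀ hp0]; linarith
  have hu0 : 0 < e₁ / p := div_pos he hp0
  have hut : e₁ / p ≤ k / p := div_le_div_of_nonneg_right (by linarith) hp0.le
  have hu1 : e₁ / p < 1 / 2 := by linarith
  have hℓ := negQuantile_pos hν ht0 ht1
  have hL := negQuantile_pos one_pos ht0 ht1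
  have hM := negQuantile_pos one_pos hu0 hu1
  have hε₁0 : 0 ≤ ε₁ := (epsOneBound_nonneg hset.k_pos.le hL.le hM.le).trans hε₁
  have hMb : negQuantile (n - 3 / 2) (e₁ / p) = negQuantile (n - 3 / 2) (k / p)
      * (negQuantile 1 (e₁ / p) / negQuantile 1 (k / p)) := negQuantile_eq_mul ht0 ht1
  have hb : 1 ≤ negQuantile 1 (e₁ / p) / negQuantile 1 (k / p) := by
    rw [one_le_div hL, negQuantile_one, negQuantile_one]
    exact stdNormalQuantile_le hu0 hut (by linarith)
  set b := negQuantile 1 (e₁ / p) / negQuantile 1 (k / p)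
  have hd : 0 < ε - ε₁ := by linarith
  have hsqrt : (1.4142 : ℝ) ≤ √2 := Real.le_sqrt_of_sq_le (by norm_num)
  have hαd : √2 * (1 + ε + b) ≤ α * (ε - ε₁) := by
    have h1 := mul_le_mul_of_nonneg_right hα hd.le
    have h2 : √2 * (ε - ε₁)⁻¹ * (1 + ε + b) * (ε - ε₁) = √2 * (1 + ε + b) := by field_simp
    linarith
  have hα2 : √2 ≤ α := by
    have h1 : √2 * (ε - ε₁) ≤ α * (ε - ε₁) :=
      (mul_le_mul_of_nonneg_left (by linarith) (by positivity)).trans hαd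
    exact le_of_mul_le_mul_right h1 hd
  have hα1 : 1 ≤ α := by linarith
  -- Because b ≥ 1, the surplus 0.94√2 - 1 > 0.329 acts on at least 2 and covers 0.65.
  have hαb : 1 + ε + b + 0.65 ≤ 0.94 * (α * (ε - ε₁)) := by
    have := mul_le_mul_of_nonneg_right hsqrt (show 0 ≤ 1 + ε + b by linarith)
    linarith
  have hC₃ := one_le_of_probAtLeast_condEigen hn0 (by omega) (by omega) he1
    hset.model.standardized heigen
  have hA := hset.model.measure_max_colDot_le hn hu0 hu1
  have hB := hset.model.measure_average_colDot_le_of_condEigen hn hk hkp he he1 hC₃ hα2 hs₂ hs₃ hε₁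
  have h2e : 2 * p * (e₁ / p) ≤ 2 * e₁ := by
    rw [mul_assoc, mul_div_cancel₀ _ hp0.ne']
  have hexp : 1 ≤ Real.exp (1 / (4 * (n : ℝ) - 6) ^ 2) := Real.one_le_exp (by positivity)
  -- Three conditions, 2e₁ for the largest correlation and e₁ for the averages: six in all, within 5
  -- + exp(·).
  have hbound : e₁ + e₁ + e₁ + 2 * e₁ + e₁ ≤ (p : ℝ) ^ (1 - δ) * e₀ := by nlinarith
  refine ErrorBounds.of_exceptional ((measure_union_le_ofReal (by positivity) he.le
    (measure_union_le_ofReal (by positivity) (by positivity)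
      (measure_union_le_ofReal (by positivity) he.le
        (measure_union_le_ofReal he.le he.le hsparse hcompat) heigen)
      (hA.trans (ENNReal.ofReal_le_ofReal h2e))) hB).trans (ENNReal.ofReal_le_ofReal hbound)) ?_
  filter_upwards [hset.model.standardized, hset.estimator, hset.model.ae_noise_ne_zero hn0]
    with ω hX hest hne hω
  simp only [Set.mem_union, Set.mem_ofPred_eq, not_or, not_not, not_and, not_exists, not_lt] at hω
  obtain ⟨⟨⟨⟨h1, h2⟩, h3⟩, h4⟩, h5⟩ := hω
  refine hest.error_bounds_of_average hn0 hp (sigmaOra_pos hn0 hne) hs₂ hℓ hε hε₁0 hε₁ε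
    (zero_le_one.trans hb) hα1 hαb hset.penalty_ge hset.penalty_le hset.one_le_delta h1 hs h2
    (fun j => ?_) (fun a ha => ?_) hC₀ hC hset.sample_size hc₀
  · have := h4 hX j
    rwa [sqrt_mul_l2norm_residual hn0, mul_comm, hMb] at this
  · have := h5 hX h3 a ha
    rwa [sqrt_mul_l2norm_residual hn0, mul_comm] at this

/-- Error bounds for a biased target vector. -/
theorem errorBounds_of_bias (hset : LassoSetting μ X Y γ σ ghat σhat lam A ε k δ s c₀ e₁)
    (hs : s₁ + s₂ ≤ s) (hs₂ : 1 ≤ s₂) (hs₃ : s₂ ≤ s₃) (hk : 1 ≤ k)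
    (hε₁ : epsOneBound n p k e₁ C₃ s₂ ≤ ε₁) (hε₁₂ : ε₁ < ε₂) (hε₂ε : ε₂ < ε)
    (hα : 2 * (ε - ε₂)⁻¹ * (1 + ε + negQuantile 1 (e₁ / p) / negQuantile 1 (k / p)) ≤ α)
    (he₀ : (6 + Real.exp (1 / (4 * (n : ℝ) - 6) ^ 2)) * e₁ ≤ (p : ℝ) ^ (1 - δ) * e₀)
    (hC₄ : √(4 / negQuantile 1 (k / p) ^ 2 * Real.log (p / e₁)) / min (√2 - 1) (ε₂ - ε₁) ≤ C₄)
    (hC₀ : 0 < C₀) (hC : (3 * A + 2 * (α * A) + 1) * averageConst α ε ε₂ C₂ A ≤ C₀)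
    (hc₀ : C₀ * c₀ ≤ 1 / 2)
    (hsparse : ProbAtLeast μ (fun ω => CondSparse (X ω) (Y ω) (γt ω) (K ω) s₁) e₁)
    (hcompat : ProbAtLeast μ (fun ω => CondCompat (X ω) (K ω) α s₂ C₂) e₁)
    (heigen : ProbAtLeast μ (fun ω => CondEigen (X ω) s₃ C₃) e₁)
    (hbias : ProbAtLeast μ (fun ω => CondBias (X ω) (Y ω) (γt ω) (γ ω) C₄ e₁) e₁) :
    ErrorBounds μ X Y γt ghat σhat C₀ s δ e₀ := by
  have hn := hset.two_le_n
  have hn0 : 0 < n := by omega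
  have hn' : (2 : ℝ) ≤ n := by exact_mod_cast hn
  have hp := hset.two_le_p
  have hp' : (2 : ℝ) ≤ p := by exact_mod_cast hp
  have hp0 : (0 : ℝ) < p := by linarith
  have hν : (0 : ℝ) < n - 3 / 2 := by linarith
  have he := hset.e₁_pos
  have he1 := hset.e₁_lt_one
  have hkp := hset.k_lt
  have hε := hset.eps_pos
  have ht0 : 0 < k / p := div_pos hset.k_pos hp0
  have ht1 : k / p < 1 / 2 := by rw [div_lt_iff₀ hp0]; linarith
  have hu0 : 0 < e₁ / p := div_pos he hp0
  have hut : e₁ / p ≤ k / p := div_le_div_of_nonneg_right (by linarith) hp0.le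
  have hu1 : e₁ / p < 1 / 2 := by linarith
  have hℓ := negQuantile_pos hν ht0 ht1
  have hL := negQuantile_pos one_pos ht0 ht1
  have hM := negQuantile_pos one_pos hu0 hu1
  have hε₁0 : 0 ≤ ε₁ := (epsOneBound_nonneg hset.k_pos.le hL.le hM.le).trans hε₁
  have hMb : negQuantile (n - 3 / 2) (e₁ / p) = negQuantile (n - 3 / 2) (k / p)
      * (negQuantile 1 (e₁ / p) / negQuantile 1 (k / p)) := negQuantile_eq_mul ht0 ht1
  have hb : 1 ≤ negQuantile 1 (e₁ / p) / negQuantile 1 (k / p) := by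
    rw [one_le_div hL, negQuantile_one, negQuantile_one]
    exact stdNormalQuantile_le hu0 hut (by linarith)
  set b := negQuantile 1 (e₁ / p) / negQuantile 1 (k / p)
  have hd : 0 < ε - ε₂ := by linarith
  have hsqrt : (1.4 : ℝ) ≤ √2 := Real.le_sqrt_of_sq_le (by norm_num)
  have hsqrt' : √2 ≤ 1.42 := Real.sqrt_le_iff.2 ⟨by norm_num, by norm_num⟩
  have hαd : 2 * (1 + ε + b) ≤ α * (ε - ε₂) := by
    have h1 := mul_le_mul_of_nonneg_right hα hd.le
    have h2 : 2 * (ε - ε₂)⁻¹ * (1 + ε + b) * (ε - ε₂) = 2 * (1 + ε + b) := by field_simp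
    linarith
  have hα2 : 2 ≤ α := by
    have h1 : 2 * (ε - ε₂) ≤ α * (ε - ε₂) :=
      (mul_le_mul_of_nonneg_left (by linarith) (by positivity)).trans hαd
    exact le_of_mul_le_mul_right h1 hd
  have hα1 : 1 ≤ α := by linarith
  have hα0 : 0 < α := by linarith
  have hm : 0 < min (√2 - 1) (ε₂ - ε₁) := lt_min (by linarith) (by linarith)
  have hm1 := min_le_left (√2 - 1) (ε₂ - ε₁)
  have hm2 := min_le_right (√2 - 1) (ε₂ - ε₁)
  set m := min (√2 - 1) (ε₂ - ε₁)
  have hαb : 1 + ε + (b + m) + 0.65 ≤ 0.94 * (α * (ε - ε₂)) := by linarith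
  have hlog : 0 < Real.log (p / e₁) := Real.log_pos (by rw [one_lt_div he]; linarith)
  have hC₃ := one_le_of_probAtLeast_condEigen hn0 (by omega) (by omega) he1
    hset.model.standardized heigen
  have hA := hset.model.measure_max_colDot_le hn hu0 hu1
  have hB := hset.model.measure_average_colDot_le_of_condEigen hn hk hkp he he1 hC₃
    (show √2 ≤ α by linarith) hs₂ hs₃ hε₁
  have h2e : 2 * p * (e₁ / p) ≤ 2 * e₁ := by
    rw [mul_assoc, mul_div_cancel₀ _ hp0.ne']
  have hexp : 1 ≤ Real.exp (1 / (4 * (n : ℝ) - 6) ^ 2) := Real.one_le_exp (by positivity)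
  have hbound : e₁ + e₁ + e₁ + e₁ + 2 * e₁ + e₁ ≤ (p : ℝ) ^ (1 - δ) * e₀ := by nlinarith
  refine ErrorBounds.of_exceptional ((measure_union_le_ofReal (by positivity) he.le
    (measure_union_le_ofReal (by positivity) (by positivity)
      (measure_union_le_ofReal (by positivity) he.le
        (measure_union_le_ofReal (by positivity) he.le
          (measure_union_le_ofReal he.le he.le hsparse hcompat) heigen) hbias)
      (hA.trans (ENNReal.ofReal_le_ofReal h2e))) hB).trans (ENNReal.ofReal_le_ofReal hbound)) ?_
  filter_upwards [hset.model.standardized, hset.estimator, hset.model.ae_noise_ne_zero hn0]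
    with ω hX hest hne hω
  simp only [Set.mem_union, Set.mem_ofPred_eq, not_or, not_not, not_and, not_exists, not_lt] at hω
  obtain ⟨⟨⟨⟨⟨h1, h2⟩, h3⟩, hb4⟩, h4⟩, h5⟩ := hω
  have hΔ := hb4.two_mul_l2norm_le hL hm hlog hC₄
  -- If the target fitted `Y` exactly, the bias bound would force X(γt - γ) = 0, and the noise would
  -- vanish.
  have hS : 0 < sigmaOra (X ω) (Y ω) (γt ω) := by
    refine lt_of_le_of_ne (sigmaOra_nonneg _) fun h0 => hne ?_
    rw [← h0, zero_mul, zero_mul] at hΔ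
    have hΔ0 : (X ω).mulVec (γt ω - γ ω) = 0 :=
      l2norm_eq_zero.1 (le_antisymm (by linarith) (l2norm_nonneg _))
    rw [residual_eq_add (γt ω) (γ ω), hΔ0, add_zero]
    refine l2norm_eq_zero.1 ?_
    rw [l2norm_residual hn0, ← h0, mul_zero]
  have hΔ' : √(n : ℝ) * (2 * l2norm ((X ω).mulVec (γt ω - γ ω)))
      ≤ n * sigmaOra (X ω) (Y ω) (γt ω) * (negQuantile (n - 3 / 2) (k / p) * m) := by
    have hsn : 0 ≤ √(n : ℝ) := Real.sqrt_nonneg _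
    have hLν : negQuantile 1 (k / p) = √((n : ℝ) - 3 / 2) * negQuantile (n - 3 / 2) (k / p) := by
      rw [sqrt_mul_negQuantile hν, negQuantile_one]
    -- L₁ and L_{n-3/2} differ by the factor √(n - 3/2), so the bias is at most m ℓ in units of n S.
    have hνn : √(n : ℝ) * √((n : ℝ) - 3 / 2) ≤ n := by
      calc √(n : ℝ) * √((n : ℝ) - 3 / 2) ≤ √(n : ℝ) * √(n : ℝ) :=
            mul_le_mul_of_nonneg_left (Real.sqrt_le_sqrt (by linarith)) hsn
        _ = n := Real.mul_self_sqrt (Nat.cast_nonneg n)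
    refine (mul_le_mul_of_nonneg_left hΔ hsn).trans ?_
    rw [hLν]
    calc √(n : ℝ) * (sigmaOra (X ω) (Y ω) (γt ω)
          * (√((n : ℝ) - 3 / 2) * negQuantile (n - 3 / 2) (k / p)) * m)
        = (√(n : ℝ) * √((n : ℝ) - 3 / 2))
          * (sigmaOra (X ω) (Y ω) (γt ω) * (negQuantile (n - 3 / 2) (k / p) * m)) := by ring
      _ ≤ n * (sigmaOra (X ω) (Y ω) (γt ω) * (negQuantile (n - 3 / 2) (k / p) * m)) :=
          mul_le_mul_of_nonneg_right hνn (by positivity)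
      _ = _ := by ring
  refine hest.error_bounds_of_average hn0 hp hS hs₂ hℓ hε (hε₁0.trans hε₁₂.le) hε₂ε
    (show 0 ≤ b + m by linarith) hα1 hαb hset.penalty_ge hset.penalty_le hset.one_le_delta h1 hs h2
    (fun j => ?_) (fun a ha => ?_) hC₀ hC hset.sample_size hc₀
  · have hM' : 0 ≤ negQuantile (n - 3 / 2) (e₁ / p) := (negQuantile_pos hν hu0 hu1).le
    have := abs_colDot_le_of_bias (g := γt ω) hX hM' (h4 hX j)
    rw [sqrt_mul_l2norm_residual hn0, hMb] at this
    linarith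
  · have := sum_mul_abs_colDot_le_of_bias (g := γt ω) hX (fun j => (ha.1 j).1) ha.2
      (by positivity) (h5 hX h3 a ha)
    rw [sqrt_mul_l2norm_residual hn0] at this
    -- As m ≤ ε₂ - ε₁, the bias raises the relative level of the averages from ε₁ to at most ε₂.
    have h6 : n * sigmaOra (X ω) (Y ω) (γt ω) * (negQuantile (n - 3 / 2) (k / p) * m)
        ≤ n * sigmaOra (X ω) (Y ω) (γt ω) * (negQuantile (n - 3 / 2) (k / p) * (ε₂ - ε₁)) := by
      gcongr
    linarith

end LassoSetting
theorem theorem10 :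
    -- (i) large penalty level
    (∀ α C₂ A : ℝ, ∃ C₀ : ℝ, 0 < C₀ ∧
      ∀ (Ω : Type*) [MeasurableSpace Ω] (μ : Measure Ω) [IsProbabilityMeasure μ] (n p : ℕ)
        (X : Ω → Matrix (Fin n) (Fin p) ℝ) (Y : Ω → Fin n → ℝ) (γ : Ω → Fin p → ℝ) (σ : ℝ)
        (ghat : Ω → Fin p → ℝ) (σhat : Ω → ℝ) (K : Ω → Finset (Fin p))
        (lam ε k δ s s₁ c₀ e₀ e₁ : ℝ),
        LassoSetting μ X Y γ σ ghat σhat lam A ε k δ s c₀ e₁ →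
        s₁ ≤ s →
        k ≤ e₁ →
        α = 1 + 2 / ε →
        4 * e₁ ≤ (p : ℝ) ^ (1 - δ) * e₀ →
        C₀ * c₀ ≤ 1 / 2 →
        ProbAtLeast μ (fun ω => CondSparse (X ω) (Y ω) (γ ω) (K ω) s₁) e₁ →
        ProbAtLeast μ (fun ω => CondCompat (X ω) (K ω) α 0 C₂) e₁ →
        ErrorBounds μ X Y γ ghat σhat C₀ s δ e₀) ∧
    -- (ii) smaller penalty level
    (∀ α ε ε₁ C₂ A : ℝ, ∃ C₀ : ℝ, 0 < C₀ ∧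
      ∀ (Ω : Type*) [MeasurableSpace Ω] (μ : Measure Ω) [IsProbabilityMeasure μ] (n p : ℕ)
        (X : Ω → Matrix (Fin n) (Fin p) ℝ) (Y : Ω → Fin n → ℝ) (γ : Ω → Fin p → ℝ) (σ : ℝ)
        (ghat : Ω → Fin p → ℝ) (σhat : Ω → ℝ) (K : Ω → Finset (Fin p))
        (lam k δ s s₁ c₀ e₀ e₁ C₃ : ℝ) (s₂ s₃ : ℕ),
        LassoSetting μ X Y γ σ ghat σhat lam A ε k δ s c₀ e₁ →
        s₁ + s₂ ≤ s →
        1 ≤ s₂ → s₂ ≤ s₃ →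
        1 ≤ k →
        epsOneBound n p k e₁ C₃ s₂ ≤ ε₁ → ε₁ < ε →
        √2 * (ε - ε₁)⁻¹ * (1 + ε + negQuantile 1 (e₁ / p) / negQuantile 1 (k / p)) ≤ α →
        (5 + Real.exp (1 / (4 * (n : ℝ) - 6) ^ 2)) * e₁ ≤ (p : ℝ) ^ (1 - δ) * e₀ →
        C₀ * c₀ ≤ 1 / 2 →
        ProbAtLeast μ (fun ω => CondSparse (X ω) (Y ω) (γ ω) (K ω) s₁) e₁ →
        ProbAtLeast μ (fun ω => CondCompat (X ω) (K ω) α s₂ C₂) e₁ →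
        ProbAtLeast μ (fun ω => CondEigen (X ω) s₃ C₃) e₁ →
        ErrorBounds μ X Y γ ghat σhat C₀ s δ e₀) ∧
    -- (iii) biased target vector `γt`
    (∀ α ε ε₂ C₂ A : ℝ, ∃ C₀ : ℝ, 0 < C₀ ∧
      ∀ (Ω : Type*) [MeasurableSpace Ω] (μ : Measure Ω) [IsProbabilityMeasure μ] (n p : ℕ)
        (X : Ω → Matrix (Fin n) (Fin p) ℝ) (Y : Ω → Fin n → ℝ) (γ γt : Ω → Fin p → ℝ) (σ : ℝ)
        (ghat : Ω → Fin p → ℝ) (σhat : Ω → ℝ) (K : Ω → Finset (Fin p))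
        (lam k δ s s₁ c₀ e₀ e₁ ε₁ C₃ C₄ : ℝ) (s₂ s₃ : ℕ),
        LassoSetting μ X Y γ σ ghat σhat lam A ε k δ s c₀ e₁ →
        s₁ + s₂ ≤ s →
        1 ≤ s₂ → s₂ ≤ s₃ →
        1 ≤ k →
        epsOneBound n p k e₁ C₃ s₂ ≤ ε₁ → ε₁ < ε₂ → ε₂ < ε →
        2 * (ε - ε₂)⁻¹ * (1 + ε + negQuantile 1 (e₁ / p) / negQuantile 1 (k / p)) ≤ α →
        (6 + Real.exp (1 / (4 * (n : ℝ) - 6) ^ 2)) * e₁ ≤ (p : ℝ) ^ (1 - δ) * e₀ →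
        √(4 / negQuantile 1 (k / p) ^ 2 * Real.log (p / e₁)) / min (√2 - 1) (ε₂ - ε₁) ≤ C₄ →
        C₀ * c₀ ≤ 1 / 2 →
        ProbAtLeast μ (fun ω => CondSparse (X ω) (Y ω) (γt ω) (K ω) s₁) e₁ →
        ProbAtLeast μ (fun ω => CondCompat (X ω) (K ω) α s₂ C₂) e₁ →
        ProbAtLeast μ (fun ω => CondEigen (X ω) s₃ C₃) e₁ →
        ProbAtLeast μ (fun ω => CondBias (X ω) (Y ω) (γt ω) (γ ω) C₄ e₁) e₁ →
        ErrorBounds μ X Y γt ghat σhat C₀ s δ e₀) := by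
  -- The absolute value and the summand one make the constant positive for all parameters, before
  -- the setting forces A > 0.
  refine ⟨fun α C₂ A => ⟨1 + |(3 * A + 2 * A + 1) * uniformConst α C₂ A|, by positivity, ?_⟩,
    fun α ε ε₁ C₂ A =>
      ⟨1 + |(3 * A + 2 * (α * A) + 1) * averageConst α ε ε₁ C₂ A|, by positivity, ?_⟩,
    fun α ε ε₂ C₂ A =>
      ⟨1 + |(3 * A + 2 * (α * A) + 1) * averageConst α ε ε₂ C₂ A|, by positivity, ?_⟩⟩
  · intro Ω _ μ _ n p X Y γ σ ghat σhat K lam ε k δ s s₁ c₀ e₀ e₁ hset hs hk hα he₀ hc₀ h1 h2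
    exact hset.errorBounds_of_uniform hs hk hα he₀ (by positivity)
      ((le_abs_self _).trans (by linarith)) hc₀ h1 h2
  · intro Ω _ μ _ n p X Y γ σ ghat σhat K lam k δ s s₁ c₀ e₀ e₁ C₃ s₂ s₃ hset hs hs₂ hs₃ hk hε₁
      hε₁ε hα he₀ hc₀ h1 h2 h3
    exact hset.errorBounds_of_average hs hs₂ hs₃ hk hε₁ hε₁ε hα he₀ (by positivity)
      ((le_abs_self _).trans (by linarith)) hc₀ h1 h2 h3
  · intro Ω _ μ _ n p X Y γ γt σ ghat σhat K lam k δ s s₁ c₀ e₀ e₁ ε₁ C₃ C₄ s₂ s₃ hset hs hs₂ hs₃ hk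
      hε₁ hε₁₂ hε₂ε hα he₀ hC₄ hc₀ h1 h2 h3 h4
    exact hset.errorBounds_of_bias hs hs₂ hs₃ hk hε₁ hε₁₂ hε₂ε hα he₀ hC₄ (by positivity)
      ((le_abs_self _).trans (by linarith)) hc₀ h1 h2 h3 h4
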